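/- **Language.** Parameters $a,b,c,\dots$ (countably many) are the free individual variables; $x,y,\dots$ are bound variables. Formulas are built from $Et$ (existence), identities $t=s$ and predications $P(t_1,\dots,t_n)$ (predicate symbols of any arity) by $\neg,\wedge,\to,\forall$. Terms are parameters, variables, and descriptions $\imath x\varphi$ whose body $\varphi$ contains no description. Atomic formulas are predications, identities and formulas $Et$. A *bisequent* $\Gamma\Rightarrow\Delta\mid\Pi\Rightarrow\Sigma$ consists of four finite multisets of formulas without free occurrences of bound variables. Below, $t,s$ are closed terms, $d$ is a closed description, $b,c$ are arbitrary parameters, $a$ is a parameter not occurring in the conclusion of the rule (an eigenparameter), and $S$ is a sequent that stays unchanged. "$B_1;\dots;B_k\ /\ B$" denotes the rule with premises $B_i$ and conclusion $B$. **Axioms.** $\Gamma\Rightarrow\Delta\mid\Pi\Rightarrow\Sigma$ if some atomic formula lies in $\Gamma\cap\Sigma$, in $\Gamma\cap\Delta$ or in $\Pi\cap\Sigma$; and $Et_1,\dots,Et_n,\Gamma\Rightarrow\Delta,P\mid P,\Pi\Rightarrow\Sigma$, where $P$ is a predication or an identity and $t_1,\dots,t_n$ is a list (order and repetitions immaterial)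 of exactly the arguments of $P$. **Propositional rules common to both variants.** - $\Gamma\Rightarrow\Delta\mid\Pi\Rightarrow\Sigma,\varphi\ /\ \neg\varphi,\Gamma\Rightarrow\Delta\mid\Pi\Rightarrow\Sigma$ - $\Gamma\Rightarrow\Delta\mid\varphi,\Pi\Rightarrow\Sigma\ /\ \Gamma\Rightarrow\Delta,\neg\varphi\mid\Pi\Rightarrow\Sigma$ - $\Gamma\Rightarrow\Delta,\varphi\mid\Pi\Rightarrow\Sigma\ /\ \Gamma\Rightarrow\Delta\mid\neg\varphi,\Pi\Rightarrow\Sigma$ - $\varphi,\Gamma\Rightarrow\Delta\mid\Pi\Rightarrow\Sigma\ /\ \Gamma\Rightarrow\Delta\mid\Pi\Rightarrow\Sigma,\neg\varphi$ - $\varphi,\psi,\Gamma\Rightarrow\Delta\mid S\ /\ \varphi\wedge\psi,\Gamma\Rightarrow\Delta\mid S$ - $\Gamma\Rightarrow\Delta,\varphi\mid S;\ \Gamma\Rightarrow\Delta,\psi\mid S\ /\ \Gamma\Rightarrow\Delta,\varphi\wedge\psi\mid S$ - $\Gamma\Rightarrow\Delta,\varphi\mid\Pi\Rightarrow\Sigma;\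 \Gamma\Rightarrow\Delta\mid\psi,\Pi\Rightarrow\Sigma\ /\ \Gamma\Rightarrow\Delta\mid\varphi\to\psi,\Pi\Rightarrow\Sigma$ - $\varphi,\Gamma\Rightarrow\Delta\mid\Pi\Rightarrow\Sigma,\psi\ /\ \Gamma\Rightarrow\Delta\mid\Pi\Rightarrow\Sigma,\varphi\to\psi$ **Strong Kleene variant $K_3$, additionally.** - $S\mid\varphi,\psi,\Pi\Rightarrow\Sigma\ /\ S\mid\varphi\wedge\psi,\Pi\Rightarrow\Sigma$ - $S\mid\Pi\Rightarrow\Sigma,\varphi;\ S\mid\Pi\Rightarrow\Sigma,\psi\ /\ S\mid\Pi\Rightarrow\Sigma,\varphi\wedge\psi$ - $\Gamma\Rightarrow\Delta,\psi\mid\varphi,\Pi\Rightarrow\Sigma\ /\ \Gamma\Rightarrow\Delta,\varphi\to\psi\mid\Pi\Rightarrow\Sigma$ - $\Gamma\Rightarrow\Delta\mid\Pi\Rightarrow\Sigma,\varphi;\ \psi,\Gamma\Rightarrow\Delta\mid\Pi\Rightarrow\Sigma\ /\ \varphi\to\psi,\Gamma\Rightarrow\Delta\mid\Pi\Rightarrow\Sigma$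 **Weak Kleene variant $K_3^w$, instead of these four.** - $\Gamma\Rightarrow\Delta\mid\varphi,\psi,\Pi\Rightarrow\Sigma;\ \Gamma\Rightarrow\Delta,\varphi\mid\varphi,\Pi\Rightarrow\Sigma;\ \Gamma\Rightarrow\Delta,\psi\mid\psi,\Pi\Rightarrow\Sigma\ /\ \Gamma\Rightarrow\Delta\mid\varphi\wedge\psi,\Pi\Rightarrow\Sigma$ - $\Gamma\Rightarrow\Delta\mid\Pi\Rightarrow\Sigma,\varphi,\psi;\ \varphi,\Gamma\Rightarrow\Delta\mid\Pi\Rightarrow\Sigma,\psi;\ \psi,\Gamma\Rightarrow\Delta\mid\Pi\Rightarrow\Sigma,\varphi\ /\ \Gamma\Rightarrow\Delta\mid\Pi\Rightarrow\Sigma,\varphi\wedge\psi$ - $\Gamma\Rightarrow\Delta,\psi\mid\varphi,\Pi\Rightarrow\Sigma;\ \Gamma\Rightarrow\Delta,\varphi\mid\varphi,\Pi\Rightarrow\Sigma;\ \Gamma\Rightarrow\Delta,\psi\mid\psi,\Pi\Rightarrow\Sigma\ /\ \Gamma\Rightarrow\Delta,\varphi\to\psi\mid\Pi\Rightarrow\Sigma$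 - $\varphi,\psi,\Gamma\Rightarrow\Delta\mid\Pi\Rightarrow\Sigma;\ \Gamma\Rightarrow\Delta\mid\Pi\Rightarrow\Sigma,\varphi,\psi;\ \psi,\Gamma\Rightarrow\Delta\mid\Pi\Rightarrow\Sigma,\varphi\ /\ \varphi\to\psi,\Gamma\Rightarrow\Delta\mid\Pi\Rightarrow\Sigma$ **Quantifier rules.** - $Ea,\Gamma\Rightarrow\Delta,\varphi[x/a]\mid S\ /\ \Gamma\Rightarrow\Delta,\forall x\varphi\mid S$ - $Ea,\Gamma\Rightarrow\Delta\mid\Pi\Rightarrow\Sigma,\varphi[x/a]\ /\ \Gamma\Rightarrow\Delta\mid\Pi\Rightarrow\Sigma,\forall x\varphi$ - $Eb,\forall x\varphi,\varphi[x/b],\Gamma\Rightarrow\Delta\mid S\ /\ Eb,\forall x\varphi,\Gamma\Rightarrow\Delta\mid S$ - $Eb,\Gamma\Rightarrow\Delta\mid\forall x\varphi,\varphi[x/b],\Pi\Rightarrow\Sigma\ /\ Eb,\Gamma\Rightarrow\Delta\mid\forall x\varphi,\Pi\Rightarrow\Sigma$ **Existence rules.** In the first four, $P$ is a predication or an identity,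 but not an identity of the form $b=d$; $t$ is an argument of $P$, and $t_1,\dots,t_n$ is a list of exactly the arguments of $P$. - $Et,P,\Gamma\Rightarrow\Delta\mid S\ /\ P,\Gamma\Rightarrow\Delta\mid S$ - $Et,\Gamma\Rightarrow\Delta\mid\Pi\Rightarrow\Sigma,P\ /\ \Gamma\Rightarrow\Delta\mid\Pi\Rightarrow\Sigma,P$ - $Et_1,\dots,Et_n,P,\Gamma\Rightarrow\Delta\mid\Pi\Rightarrow\Sigma\ /\ Et_1,\dots,Et_n,\Gamma\Rightarrow\Delta\mid P,\Pi\Rightarrow\Sigma$ - $Et_1,\dots,Et_n,\Gamma\Rightarrow\Delta\mid\Pi\Rightarrow\Sigma,P\ /\ Et_1,\dots,Et_n,\Gamma\Rightarrow\Delta,P\mid\Pi\Rightarrow\Sigma$ - $Et,\Gamma\Rightarrow\Delta\mid\Pi\Rightarrow\Sigma\ /\ \Gamma\Rightarrow\Delta\mid Et,\Pi\Rightarrow\Sigma$ - $\Gamma\Rightarrow\Delta\mid\Pi\Rightarrow\Sigma,Et\ /\ \Gamma\Rightarrow\Delta,Et\mid\Pi\Rightarrow\Sigma$ **Identity rules.**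 In the replacement rule, $A[x/t]$ and $A[x/s]$ are atomic and $t\approx s$ is $t=s$ or $s=t$. It is taken in one of two forms; each calculus contains exactly one of them. - Replacement, form (II): $\Gamma\Rightarrow\Delta\mid\Pi\Rightarrow\Sigma,t\approx s;\ \Gamma\Rightarrow\Delta\mid\Pi\Rightarrow\Sigma,A[x/t];\ A[x/s],\Gamma\Rightarrow\Delta\mid\Pi\Rightarrow\Sigma\ /\ \Gamma\Rightarrow\Delta\mid\Pi\Rightarrow\Sigma$ - Replacement, form (I): $\Gamma\Rightarrow\Delta,t\approx s\mid\Pi\Rightarrow\Sigma;\ \Gamma\Rightarrow\Delta,A[x/t]\mid\Pi\Rightarrow\Sigma;\ A[x/s],\Gamma\Rightarrow\Delta\mid\Pi\Rightarrow\Sigma\ /\ \Gamma\Rightarrow\Delta\mid\Pi\Rightarrow\Sigma$ - $t=t,Et,\Gamma\Rightarrow\Delta\mid\Pi\Rightarrow\Sigma\ /\ Et,\Gamma\Rightarrow\Delta\mid\Pi\Rightarrow\Sigma$ - $a=d,Ed,\Gamma\Rightarrow\Delta\mid\Pi\Rightarrow\Sigma\ /\ Ed,\Gamma\Rightarrow\Delta\mid\Pi\Rightarrow\Sigma$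 **Description rules.** With $d=\imath x\varphi$: - $\varphi[x/c],c=d,Ec,\Gamma\Rightarrow\Delta\mid S\ /\ c=d,Ec,\Gamma\Rightarrow\Delta\mid S$ - $Ec,\Gamma\Rightarrow\Delta\mid\varphi[x/c],c=d,\Pi\Rightarrow\Sigma\ /\ Ec,\Gamma\Rightarrow\Delta\mid c=d,\Pi\Rightarrow\Sigma$ - $c=d,Eb,Ec,\Gamma\Rightarrow\Delta\mid\Pi\Rightarrow\Sigma,\varphi[x/b];\ b=c,c=d,Eb,Ec,\Gamma\Rightarrow\Delta\mid\Pi\Rightarrow\Sigma\ /\ c=d,Eb,Ec,\Gamma\Rightarrow\Delta\mid\Pi\Rightarrow\Sigma$ - $Eb,Ec,\Gamma\Rightarrow\Delta,\varphi[x/b]\mid c=d,\Pi\Rightarrow\Sigma;\ Eb,Ec,\Gamma\Rightarrow\Delta\mid b=c,c=d,\Pi\Rightarrow\Sigma\ /\ Eb,Ec,\Gamma\Rightarrow\Delta\mid c=d,\Pi\Rightarrow\Sigma$ - $Ec,\Gamma\Rightarrow\Delta\mid\Pi\Rightarrow\Sigma,\varphi[x/c];\ Ea,Ec,\varphi[x/a],\Gamma\Rightarrow\Delta\mid\Pi\Rightarrow\Sigma,a=c\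 /\ Ec,\Gamma\Rightarrow\Delta\mid\Pi\Rightarrow\Sigma,c=d$ - $Ec,\Gamma\Rightarrow\Delta,\varphi[x/c]\mid\Pi\Rightarrow\Sigma;\ Ea,Ec,\Gamma\Rightarrow\Delta,a=c\mid\varphi[x/a],\Pi\Rightarrow\Sigma\ /\ Ec,\Gamma\Rightarrow\Delta,c=d\mid\Pi\Rightarrow\Sigma$ **Theorem (Cut admissibility).** In each of these calculi (for $K_3$ and for $K_3^w$, and for either form of the replacement rule) the following rules are admissible, i.e. whenever all premises are derivable in the calculus, so is the conclusion. Here $\varphi$ is any formula, $t$ any closed term, $P$ any predication or identity, and $t_1,\dots,t_n$ a list of exactly the arguments of $P$. - (E-Cut) $\Gamma\Rightarrow\Delta\mid\Lambda\Rightarrow\Theta,Et;\ Et,\Pi\Rightarrow\Sigma\mid\Xi\Rightarrow\Omega\ /\ \Gamma,\Pi\Rightarrow\Delta,\Sigma\mid\Lambda,\Xi\Rightarrow\Theta,\Omega$ - (L-Cut) $Et_1,\dots,Et_n,\Gamma\Rightarrow\Delta\mid\Lambda\Rightarrow\Theta,P;\ Et_1,\dots,Et_n,P,\Pi\Rightarrow\Sigma\mid\Xi\Rightarrow\Omega\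 /\ Et_1,\dots,Et_n,\Gamma,\Pi\Rightarrow\Delta,\Sigma\mid\Lambda,\Xi\Rightarrow\Theta,\Omega$ - (O-Cut) $\Gamma\Rightarrow\Delta,\varphi\mid\Lambda\Rightarrow\Theta;\ \varphi,\Pi\Rightarrow\Sigma\mid\Xi\Rightarrow\Omega\ /\ \Gamma,\Pi\Rightarrow\Delta,\Sigma\mid\Lambda,\Xi\Rightarrow\Theta,\Omega$ - (I-Cut) $\Gamma\Rightarrow\Delta\mid\Lambda\Rightarrow\Theta,\varphi;\ \Pi\Rightarrow\Sigma\mid\varphi,\Xi\Rightarrow\Omega\ /\ \Gamma,\Pi\Rightarrow\Delta,\Sigma\mid\Lambda,\Xi\Rightarrow\Theta,\Omega$ - (R-Cut) $\Gamma\Rightarrow\Delta\mid\varphi,\Lambda\Rightarrow\Theta;\ \Pi\Rightarrow\Sigma,\varphi\mid\Xi\Rightarrow\Omega\ /\ \Gamma,\Pi\Rightarrow\Delta,\Sigma\mid\Lambda,\Xi\Rightarrow\Theta,\Omega$ - (3-Cut) $\varphi,\Gamma_1\Rightarrow\Delta_1\mid\Lambda_1\Rightarrow\Theta_1;\ \Gamma_2\Rightarrow\Delta_2\mid\Lambda_2\Rightarrow\Theta_2,\varphi;\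 \Gamma_3\Rightarrow\Delta_3,\varphi\mid\varphi,\Lambda_3\Rightarrow\Theta_3\ /\ \Gamma_1,\Gamma_2,\Gamma_3\Rightarrow\Delta_1,\Delta_2,\Delta_3\mid\Lambda_1,\Lambda_2,\Lambda_3\Rightarrow\Theta_1,\Theta_2,\Theta_3$ -/

import Mathlib

namespace NFL

universe u v w

/-! Syntax. Parameters (free individual variables) are natural numbers. Bound variables are
well-scoped de Bruijn indices: in a scope of `m` binders the index `0` belongs to the innermost
and `m - 1` to the outermost binder, so formulas are taken up to renaming of bound variables. -/

/-- Simple terms (parameters and bound variables) in a scope of `m` binders. -/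
inductive STm (m : ℕ) : Type
  | par (a : ℕ)
  | var (i : Fin m)

/-- Formulas over a family `T` of terms, with existence predicate, identity and
predicate symbols `Pr n` of each arity `n`. -/
inductive Fm (Pr : ℕ → Type u) (T : ℕ → Type v) : ℕ → Type (max u v)
  | ex {m : ℕ} (t : T m) : Fm Pr T m
  | eq {m : ℕ} (s t : T m) : Fm Pr T m
  | pred {m n : ℕ} (P : Pr n) (ts : Fin n → T m) : Fm Pr T m
  | neg {m : ℕ} (φ : Fm Pr T m) : Fm Pr T m
  | and {m : ℕ} (φ ψ : Fm Pr T m) : Fm Pr T m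
  | imp {m : ℕ} (φ ψ : Fm Pr T m) : Fm Pr T m
  | all {m : ℕ} (φ : Fm Pr T (m + 1)) : Fm Pr T m

/-- Terms: simple terms, and descriptions `ιx φ` whose body `φ` contains no description. -/
inductive Tm (Pr : ℕ → Type u) (m : ℕ) : Type u
  | smp (t : STm m)
  | desc (φ : Fm Pr STm (m + 1))

/-- The formulas that occur in bisequents: no loose bound variable. -/
abbrev Form (Pr : ℕ → Type u) : Type u := Fm Pr (Tm Pr) 0

/-- A parameter as a (closed) term. -/
abbrev Tm.par {Pr : ℕ → Type u} {m : ℕ} (a : ℕ) : Tm Pr m := Tm.smp (STm.par a)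

/-- Apply to all terms of a formula an operation that eliminates the outermost variable. -/
def Fm.mapTm {Pr : ℕ → Type u} {T : ℕ → Type v} {T' : ℕ → Type w}
    (f : ∀ m, T (m + 1) → T' m) : {m : ℕ} → Fm Pr T (m + 1) → Fm Pr T' m
  | _, .ex t => .ex (f _ t)
  | _, .eq s t => .eq (f _ s) (f _ t)
  | _, .pred P ts => .pred P (fun i => f _ (ts i))
  | _, .neg φ => .neg (φ.mapTm f)
  | _, .and φ ψ => .and (φ.mapTm f) (ψ.mapTm f)
  | _, .imp φ ψ => .imp (φ.mapTm f) (ψ.mapTm f)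
  | _, .all φ => .all (φ.mapTm f)

/-- Replace the outermost variable by the parameter `b`. -/
def STm.inst (b : ℕ) (m : ℕ) : STm (m + 1) → STm m
  | .par a => .par a
  | .var i => if h : i.val < m then .var ⟨i.val, h⟩ else .par b

/-- Replace the outermost variable by the parameter `b`, also inside descriptions. -/
def Tm.inst {Pr : ℕ → Type u} (b : ℕ) (m : ℕ) : Tm Pr (m + 1) → Tm Pr m
  | .smp t => .smp (t.inst b m)
  | .desc φ => .desc (φ.mapTm (STm.inst b))

/-- `φ[x/b]` for the matrix `φ` of a quantified formula `∀x φ`. -/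
def Fm.inst {Pr : ℕ → Type u} (φ : Fm Pr (Tm Pr) 1) (b : ℕ) : Form Pr :=
  φ.mapTm (Tm.inst b)

/-- `φ[x/b]` for the body `φ` of a description `ιx φ`. -/
def Fm.instBody {Pr : ℕ → Type u} (φ : Fm Pr STm 1) (b : ℕ) : Form Pr :=
  φ.mapTm (fun m t => Tm.smp (t.inst b m))

/-- Some term that occurs in the formula as an argument satisfies `p`. -/
def Fm.Any {Pr : ℕ → Type u} {T : ℕ → Type v} (p : ∀ m, T m → Prop) :
    {m : ℕ} → Fm Pr T m → Prop
  | _, .ex t => p _ t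
  | _, .eq s t => p _ s ∨ p _ t
  | _, .pred _ ts => ∃ i, p _ (ts i)
  | _, .neg φ => φ.Any p
  | _, .and φ ψ => φ.Any p ∨ ψ.Any p
  | _, .imp φ ψ => φ.Any p ∨ ψ.Any p
  | _, .all φ => φ.Any p

/-- The simple term is the parameter `a`. -/
def STm.HasPar (a : ℕ) (m : ℕ) : STm m → Prop
  | .par b => b = a
  | .var _ => False

/-- The simple term is the outermost bound variable. -/
def STm.IsLast (m : ℕ) : STm m → Prop
  | .par _ => False
  | .var i => i.val + 1 = m

/-- The parameter `a` occurs in the term. -/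
def Tm.HasPar {Pr : ℕ → Type u} (a : ℕ) (m : ℕ) : Tm Pr m → Prop
  | .smp t => t.HasPar a m
  | .desc φ => φ.Any (STm.HasPar a)

/-- The parameter `a` does not occur in the formulas of `Γ`. -/
def Fresh {Pr : ℕ → Type u} (a : ℕ) (Γ : Multiset (Form Pr)) : Prop :=
  ∀ φ ∈ Γ, ¬ φ.Any (Tm.HasPar a)

/-- `SubstTm t u u'`: the result `u' = u[x/t]` of the correct substitution of the closed term `t`
for the variable `x` in `u`. A parameter may be substituted inside a description; a description
may not, since it would produce nested descriptions, so then `x` must not occur inside. -/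
inductive SubstTm {Pr : ℕ → Type u} (t : Tm Pr 0) : Tm Pr 1 → Tm Pr 0 → Prop
  | var : SubstTm t (.smp (.var 0)) t
  | par (a : ℕ) : SubstTm t (.par a) (.par a)
  | descPar (φ : Fm Pr STm 2) (b : ℕ) (ht : t = .par b) :
      SubstTm t (.desc φ) (.desc (φ.mapTm (STm.inst b)))
  | descClosed (φ : Fm Pr STm 2) (hφ : ¬ φ.Any STm.IsLast) (b : ℕ) :
      SubstTm t (.desc φ) (.desc (φ.mapTm (STm.inst b)))

/-- `SubstAtom t A A'`: `A` is atomic (a predication, an identity or an existence formula)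
with at most the variable `x`, and `A' = A[x/t]`. -/
inductive SubstAtom {Pr : ℕ → Type u} (t : Tm Pr 0) : Fm Pr (Tm Pr) 1 → Form Pr → Prop
  | ex {u : Tm Pr 1} {u' : Tm Pr 0} (h : SubstTm t u u') : SubstAtom t (.ex u) (.ex u')
  | eq {u v : Tm Pr 1} {u' v' : Tm Pr 0} (hu : SubstTm t u u') (hv : SubstTm t v v') :
      SubstAtom t (.eq u v) (.eq u' v')
  | pred {n : ℕ} (P : Pr n) {us : Fin n → Tm Pr 1} {us' : Fin n → Tm Pr 0}
      (h : ∀ i, SubstTm t (us i) (us' i)) : SubstAtom t (.pred P us) (.pred P us')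

/-- Predications `P(t₁,…,tₙ)` and identities, but not existence formulas. -/
inductive IsPredication {Pr : ℕ → Type u} : Form Pr → Prop
  | pred {n : ℕ} (P : Pr n) (ts : Fin n → Tm Pr 0) : IsPredication (.pred P ts)
  | eq (s t : Tm Pr 0) : IsPredication (.eq s t)

/-- Atomic formulas: predications, identities and existence formulas. -/
def IsAtomic {Pr : ℕ → Type u} (φ : Form Pr) : Prop :=
  IsPredication φ ∨ ∃ t, φ = .ex t

/-- Identities `b = ιx φ` between a parameter and a description, in this order. -/
def IsParEqDesc {Pr : ℕ → Type u} (φ : Form Pr) : Prop :=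
  ∃ (b : ℕ) (δ : Fm Pr STm 1), φ = .eq (.par b) (.desc δ)

/-- The arguments of an atomic formula. -/
def args {Pr : ℕ → Type u} : Form Pr → Set (Tm Pr 0)
  | .ex t => {t}
  | .eq s t => {s, t}
  | .pred _ ts => Set.range ts
  | _ => ∅

/-- `ts` is a list (order and repetitions are immaterial) of exactly the arguments of `P`. -/
def ListsArgs {Pr : ℕ → Type u} (ts : Multiset (Tm Pr 0)) (P : Form Pr) : Prop :=
  ∀ t, t ∈ ts ↔ t ∈ args P

/-- `Et₁, …, Etₙ`. -/
def exs {Pr : ℕ → Type u} (ts : Multiset (Tm Pr 0)) : Multiset (Form Pr) := ts.map Fm.ex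

/-- The strong and the weak Kleene variant. -/
inductive Kleene
  | strong
  | weak

/-- Where the rule for replacement of identicals has its two active succedent formulas:
in the first or in the second sequent of the bisequent. -/
inductive Side
  | first
  | second

/-- `Der k e Γ Δ Λ Θ`: the bisequent `Γ ⇒ Δ ∣ Λ ⇒ Θ` is derivable (without cut) in the calculus
for neutral free logic with identity and descriptions over the Kleene variant `k`, with the rule
for replacement of identicals in the form `e`. -/
inductive Der {Pr : ℕ → Type u} (k : Kleene) (e : Side) :
    Multiset (Form Pr) → Multiset (Form Pr) → Multiset (Form Pr) → Multiset (Form Pr) → Prop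
  -- axiomatic bisequents
  | axLeftLeft {Γ Δ Λ Θ} (A : Form Pr) (hA : IsAtomic A) : Der k e (A ::ₘ Γ) (A ::ₘ Δ) Λ Θ
  | axRightRight {Γ Δ Λ Θ} (A : Form Pr) (hA : IsAtomic A) : Der k e Γ Δ (A ::ₘ Λ) (A ::ₘ Θ)
  | axLeftRight {Γ Δ Λ Θ} (A : Form Pr) (hA : IsAtomic A) : Der k e (A ::ₘ Γ) Δ Λ (A ::ₘ Θ)
  | axExists {Γ Δ Λ Θ} (P : Form Pr) (hP : IsPredication P) (ts) (hts : ListsArgs ts P) :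
      Der k e (exs ts + Γ) (P ::ₘ Δ) (P ::ₘ Λ) Θ
  -- negation
  | negL₁ {Γ Δ Λ Θ} (φ : Form Pr) : Der k e Γ Δ Λ (φ ::ₘ Θ) → Der k e (φ.neg ::ₘ Γ) Δ Λ Θ
  | negR₁ {Γ Δ Λ Θ} (φ : Form Pr) : Der k e Γ Δ (φ ::ₘ Λ) Θ → Der k e Γ (φ.neg ::ₘ Δ) Λ Θ
  | negL₂ {Γ Δ Λ Θ} (φ : Form Pr) : Der k e Γ (φ ::ₘ Δ) Λ Θ → Der k e Γ Δ (φ.neg ::ₘ Λ) Θ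
  | negR₂ {Γ Δ Λ Θ} (φ : Form Pr) : Der k e (φ ::ₘ Γ) Δ Λ Θ → Der k e Γ Δ Λ (φ.neg ::ₘ Θ)
  -- conjunction and implication, rules common to both variants
  | andL₁ {Γ Δ Λ Θ} (φ ψ : Form Pr) :
      Der k e (φ ::ₘ ψ ::ₘ Γ) Δ Λ Θ → Der k e (φ.and ψ ::ₘ Γ) Δ Λ Θ
  | andR₁ {Γ Δ Λ Θ} (φ ψ : Form Pr) :
      Der k e Γ (φ ::ₘ Δ) Λ Θ → Der k e Γ (ψ ::ₘ Δ) Λ Θ → Der k e Γ (φ.and ψ ::ₘ Δ) Λ Θ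
  | impL₂ {Γ Δ Λ Θ} (φ ψ : Form Pr) :
      Der k e Γ (φ ::ₘ Δ) Λ Θ → Der k e Γ Δ (ψ ::ₘ Λ) Θ → Der k e Γ Δ (φ.imp ψ ::ₘ Λ) Θ
  | impR₂ {Γ Δ Λ Θ} (φ ψ : Form Pr) :
      Der k e (φ ::ₘ Γ) Δ Λ (ψ ::ₘ Θ) → Der k e Γ Δ Λ (φ.imp ψ ::ₘ Θ)
  -- conjunction and implication, strong variant
  | andL₂ {Γ Δ Λ Θ} (hk : k = .strong) (φ ψ : Form Pr) :
      Der k e Γ Δ (φ ::ₘ ψ ::ₘ Λ) Θ → Der k e Γ Δ (φ.and ψ ::ₘ Λ) Θ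
  | andR₂ {Γ Δ Λ Θ} (hk : k = .strong) (φ ψ : Form Pr) :
      Der k e Γ Δ Λ (φ ::ₘ Θ) → Der k e Γ Δ Λ (ψ ::ₘ Θ) → Der k e Γ Δ Λ (φ.and ψ ::ₘ Θ)
  | impL₁ {Γ Δ Λ Θ} (hk : k = .strong) (φ ψ : Form Pr) :
      Der k e Γ Δ Λ (φ ::ₘ Θ) → Der k e (ψ ::ₘ Γ) Δ Λ Θ → Der k e (φ.imp ψ ::ₘ Γ) Δ Λ Θ
  | impR₁ {Γ Δ Λ Θ} (hk : k = .strong) (φ ψ : Form Pr) :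
      Der k e Γ (ψ ::ₘ Δ) (φ ::ₘ Λ) Θ → Der k e Γ (φ.imp ψ ::ₘ Δ) Λ Θ
  -- conjunction and implication, weak variant
  | andL₂w {Γ Δ Λ Θ} (hk : k = .weak) (φ ψ : Form Pr) :
      Der k e Γ Δ (φ ::ₘ ψ ::ₘ Λ) Θ → Der k e Γ (φ ::ₘ Δ) (φ ::ₘ Λ) Θ →
      Der k e Γ (ψ ::ₘ Δ) (ψ ::ₘ Λ) Θ → Der k e Γ Δ (φ.and ψ ::ₘ Λ) Θ
  | andR₂w {Γ Δ Λ Θ} (hk : k = .weak) (φ ψ : Form Pr) :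
      Der k e Γ Δ Λ (φ ::ₘ ψ ::ₘ Θ) → Der k e (φ ::ₘ Γ) Δ Λ (ψ ::ₘ Θ) →
      Der k e (ψ ::ₘ Γ) Δ Λ (φ ::ₘ Θ) → Der k e Γ Δ Λ (φ.and ψ ::ₘ Θ)
  | impR₁w {Γ Δ Λ Θ} (hk : k = .weak) (φ ψ : Form Pr) :
      Der k e Γ (ψ ::ₘ Δ) (φ ::ₘ Λ) Θ → Der k e Γ (φ ::ₘ Δ) (φ ::ₘ Λ) Θ →
      Der k e Γ (ψ ::ₘ Δ) (ψ ::ₘ Λ) Θ → Der k e Γ (φ.imp ψ ::ₘ Δ) Λ Θ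
  | impL₁w {Γ Δ Λ Θ} (hk : k = .weak) (φ ψ : Form Pr) :
      Der k e (φ ::ₘ ψ ::ₘ Γ) Δ Λ Θ → Der k e Γ Δ Λ (φ ::ₘ ψ ::ₘ Θ) →
      Der k e (ψ ::ₘ Γ) Δ Λ (φ ::ₘ Θ) → Der k e (φ.imp ψ ::ₘ Γ) Δ Λ Θ
  -- universal quantifier
  | allR₁ {Γ Δ Λ Θ} (φ : Fm Pr (Tm Pr) 1) (a : ℕ)
      (ha : Fresh a (Γ + (φ.all ::ₘ Δ) + Λ + Θ)) :
      Der k e (.ex (.par a) ::ₘ Γ) (φ.inst a ::ₘ Δ) Λ Θ → Der k e Γ (φ.all ::ₘ Δ) Λ Θ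
  | allR₂ {Γ Δ Λ Θ} (φ : Fm Pr (Tm Pr) 1) (a : ℕ)
      (ha : Fresh a (Γ + Δ + Λ + (φ.all ::ₘ Θ))) :
      Der k e (.ex (.par a) ::ₘ Γ) Δ Λ (φ.inst a ::ₘ Θ) → Der k e Γ Δ Λ (φ.all ::ₘ Θ)
  | allL₁ {Γ Δ Λ Θ} (φ : Fm Pr (Tm Pr) 1) (b : ℕ) :
      Der k e (.ex (.par b) ::ₘ φ.all ::ₘ φ.inst b ::ₘ Γ) Δ Λ Θ →
      Der k e (.ex (.par b) ::ₘ φ.all ::ₘ Γ) Δ Λ Θ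
  | allL₂ {Γ Δ Λ Θ} (φ : Fm Pr (Tm Pr) 1) (b : ℕ) :
      Der k e (.ex (.par b) ::ₘ Γ) Δ (φ.all ::ₘ φ.inst b ::ₘ Λ) Θ →
      Der k e (.ex (.par b) ::ₘ Γ) Δ (φ.all ::ₘ Λ) Θ
  -- existence predicate
  | exL₁ {Γ Δ Λ Θ} (P : Form Pr) (hP : IsPredication P) (hd : ¬ IsParEqDesc P)
      (t) (ht : t ∈ args P) :
      Der k e (.ex t ::ₘ P ::ₘ Γ) Δ Λ Θ → Der k e (P ::ₘ Γ) Δ Λ Θ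
  | exR₂ {Γ Δ Λ Θ} (P : Form Pr) (hP : IsPredication P) (hd : ¬ IsParEqDesc P)
      (t) (ht : t ∈ args P) :
      Der k e (.ex t ::ₘ Γ) Δ Λ (P ::ₘ Θ) → Der k e Γ Δ Λ (P ::ₘ Θ)
  | exL₂ {Γ Δ Λ Θ} (P : Form Pr) (hP : IsPredication P) (hd : ¬ IsParEqDesc P)
      (ts) (hts : ListsArgs ts P) :
      Der k e (exs ts + (P ::ₘ Γ)) Δ Λ Θ → Der k e (exs ts + Γ) Δ (P ::ₘ Λ) Θ
  | exR₁ {Γ Δ Λ Θ} (P : Form Pr) (hP : IsPredication P) (hd : ¬ IsParEqDesc P)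
      (ts) (hts : ListsArgs ts P) :
      Der k e (exs ts + Γ) Δ Λ (P ::ₘ Θ) → Der k e (exs ts + Γ) (P ::ₘ Δ) Λ Θ
  | exTr₁ {Γ Δ Λ Θ} (t : Tm Pr 0) : Der k e (.ex t ::ₘ Γ) Δ Λ Θ → Der k e Γ Δ (.ex t ::ₘ Λ) Θ
  | exTr₂ {Γ Δ Λ Θ} (t : Tm Pr 0) : Der k e Γ Δ Λ (.ex t ::ₘ Θ) → Der k e Γ (.ex t ::ₘ Δ) Λ Θ
  -- identity: replacement (two forms), reflexivity, and a name for an existing description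
  | replSecond {Γ Δ Λ Θ} (he : e = .second) (t s : Tm Pr 0) (I : Form Pr)
      (hI : I = .eq t s ∨ I = .eq s t) (A : Fm Pr (Tm Pr) 1) (At As : Form Pr)
      (ht : SubstAtom t A At) (hs : SubstAtom s A As) :
      Der k e Γ Δ Λ (I ::ₘ Θ) → Der k e Γ Δ Λ (At ::ₘ Θ) → Der k e (As ::ₘ Γ) Δ Λ Θ →
      Der k e Γ Δ Λ Θ
  | replFirst {Γ Δ Λ Θ} (he : e = .first) (t s : Tm Pr 0) (I : Form Pr)
      (hI : I = .eq t s ∨ I = .eq s t) (A : Fm Pr (Tm Pr) 1) (At As : Form Pr)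
      (ht : SubstAtom t A At) (hs : SubstAtom s A As) :
      Der k e Γ (I ::ₘ Δ) Λ Θ → Der k e Γ (At ::ₘ Δ) Λ Θ → Der k e (As ::ₘ Γ) Δ Λ Θ →
      Der k e Γ Δ Λ Θ
  | eqRefl {Γ Δ Λ Θ} (t : Tm Pr 0) :
      Der k e (.eq t t ::ₘ .ex t ::ₘ Γ) Δ Λ Θ → Der k e (.ex t ::ₘ Γ) Δ Λ Θ
  | exDesc {Γ Δ Λ Θ} (φ : Fm Pr STm 1) (a : ℕ)
      (ha : Fresh a ((.ex (.desc φ) ::ₘ Γ) + Δ + Λ + Θ)) :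
      Der k e (.eq (.par a) (.desc φ) ::ₘ .ex (.desc φ) ::ₘ Γ) Δ Λ Θ →
      Der k e (.ex (.desc φ) ::ₘ Γ) Δ Λ Θ
  -- definite descriptions
  | descL₁one {Γ Δ Λ Θ} (φ : Fm Pr STm 1) (c : ℕ) :
      Der k e (φ.instBody c ::ₘ .eq (.par c) (.desc φ) ::ₘ .ex (.par c) ::ₘ Γ) Δ Λ Θ →
      Der k e (.eq (.par c) (.desc φ) ::ₘ .ex (.par c) ::ₘ Γ) Δ Λ Θ
  | descL₂one {Γ Δ Λ Θ} (φ : Fm Pr STm 1) (c : ℕ) :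
      Der k e (.ex (.par c) ::ₘ Γ) Δ (φ.instBody c ::ₘ .eq (.par c) (.desc φ) ::ₘ Λ) Θ →
      Der k e (.ex (.par c) ::ₘ Γ) Δ (.eq (.par c) (.desc φ) ::ₘ Λ) Θ
  | descL₁two {Γ Δ Λ Θ} (φ : Fm Pr STm 1) (b c : ℕ) :
      Der k e (.eq (.par c) (.desc φ) ::ₘ .ex (.par b) ::ₘ .ex (.par c) ::ₘ Γ) Δ
        Λ (φ.instBody b ::ₘ Θ) →
      Der k e (.eq (.par b) (.par c) ::ₘ .eq (.par c) (.desc φ) ::ₘ .ex (.par b) ::ₘ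
        .ex (.par c) ::ₘ Γ) Δ Λ Θ →
      Der k e (.eq (.par c) (.desc φ) ::ₘ .ex (.par b) ::ₘ .ex (.par c) ::ₘ Γ) Δ Λ Θ
  | descL₂two {Γ Δ Λ Θ} (φ : Fm Pr STm 1) (b c : ℕ) :
      Der k e (.ex (.par b) ::ₘ .ex (.par c) ::ₘ Γ) (φ.instBody b ::ₘ Δ)
        (.eq (.par c) (.desc φ) ::ₘ Λ) Θ →
      Der k e (.ex (.par b) ::ₘ .ex (.par c) ::ₘ Γ) Δ
        (.eq (.par b) (.par c) ::ₘ .eq (.par c) (.desc φ) ::ₘ Λ) Θ →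
      Der k e (.ex (.par b) ::ₘ .ex (.par c) ::ₘ Γ) Δ (.eq (.par c) (.desc φ) ::ₘ Λ) Θ
  | descR₂ {Γ Δ Λ Θ} (φ : Fm Pr STm 1) (c a : ℕ)
      (ha : Fresh a ((.ex (.par c) ::ₘ Γ) + Δ + Λ + (.eq (.par c) (.desc φ) ::ₘ Θ))) :
      Der k e (.ex (.par c) ::ₘ Γ) Δ Λ (φ.instBody c ::ₘ Θ) →
      Der k e (.ex (.par a) ::ₘ .ex (.par c) ::ₘ φ.instBody a ::ₘ Γ) Δ
        Λ (.eq (.par a) (.par c) ::ₘ Θ) →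
      Der k e (.ex (.par c) ::ₘ Γ) Δ Λ (.eq (.par c) (.desc φ) ::ₘ Θ)
  | descR₁ {Γ Δ Λ Θ} (φ : Fm Pr STm 1) (c a : ℕ)
      (ha : Fresh a ((.ex (.par c) ::ₘ Γ) + (.eq (.par c) (.desc φ) ::ₘ Δ) + Λ + Θ)) :
      Der k e (.ex (.par c) ::ₘ Γ) (φ.instBody c ::ₘ Δ) Λ Θ →
      Der k e (.ex (.par a) ::ₘ .ex (.par c) ::ₘ Γ) (.eq (.par a) (.par c) ::ₘ Δ)
        (φ.instBody a ::ₘ Λ) Θ →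
      Der k e (.ex (.par c) ::ₘ Γ) (.eq (.par c) (.desc φ) ::ₘ Δ) Λ Θ

end NFL

/-! Read the four places of a bisequent as claims about one valuation: true (first antecedent), not
true (first succedent), not false (second antecedent), false (second succedent). A derivation
refutes the joint claim. "Not true" together with "not false" means undefined. All the cuts reduce
to two dichotomies, true or not true (`Cut.outer`) and false or not false (`Cut.inner`); 3-Cut
applies one inside the other.

The calculus is first recast as `D`, on multisets of signed formulas. Its rules are of two kinds:
those that decompose one formula and drop it (`Dec`), and those that leave their principal formulas
in place (`Ret`, including the axioms). An eigenparameter rule gets one premise for every parameter,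
so no renaming is needed inside `D`. The equivalence `der_iff` holds because a derivation can be
renamed by any map of parameters, and conversely because a fresh parameter always exists.

The general tool for `D` is `D.elim`: a formula is traced upwards in a derivation, and only the
places where it is principal need an argument. This yields inversion of every decomposition rule
(`D.invert`) and then contraction (`D.contract`), so that derivability depends only on the set of
signed formulas (`D.mono`). Inversion at an axiom needs the axioms for compound formulas,
`D.identity`. This is proved together with replacement of parameters inside compound formulas as
`D.rel`.

Cut (`cut`) is then proved by induction on a rank in which `c = ιx φ` exceeds both the instances of
`φ` and the identities between parameters. Connectives and quantifiers reduce to immediate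
subformulas, the weak Kleene rules through a split into three values. The hard case is `Cut.desc`.
If `c` and the description both exist, then `c = ιx φ` cannot be undefined, and this must be shown
by the rules: a name for the description and its uniqueness decide the identity
(`D.descEq_l₁_of_l₂`, `D.descEq_r₂_of_r₁`). -/

namespace NFL

universe u v w

variable {Pr : ℕ → Type u} {k : Kleene} {e : Side}

variable {Pr : ℕ → Type u} {k : Kleene} {e : Side}

/-! ### Signed formulas and the calculus `D` -/

/-- The four places of a bisequent: `l₁ ⇒ r₁ ∣ l₂ ⇒ r₂`. -/
inductive Pos
  | l₁ | r₁ | l₂ | r₂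
  deriving DecidableEq

/-- Formulas with a place in a bisequent. -/
abbrev SF (Pr : ℕ → Type u) : Type u := Pos × Form Pr

abbrev L₁ (φ : Form Pr) : SF Pr := (Pos.l₁, φ)
abbrev R₁ (φ : Form Pr) : SF Pr := (Pos.r₁, φ)
abbrev L₂ (φ : Form Pr) : SF Pr := (Pos.l₂, φ)
abbrev R₂ (φ : Form Pr) : SF Pr := (Pos.r₂, φ)

/-- The formula `Ea` for a parameter `a`. -/
abbrev exPar (a : ℕ) : Form Pr := .ex (.par a)
/-- The formula `a = b` for parameters. -/
abbrev parEq (a b : ℕ) : Form Pr := .eq (.par a) (.par b)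
/-- The formula `c = ιx φ`. -/
abbrev descEq (c : ℕ) (φ : Fm Pr STm 1) : Form Pr := .eq (.par c) (.desc φ)

/-- The existence formulas of the arguments of `P`, in the first antecedent. -/
def argsEx (P : Form Pr) : Set (SF Pr) := {X | ∃ t ∈ args P, X = L₁ (.ex t)}

/-- `Dec k X E Ls`: the signed formula `X` is decomposed by a rule with the premises `Ls`
whose conclusion also needs the side formulas `E`. The eigenparameter rules
have one premise for each parameter. -/
inductive Dec (k : Kleene) : SF Pr → Set (SF Pr) → Set (Multiset (SF Pr)) → Prop
  | negL₁ (φ : Form Pr) : Dec k (L₁ φ.neg) ∅ {{R₂ φ}}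
  | negR₁ (φ : Form Pr) : Dec k (R₁ φ.neg) ∅ {{L₂ φ}}
  | negL₂ (φ : Form Pr) : Dec k (L₂ φ.neg) ∅ {{R₁ φ}}
  | negR₂ (φ : Form Pr) : Dec k (R₂ φ.neg) ∅ {{L₁ φ}}
  | andL₁ (φ ψ : Form Pr) : Dec k (L₁ (φ.and ψ)) ∅ {{L₁ φ, L₁ ψ}}
  | andR₁ (φ ψ : Form Pr) : Dec k (R₁ (φ.and ψ)) ∅ {{R₁ φ}, {R₁ ψ}}
  | impL₂ (φ ψ : Form Pr) : Dec k (L₂ (φ.imp ψ)) ∅ {{R₁ φ}, {L₂ ψ}}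
  | impR₂ (φ ψ : Form Pr) : Dec k (R₂ (φ.imp ψ)) ∅ {{L₁ φ, R₂ ψ}}
  | andL₂ (hk : k = .strong) (φ ψ : Form Pr) : Dec k (L₂ (φ.and ψ)) ∅ {{L₂ φ, L₂ ψ}}
  | andR₂ (hk : k = .strong) (φ ψ : Form Pr) : Dec k (R₂ (φ.and ψ)) ∅ {{R₂ φ}, {R₂ ψ}}
  | impL₁ (hk : k = .strong) (φ ψ : Form Pr) : Dec k (L₁ (φ.imp ψ)) ∅ {{R₂ φ}, {L₁ ψ}}
  | impR₁ (hk : k = .strong) (φ ψ : Form Pr) : Dec k (R₁ (φ.imp ψ)) ∅ {{R₁ ψ, L₂ φ}}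
  | andL₂w (hk : k = .weak) (φ ψ : Form Pr) :
      Dec k (L₂ (φ.and ψ)) ∅ {{L₂ φ, L₂ ψ}, {R₁ φ, L₂ φ}, {R₁ ψ, L₂ ψ}}
  | andR₂w (hk : k = .weak) (φ ψ : Form Pr) :
      Dec k (R₂ (φ.and ψ)) ∅ {{R₂ φ, R₂ ψ}, {L₁ φ, R₂ ψ}, {L₁ ψ, R₂ φ}}
  | impR₁w (hk : k = .weak) (φ ψ : Form Pr) :
      Dec k (R₁ (φ.imp ψ)) ∅ {{R₁ ψ, L₂ φ}, {R₁ φ, L₂ φ}, {R₁ ψ, L₂ ψ}}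
  | impL₁w (hk : k = .weak) (φ ψ : Form Pr) :
      Dec k (L₁ (φ.imp ψ)) ∅ {{L₁ φ, L₁ ψ}, {R₂ φ, R₂ ψ}, {L₁ ψ, R₂ φ}}
  | allR₁ (φ : Fm Pr (Tm Pr) 1) :
      Dec k (R₁ φ.all) ∅ (Set.range fun a => {L₁ (exPar a), R₁ (φ.inst a)})
  | allR₂ (φ : Fm Pr (Tm Pr) 1) :
      Dec k (R₂ φ.all) ∅ (Set.range fun a => {L₁ (exPar a), R₂ (φ.inst a)})
  | exL₂ (P : Form Pr) (hP : IsPredication P) (hd : ¬ IsParEqDesc P) :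
      Dec k (L₂ P) (argsEx P) {{L₁ P}}
  | exR₁ (P : Form Pr) (hP : IsPredication P) (hd : ¬ IsParEqDesc P) :
      Dec k (R₁ P) (argsEx P) {{R₂ P}}
  | exTr₁ (t : Tm Pr 0) : Dec k (L₂ (.ex t)) ∅ {{L₁ (.ex t)}}
  | exTr₂ (t : Tm Pr 0) : Dec k (R₁ (.ex t)) ∅ {{R₂ (.ex t)}}
  | descR₂ (φ : Fm Pr STm 1) (c : ℕ) :
      Dec k (R₂ (descEq c φ)) {L₁ (exPar c)} (insert {R₂ (φ.instBody c)}
        (Set.range fun a => {L₁ (exPar a), L₁ (φ.instBody a), R₂ (parEq a c)}))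
  | descR₁ (φ : Fm Pr STm 1) (c : ℕ) :
      Dec k (R₁ (descEq c φ)) {L₁ (exPar c)} (insert {R₁ (φ.instBody c)}
        (Set.range fun a => {L₁ (exPar a), R₁ (parEq a c), L₂ (φ.instBody a)}))

/-- `Ret e Q Ls`: a rule with premises `Ls` which leaves its principal formulas `Q` in place. -/
inductive Ret (e : Side) : Set (SF Pr) → Set (Multiset (SF Pr)) → Prop
  | axLeftLeft (A : Form Pr) (hA : IsAtomic A) : Ret e {L₁ A, R₁ A} ∅
  | axRightRight (A : Form Pr) (hA : IsAtomic A) : Ret e {L₂ A, R₂ A} ∅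
  | axLeftRight (A : Form Pr) (hA : IsAtomic A) : Ret e {L₁ A, R₂ A} ∅
  | axExists (P : Form Pr) (hP : IsPredication P) : Ret e ({R₁ P, L₂ P} ∪ argsEx P) ∅
  | allL₁ (φ : Fm Pr (Tm Pr) 1) (b : ℕ) : Ret e {L₁ (exPar b), L₁ φ.all} {{L₁ (φ.inst b)}}
  | allL₂ (φ : Fm Pr (Tm Pr) 1) (b : ℕ) : Ret e {L₁ (exPar b), L₂ φ.all} {{L₂ (φ.inst b)}}
  | exL₁ (P : Form Pr) (hP : IsPredication P) (hd : ¬ IsParEqDesc P) (t) (ht : t ∈ args P) :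
      Ret e {L₁ P} {{L₁ (.ex t)}}
  | exR₂ (P : Form Pr) (hP : IsPredication P) (hd : ¬ IsParEqDesc P) (t) (ht : t ∈ args P) :
      Ret e {R₂ P} {{L₁ (.ex t)}}
  | replSecond (he : e = .second) (t s : Tm Pr 0) (I : Form Pr)
      (hI : I = .eq t s ∨ I = .eq s t) (A : Fm Pr (Tm Pr) 1) (At As : Form Pr)
      (ht : SubstAtom t A At) (hs : SubstAtom s A As) :
      Ret e ∅ {{R₂ I}, {R₂ At}, {L₁ As}}
  | replFirst (he : e = .first) (t s : Tm Pr 0) (I : Form Pr)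
      (hI : I = .eq t s ∨ I = .eq s t) (A : Fm Pr (Tm Pr) 1) (At As : Form Pr)
      (ht : SubstAtom t A At) (hs : SubstAtom s A As) :
      Ret e ∅ {{R₁ I}, {R₁ At}, {L₁ As}}
  | eqRefl (t : Tm Pr 0) : Ret e {L₁ (.ex t)} {{L₁ (.eq t t)}}
  | exDesc (φ : Fm Pr STm 1) :
      Ret e {L₁ (.ex (.desc φ))} (Set.range fun a => {L₁ (descEq a φ)})
  | descL₁one (φ : Fm Pr STm 1) (c : ℕ) :
      Ret e {L₁ (descEq c φ), L₁ (exPar c)} {{L₁ (φ.instBody c)}}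
  | descL₂one (φ : Fm Pr STm 1) (c : ℕ) :
      Ret e {L₂ (descEq c φ), L₁ (exPar c)} {{L₂ (φ.instBody c)}}
  -- For `b = c` the original rule needs two copies of the same existence formula, whereas `D` only
  -- tests membership. That instance is recovered from reflexivity.
  | descL₁two (φ : Fm Pr STm 1) (b c : ℕ) (hbc : b ≠ c) :
      Ret e {L₁ (descEq c φ), L₁ (exPar b), L₁ (exPar c)}
        {{R₂ (φ.instBody b)}, {L₁ (parEq b c)}}
  | descL₂two (φ : Fm Pr STm 1) (b c : ℕ) (hbc : b ≠ c) :
      Ret e {L₂ (descEq c φ), L₁ (exPar b), L₁ (exPar c)}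
        {{R₁ (φ.instBody b)}, {L₂ (parEq b c)}}

/-- Derivability of bisequents, written as multisets of signed formulas. -/
inductive D (k : Kleene) (e : Side) : Multiset (SF Pr) → Prop
  | dec {X E Ls S} : Dec k X E Ls → (∀ Y ∈ E, Y ∈ S) → (∀ L ∈ Ls, D k e (L + S)) → D k e (X ::ₘ S)
  | ret {Q Ls S} : Ret e Q Ls → (∀ Y ∈ Q, Y ∈ S) → (∀ L ∈ Ls, D k e (L + S)) → D k e S

/-! ### Weakening and permutation of rules -/

theorem D.weaken {S : Multiset (SF Pr)} (h : D k e S) (W : Multiset (SF Pr)) : D k e (S + W) := by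
  induction h with
  | dec h hE _ ih =>
    rw [Multiset.cons_add]
    exact .dec h (fun Y hY => Multiset.mem_add.2 (.inl (hE Y hY)))
      fun L hL => by rw [← add_assoc]; exact ih L hL
  | ret h hE _ ih =>
    exact .ret h (fun Y hY => Multiset.mem_add.2 (.inl (hE Y hY)))
      fun L hL => by rw [← add_assoc]; exact ih L hL

theorem D.weaken_le {S S' : Multiset (SF Pr)} (h : D k e S) (hS : S ≤ S') : D k e S' := by
  obtain ⟨W, rfl⟩ := Multiset.le_iff_exists_add.1 hS
  exact h.weaken W

set_option linter.unusedTactic false in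
theorem Dec.unique {X : SF Pr} {E E' Ls Ls'} (h : Dec k X E Ls) (h' : Dec k X E' Ls') :
    E = E' ∧ Ls = Ls' := by
  cases h <;> cases h' <;> first
    | exact ⟨rfl, rfl⟩
    | (rename_i hP _; cases hP; done)
    | (exfalso; simp_all; done)
    | (exfalso; rename_i hd; exact hd ⟨_, _, rfl⟩)

/-- The side formulas of decomposition rules are all of this shape. As they are never decomposed,
they stay available throughout the part of the derivation above. -/
theorem Dec.ne_ex {t : Tm Pr 0} {E Ls} : ¬ Dec k (L₁ (.ex t)) E Ls := by
  intro h; cases h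

/-- Permutation of rules: `X` may be traded for `S₂` in a derivation if this can be done
where `X` is principal. The side formulas `M` stay in the context. -/
theorem D.elim {X : SF Pr} {S₂ : Multiset (SF Pr)} {M : Set (SF Pr)}
    (hM : ∀ m ∈ M, m ≠ X → ∀ E Ls, ¬ Dec k m E Ls)
    (hX : X ∈ M ∨ ∀ t, X ≠ L₁ (.ex t))
    (hdec : ∀ T E Ls, (∀ m ∈ M, m ∈ T) → Dec k X E Ls → (∀ Y ∈ E, Y ∈ T) →
      (∀ L ∈ Ls, D k e (L + T)) → D k e (T + S₂))
    (hret : ∀ T Q Ls, (∀ m ∈ M, m ∈ T) → Ret e Q Ls → X ∈ Q → (∀ Y ∈ Q, Y ≠ X → Y ∈ T) →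
      (∀ L ∈ Ls, D k e (L + T + S₂)) → D k e (T + S₂))
    {T : Multiset (SF Pr)} (h : D k e (X ::ₘ T)) (hT : ∀ m ∈ M, m ∈ T) : D k e (T + S₂) := by
  classical
  generalize hY : X ::ₘ T = Y at h
  induction h generalizing T with
  | @dec X' E Ls S h hE hL ih =>
    rcases Multiset.cons_eq_cons.1 hY with ⟨rfl, rfl⟩ | ⟨hne, cs, rfl, rfl⟩
    · exact hdec _ _ _ hT h hE hL
    -- The rule removes a formula other than `X`. It cannot be a member of `M`, since apart from `X`
    -- these have no decomposition.
    · have hM' : ∀ m ∈ M, m ∈ cs := by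
        intro m hm
        rcases Multiset.mem_cons.1 (hT m hm) with rfl | h'
        · exact absurd h (hM m hm (Ne.symm hne) _ _)
        · exact h'
      rw [Multiset.cons_add]
      refine .dec h (fun Y hY => ?_) fun L hL => ?_
      -- The traced occurrence might itself serve as a side formula. Then either `X ∈ M`, so that
      -- another copy remains, or `X` is not an existence formula and cannot be a side formula.
      · rcases Multiset.mem_cons.1 (hE Y hY) with rfl | h'
        · rcases hX with hX | hX
          · exact Multiset.mem_add.2 (.inl (hM' _ hX))
          · exfalso
            cases h <;> first
              | exact hY.elim
              | (obtain ⟨t, _, ht⟩ := hY; exact hX _ ht)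
              | exact hX _ hY
        · exact Multiset.mem_add.2 (.inl h')
      · rw [← add_assoc]
        exact ih L hL (fun m hm => Multiset.mem_add.2 (.inr (hM' m hm)))
          (by rw [Multiset.add_cons])
  | @ret Q Ls S h hE hL ih =>
    subst hY
    have ih' : ∀ L ∈ Ls, D k e (L + T + S₂) := fun L hL =>
      ih L hL (fun m hm => Multiset.mem_add.2 (.inr (hT m hm))) (by rw [Multiset.add_cons])
    by_cases hXQ : X ∈ Q
    · exact hret _ _ _ hT h hXQ
        (fun Y hY hne => (Multiset.mem_cons.1 (hE Y hY)).resolve_left hne) ih'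
    · refine .ret h (fun Y hY => Multiset.mem_add.2 (.inl ?_))
        fun L hL => by rw [← add_assoc]; exact ih' L hL
      exact (Multiset.mem_cons.1 (hE Y hY)).resolve_left (fun h => hXQ (h ▸ hY))

/-! ### Rank of formulas -/

/-- The number of connectives and quantifiers, where identities count the weight of their terms. -/
def Fm.rank {T : ℕ → Type v} (wt : ∀ m, T m → ℕ) : {m : ℕ} → Fm Pr T m → ℕ
  | _, .ex _ => 0
  | _, .eq s t => wt _ s + wt _ t
  | _, .pred _ _ => 0
  | _, .neg φ => φ.rank wt + 1
  | _, .and φ ψ => φ.rank wt + ψ.rank wt + 1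
  | _, .imp φ ψ => φ.rank wt + ψ.rank wt + 1
  | _, .all φ => φ.rank wt + 1

/-- Descriptions weigh more than their bodies. -/
def Tm.weight (m : ℕ) : Tm Pr m → ℕ
  | .smp _ => 0
  | .desc φ => φ.rank (fun _ _ => 0) + 1

/-- The rank on which cut is reduced. -/
abbrev rk {m : ℕ} (φ : Fm Pr (Tm Pr) m) : ℕ := φ.rank Tm.weight

theorem Fm.rank_mapTm {T : ℕ → Type v} {T' : ℕ → Type w} (wt : ∀ m, T m → ℕ)
    (wt' : ∀ m, T' m → ℕ) (f : ∀ m, T (m + 1) → T' m) (h : ∀ m t, wt' m (f m t) = wt (m + 1) t) :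
    ∀ {m : ℕ} (φ : Fm Pr T (m + 1)), (φ.mapTm f).rank wt' = φ.rank wt
  | _, .ex _ => by simp [Fm.mapTm, Fm.rank]
  | _, .eq _ _ => by simp [Fm.mapTm, Fm.rank, h]
  | _, .pred _ _ => by simp [Fm.mapTm, Fm.rank]
  | _, .neg φ => by simp [Fm.mapTm, Fm.rank, Fm.rank_mapTm wt wt' f h φ]
  | _, .and φ ψ => by
    simp [Fm.mapTm, Fm.rank, Fm.rank_mapTm wt wt' f h φ, Fm.rank_mapTm wt wt' f h ψ]
  | _, .imp φ ψ => by
    simp [Fm.mapTm, Fm.rank, Fm.rank_mapTm wt wt' f h φ, Fm.rank_mapTm wt wt' f h ψ]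
  | _, .all φ => by simp [Fm.mapTm, Fm.rank, Fm.rank_mapTm wt wt' f h φ]

theorem rk_inst (φ : Fm Pr (Tm Pr) 1) (b : ℕ) : rk (φ.inst b) = rk φ := by
  refine Fm.rank_mapTm Tm.weight Tm.weight (Tm.inst b) (fun m t => ?_) φ
  cases t with
  | smp => rfl
  | desc φ =>
    exact congrArg (· + 1)
      (Fm.rank_mapTm (fun _ _ => 0) (fun _ _ => 0) (STm.inst b) (fun _ _ => rfl) φ)

theorem rk_instBody (φ : Fm Pr STm 1) (b : ℕ) : rk (φ.instBody b) = φ.rank (fun _ _ => 0) :=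
  Fm.rank_mapTm (fun _ _ => 0) Tm.weight (fun m t => Tm.smp (t.inst b m)) (fun _ _ => rfl) φ

theorem rk_instBody_lt (φ : Fm Pr STm 1) (b c : ℕ) : rk (φ.instBody b) < rk (descEq c φ) := by
  rw [rk_instBody]; simp [rk, Fm.rank, Tm.weight]

theorem rk_parEq_lt (φ : Fm Pr STm 1) (a b c : ℕ) : rk (parEq (Pr := Pr) a b) < rk (descEq c φ) := by
  simp [rk, Fm.rank, Tm.weight]

/-! ### Replacement of a parameter as a relation between formulas -/

/-- The terms agree, or they are `a` and `b`; if `p` then all terms are simple. -/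
inductive RelTm (p : Prop) (a b : ℕ) {m : ℕ} : Tm Pr m → Tm Pr m → Prop
  | refl (t : Tm Pr m) (ht : p → ∃ s, t = .smp s) : RelTm p a b t t
  | repl (hp : p) : RelTm p a b (.par a) (.par b)

/-- The second formula results from the first by replacing some occurrences of `a` by `b`. -/
inductive RelFm (p : Prop) (a b : ℕ) : {m : ℕ} → Fm Pr (Tm Pr) m → Fm Pr (Tm Pr) m → Prop
  | ex {m : ℕ} {t t' : Tm Pr m} : RelTm p a b t t' → RelFm p a b (.ex t) (.ex t')
  | eq {m : ℕ} {s t s' t' : Tm Pr m} :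
      RelTm p a b s s' → RelTm p a b t t' → RelFm p a b (.eq s t) (.eq s' t')
  | pred {m n : ℕ} (P : Pr n) {ts ts' : Fin n → Tm Pr m} :
      (∀ i, RelTm p a b (ts i) (ts' i)) → RelFm p a b (.pred P ts) (.pred P ts')
  | neg {m : ℕ} {φ φ' : Fm Pr (Tm Pr) m} : RelFm p a b φ φ' → RelFm p a b φ.neg φ'.neg
  | and {m : ℕ} {φ φ' ψ ψ' : Fm Pr (Tm Pr) m} :
      RelFm p a b φ φ' → RelFm p a b ψ ψ' → RelFm p a b (φ.and ψ) (φ'.and ψ')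
  | imp {m : ℕ} {φ φ' ψ ψ' : Fm Pr (Tm Pr) m} :
      RelFm p a b φ φ' → RelFm p a b ψ ψ' → RelFm p a b (φ.imp ψ) (φ'.imp ψ')
  | all {m : ℕ} {φ φ' : Fm Pr (Tm Pr) (m + 1)} : RelFm p a b φ φ' → RelFm p a b φ.all φ'.all

theorem RelTm.symm {p : Prop} {a b m : ℕ} {t t' : Tm Pr m} (h : RelTm p a b t t') :
    RelTm p b a t' t := by
  cases h with
  | refl t ht => exact .refl t ht
  | repl hp => exact .repl hp

theorem RelFm.symm {p : Prop} {a b m : ℕ} {φ φ' : Fm Pr (Tm Pr) m} (h : RelFm p a b φ φ') :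
    RelFm p b a φ' φ := by
  induction h with
  | ex h => exact .ex h.symm
  | eq h h' => exact .eq h.symm h'.symm
  | pred P h => exact .pred P fun i => (h i).symm
  | neg _ ih => exact .neg ih
  | and _ _ ih ih' => exact .and ih ih'
  | imp _ _ ih ih' => exact .imp ih ih'
  | all _ ih => exact .all ih

theorem RelTm.inst {p : Prop} {a b m : ℕ} {t t' : Tm Pr (m + 1)} (h : RelTm p a b t t') (c : ℕ) :
    RelTm p a b (t.inst c) (t'.inst c) := by
  cases h with
  | refl t ht =>
    refine .refl _ fun hp => ?_
    obtain ⟨s, rfl⟩ := ht hp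
    exact ⟨_, rfl⟩
  | repl hp => exact .repl hp

theorem RelFm.mapTm_inst {p : Prop} {a b : ℕ} (c : ℕ) : ∀ {m : ℕ} {φ φ' : Fm Pr (Tm Pr) (m + 1)},
    RelFm p a b φ φ' → RelFm p a b (φ.mapTm (Tm.inst c)) (φ'.mapTm (Tm.inst c))
  | _, _, _, .ex h => by simpa only [Fm.mapTm] using RelFm.ex (h.inst c)
  | _, _, _, .eq h h' => by simpa only [Fm.mapTm] using RelFm.eq (h.inst c) (h'.inst c)
  | _, _, _, .pred P h => by simpa only [Fm.mapTm] using RelFm.pred P fun i => (h i).inst c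
  | _, _, _, .neg h => by simpa only [Fm.mapTm] using RelFm.neg (RelFm.mapTm_inst c h)
  | _, _, _, .and h h' => by simpa only [Fm.mapTm] using RelFm.and (RelFm.mapTm_inst c h) (RelFm.mapTm_inst c h')
  | _, _, _, .imp h h' => by simpa only [Fm.mapTm] using RelFm.imp (RelFm.mapTm_inst c h) (RelFm.mapTm_inst c h')
  | _, _, _, .all h => by simpa only [Fm.mapTm] using RelFm.all (RelFm.mapTm_inst c h)

theorem RelFm.inst {p : Prop} {a b : ℕ} {φ φ' : Fm Pr (Tm Pr) 1} (h : RelFm p a b φ φ') (c : ℕ) :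
    RelFm p a b (φ.inst c) (φ'.inst c) := h.mapTm_inst c

theorem RelFm.rk_eq {p : Prop} {a b m : ℕ} {φ φ' : Fm Pr (Tm Pr) m} (h : RelFm p a b φ φ') :
    rk φ = rk φ' := by
  have tm : ∀ {m : ℕ} {t t' : Tm Pr m}, RelTm p a b t t' → t.weight = t'.weight := by
    intro m t t' h
    cases h <;> rfl
  induction h with
  | eq h h' => simp [Fm.rank, tm h, tm h']
  | _ => simp_all [Fm.rank]

/-- For `p` false the relation is equality on arbitrary formulas, for `p` true it is replacement on
formulas with simple terms. The parameter `p` lets one induction cover both. -/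
theorem RelFm.refl {p : Prop} (hp : ¬ p) (a b : ℕ) {m : ℕ} (φ : Fm Pr (Tm Pr) m) :
    RelFm p a b φ φ := by
  induction φ with
  | ex t => exact .ex (.refl t fun h => absurd h hp)
  | eq s t => exact .eq (.refl s fun h => absurd h hp) (.refl t fun h => absurd h hp)
  | pred P ts => exact .pred P fun i => .refl _ fun h => absurd h hp
  | neg _ ih => exact .neg ih
  | and _ _ ih ih' => exact .and ih ih'
  | imp _ _ ih ih' => exact .imp ih ih'
  | all _ ih => exact .all ih

theorem RelTm.smp_inst (a b m : ℕ) (t : STm (m + 1)) :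
    RelTm (Pr := Pr) True a b (.smp (t.inst a m)) (.smp (t.inst b m)) := by
  cases t with
  | par c => exact .refl _ fun _ => ⟨_, rfl⟩
  | var i =>
    by_cases h : i.val < m
    · simp only [STm.inst, h, dite_true]
      exact .refl _ fun _ => ⟨_, rfl⟩
    · simp only [STm.inst, h, dite_false]
      exact .repl trivial

theorem RelFm.mapTm_smp_inst (a b : ℕ) : ∀ {m : ℕ} (φ : Fm Pr STm (m + 1)),
    RelFm (Pr := Pr) True a b (φ.mapTm (fun m t => Tm.smp (t.inst a m)))
      (φ.mapTm (fun m t => Tm.smp (t.inst b m)))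
  | _, .ex _ => by simpa only [Fm.mapTm] using RelFm.ex (RelTm.smp_inst ..)
  | _, .eq _ _ => by simpa only [Fm.mapTm] using RelFm.eq (RelTm.smp_inst ..) (RelTm.smp_inst ..)
  | _, .pred P _ => by simpa only [Fm.mapTm] using RelFm.pred P fun _ => RelTm.smp_inst ..
  | _, .neg φ => by simpa only [Fm.mapTm] using RelFm.neg (RelFm.mapTm_smp_inst a b φ)
  | _, .and φ ψ => by simpa only [Fm.mapTm] using RelFm.and (RelFm.mapTm_smp_inst a b φ) (RelFm.mapTm_smp_inst a b ψ)
  | _, .imp φ ψ => by simpa only [Fm.mapTm] using RelFm.imp (RelFm.mapTm_smp_inst a b φ) (RelFm.mapTm_smp_inst a b ψ)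
  | _, .all φ => by simpa only [Fm.mapTm] using RelFm.all (RelFm.mapTm_smp_inst a b φ)

theorem RelFm.instBody (a b : ℕ) (φ : Fm Pr STm 1) :
    RelFm True a b (φ.instBody a) (φ.instBody b) := RelFm.mapTm_smp_inst a b φ

/-- Two related closed simple terms have a common template: a fixed parameter where they agree, the
bound variable where they differ. Descriptions are excluded, so substitution never has to enter one.
-/
theorem RelTm.substTm {a b : ℕ} {t t' : Tm Pr 0} (h : RelTm True a b t t') :
    ∃ v : Tm Pr 1, SubstTm (.par a) v t ∧ SubstTm (.par b) v t' := by
  cases h with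
  | refl t ht =>
    obtain ⟨s, rfl⟩ := ht trivial
    cases s with
    | par c => exact ⟨_, .par c, .par c⟩
    | var i => exact i.elim0
  | repl _ => exact ⟨_, .var, .var⟩

/-! ### Axioms for compound formulas and replacement of parameters -/

theorem isAtomic_ex (t : Tm Pr 0) : IsAtomic (.ex t) := .inr ⟨t, rfl⟩

theorem not_isParEqDesc_parEq (a b : ℕ) : ¬ IsParEqDesc (parEq (Pr := Pr) a b) := by
  rintro ⟨_, _, h⟩; cases h

theorem D.axiom_l₁r₁ {A : Form Pr} {S} (hA : IsAtomic A) (h : L₁ A ∈ S) (h' : R₁ A ∈ S) : D k e S :=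
  .ret (.axLeftLeft A hA) (by simp [h, h']) (by simp)

theorem D.axiom_l₂r₂ {A : Form Pr} {S} (hA : IsAtomic A) (h : L₂ A ∈ S) (h' : R₂ A ∈ S) : D k e S :=
  .ret (.axRightRight A hA) (by simp [h, h']) (by simp)

theorem D.axiom_l₁r₂ {A : Form Pr} {S} (hA : IsAtomic A) (h : L₁ A ∈ S) (h' : R₂ A ∈ S) : D k e S :=
  .ret (.axLeftRight A hA) (by simp [h, h']) (by simp)

theorem SubstAtom.isAtomic {t : Tm Pr 0} {A At} (h : SubstAtom t A At) : IsAtomic At := by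
  cases h with
  | ex => exact isAtomic_ex _
  | eq => exact .inl (.eq _ _)
  | pred => exact .inl (.pred _ _)

/-- Replacement of identicals in the first antecedent, in either form of the rule. -/
theorem D.repl {t s : Tm Pr 0} {I : Form Pr} {A : Fm Pr (Tm Pr) 1} {At As : Form Pr}
    {S : Multiset (SF Pr)} (hI : I = .eq t s ∨ I = .eq s t)
    (ht : SubstAtom t A At) (hs : SubstAtom s A As) (hIS : L₁ I ∈ S) (hAt : L₁ At ∈ S)
    (h : D k e (L₁ As ::ₘ S)) : D k e S := by
  have hI' : IsAtomic I := by rcases hI with rfl | rfl <;> exact .inl (.eq _ _)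
  cases e with
  | first =>
    refine .ret (.replFirst rfl t s I hI A At As ht hs) (by simp) ?_
    simp only [Set.mem_insert_iff, Set.mem_singleton_iff, forall_eq_or_imp, forall_eq,
      Multiset.singleton_add]
    exact ⟨.axiom_l₁r₁ hI' (by simp [hIS]) (by simp), .axiom_l₁r₁ ht.isAtomic (by simp [hAt])
      (by simp), h⟩
  | second =>
    refine .ret (.replSecond rfl t s I hI A At As ht hs) (by simp) ?_
    simp only [Set.mem_insert_iff, Set.mem_singleton_iff, forall_eq_or_imp, forall_eq,
      Multiset.singleton_add]
    exact ⟨.axiom_l₁r₂ hI' (by simp [hIS]) (by simp), .axiom_l₁r₂ ht.isAtomic (by simp [hAt])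
      (by simp), h⟩

theorem exists_listsArgs {P : Form Pr} (hP : IsPredication P) : ∃ ts, ListsArgs ts P := by
  cases hP with
  | eq s t => exact ⟨{s, t}, fun u => by simp [args]⟩
  | pred P ts => exact ⟨Finset.univ.val.map ts, fun u => by simp [args]⟩

theorem D.exL₁ {P : Form Pr} {S : Multiset (SF Pr)} (hP : IsPredication P) (hd : ¬ IsParEqDesc P)
    {t} (ht : t ∈ args P) (hPS : L₁ P ∈ S) (h : D k e (L₁ (.ex t) ::ₘ S)) : D k e S :=
  .ret (.exL₁ P hP hd t ht) (by simpa) (by simpa)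

theorem D.exR₂ {P : Form Pr} {S : Multiset (SF Pr)} (hP : IsPredication P) (hd : ¬ IsParEqDesc P)
    {t} (ht : t ∈ args P) (hPS : R₂ P ∈ S) (h : D k e (L₁ (.ex t) ::ₘ S)) : D k e S :=
  .ret (.exR₂ P hP hd t ht) (by simpa) (by simpa)

/-- A predication can only be false if its arguments exist. The existence rule keeps `P`, so it can
be applied to the arguments one after another. -/
theorem D.exR₂_all {P : Form Pr} (hP : IsPredication P) (hd : ¬ IsParEqDesc P)
    {S : Multiset (SF Pr)} (hPS : R₂ P ∈ S)
    (h : ∀ S', (∀ Y ∈ S, Y ∈ S') → (∀ Y ∈ argsEx P, Y ∈ S') → S ≤ S' → D k e S') : D k e S := by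
  obtain ⟨ts, hts⟩ := exists_listsArgs hP
  have key : ∀ us : Multiset (Tm Pr 0), (∀ t ∈ us, t ∈ args P) →
      ∀ S' : Multiset (SF Pr), S ≤ S' →
      D k e (us.map (fun t => L₁ (.ex t)) + S') → D k e S' := by
    intro us
    induction us using Multiset.induction_on with
    | empty => intro _ S' _ h; simpa using h
    | cons t us ih =>
      intro hus S' hS' h
      refine D.exR₂ hP hd (hus t (by simp)) (Multiset.mem_of_le hS' hPS) ?_
      refine ih (fun t ht => hus t (by simp [ht])) _ (hS'.trans (Multiset.le_cons_self _ _)) ?_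
      simpa using h
  refine key ts (fun t ht => (hts t).1 ht) S le_rfl (h _ ?_ ?_ ?_)
  · intro Y hY; simp [hY]
  · rintro Y ⟨t, ht, rfl⟩
    exact Multiset.mem_add.2 (.inl (Multiset.mem_map.2 ⟨t, (hts t).2 ht, rfl⟩))
  · exact Multiset.le_add_left _ _

/-- Decompose two formulas of a bisequent. -/
theorem D.dec₂ {X Y : SF Pr} {LsX LsY} (hX : Dec k X ∅ LsX) (hY : Dec k Y ∅ LsY) (hne : X ≠ Y)
    {S : Multiset (SF Pr)} (hXS : X ∈ S) (hYS : Y ∈ S)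
    (h : ∀ L ∈ LsX, ∀ L' ∈ LsY, ∀ S', (∀ Z ∈ S, Z ≠ X → Z ≠ Y → Z ∈ S') →
      D k e (L' + (L + S'))) : D k e S := by
  obtain ⟨S, rfl⟩ := Multiset.exists_cons_of_mem hXS
  obtain ⟨S, rfl⟩ := Multiset.exists_cons_of_mem ((Multiset.mem_cons.1 hYS).resolve_left hne.symm)
  refine .dec hX (by simp) fun L hL => ?_
  rw [Multiset.add_cons]
  refine .dec hY (by simp) fun L' hL' => h L hL L' hL' S fun Z hZ h₁ h₂ => ?_
  simpa [h₁, h₂] using hZ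

theorem RelTm.smp_left {a b m : ℕ} {t t' : Tm Pr m} (h : RelTm True a b t t') :
    ∃ s, t = .smp s := by
  cases h with
  | refl t ht => exact ht trivial
  | repl => exact ⟨_, rfl⟩

theorem RelTm.eq_of_not {p : Prop} (hp : ¬ p) {a b m : ℕ} {t t' : Tm Pr m}
    (h : RelTm p a b t t') : t = t' := by
  cases h with
  | refl => rfl
  | repl h => exact absurd h hp

theorem RelTm.mem_of {p : Prop} {a b : ℕ} {t t' : Tm Pr 0} (h : RelTm p a b t t')
    {S : Multiset (SF Pr)} (ht : L₁ (.ex t') ∈ S) (ha : L₁ (exPar a) ∈ S) : L₁ (.ex t) ∈ S := by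
  cases h with
  | refl => exact ht
  | repl => exact ha

/-- One replacement puts `φ'` in the first antecedent, where an axiom closes the bisequent. -/
theorem D.rel_atom {a b : ℕ} {S : Multiset (SF Pr)}
    (hab : L₁ (parEq a b) ∈ S ∨ L₁ (parEq b a) ∈ S) {φ φ' : Form Pr}
    (hA : ∃ A, SubstAtom (.par a) A φ ∧ SubstAtom (.par b) A φ')
    (hφ : L₁ φ ∈ S) (h : R₁ φ' ∈ S ∨ R₂ φ' ∈ S) : D k e S := by
  obtain ⟨A, h₁, h₂⟩ := hA
  have : ∃ I : Form Pr, (I = .eq (.par a) (.par b) ∨ I = .eq (.par b) (.par a)) ∧ L₁ I ∈ S := by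
    rcases hab with h | h
    · exact ⟨_, .inl rfl, h⟩
    · exact ⟨_, .inr rfl, h⟩
  obtain ⟨I, hI, hIS⟩ := this
  refine D.repl hI h₁ h₂ hIS hφ ?_
  rcases h with h | h
  · exact .axiom_l₁r₁ h₂.isAtomic (by simp) (by simp [h])
  · exact .axiom_l₁r₂ h₂.isAtomic (by simp) (by simp [h])

/-- Replacement adds its result to the first antecedent, so `φ` must be moved there, which requires
its arguments to exist. The falsity of `φ'` makes the arguments of `φ'` exist. The arguments of `φ`
are among these, except possibly `a`, which exists because of the identity. -/
theorem D.rel_pred {a b : ℕ} {S : Multiset (SF Pr)}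
    (hab : L₁ (parEq a b) ∈ S ∨ L₁ (parEq b a) ∈ S) {φ φ' : Form Pr}
    (hP : IsPredication φ) (hP' : IsPredication φ')
    (hd : ¬ IsParEqDesc φ) (hd' : ¬ IsParEqDesc φ')
    (hA : ∃ A, SubstAtom (.par a) A φ ∧ SubstAtom (.par b) A φ')
    (hargs : ∀ t ∈ args φ, ∃ t' ∈ args φ', RelTm True a b t t')
    (hφ : L₂ φ ∈ S) (h : R₂ φ' ∈ S) : D k e S := by
  have hEa : (∀ S' : Multiset (SF Pr), S ≤ S' → L₁ (exPar a) ∈ S' → D k e S') → D k e S := by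
    intro H
    rcases hab with h | h
    · exact D.exL₁ (.eq _ _) (not_isParEqDesc_parEq a b) (t := .par a) (by simp [args]) h
        (H _ (Multiset.le_cons_self _ _) (by simp))
    · exact D.exL₁ (.eq _ _) (not_isParEqDesc_parEq b a) (t := .par a) (by simp [args]) h
        (H _ (Multiset.le_cons_self _ _) (by simp))
  refine hEa fun S' hS' hEa => D.exR₂_all hP' hd' (Multiset.mem_of_le hS' h) fun S₁ hS₁ hE _ => ?_
  have hsub : ∀ Y ∈ S, Y ∈ S₁ := fun Y hY => hS₁ Y (Multiset.mem_of_le hS' hY)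
  obtain ⟨S₂, rfl⟩ := Multiset.exists_cons_of_mem (hsub _ hφ)
  refine .dec (.exL₂ φ hP hd) ?_ ?_
  · rintro Y ⟨t, ht, rfl⟩
    obtain ⟨t', ht', hr⟩ := hargs t ht
    have := hr.mem_of (hE _ ⟨t', ht', rfl⟩) (hS₁ _ hEa)
    simpa using this
  · simp only [Set.mem_singleton_iff, forall_eq, Multiset.singleton_add]
    have h' := hsub _ h
    have hsub' : ∀ {ψ : Form Pr}, L₁ ψ ∈ S → L₁ ψ ∈ S₂ := fun {ψ} hψ => by simpa using hsub _ hψ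
    refine D.rel_atom (a := a) (b := b) ?_ hA (by simp) (.inr (by simpa using h'))
    rcases hab with h | h
    · exact .inl (by simpa using Or.inr (hsub' h))
    · exact .inr (by simpa using Or.inr (hsub' h))

theorem RelFm.exists_substAtom {a b : ℕ} {φ φ' : Form Pr} (hA : IsAtomic φ)
    (h : RelFm True a b φ φ') : ∃ A, SubstAtom (.par a) A φ ∧ SubstAtom (.par b) A φ' := by
  cases h with
  | ex h => obtain ⟨v, h₁, h₂⟩ := h.substTm; exact ⟨_, .ex h₁, .ex h₂⟩
  | eq h h' =>
    obtain ⟨v, h₁, h₂⟩ := h.substTm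
    obtain ⟨v', h₁', h₂'⟩ := h'.substTm
    exact ⟨_, .eq h₁ h₁', .eq h₂ h₂'⟩
  | pred P h =>
    choose v h₁ h₂ using fun i => (h i).substTm
    exact ⟨_, .pred P h₁, .pred P h₂⟩
  | _ => rcases hA with h | ⟨_, h⟩ <;> cases h

theorem RelFm.not_isParEqDesc {a b : ℕ} {φ φ' : Form Pr} (h : RelFm True a b φ φ') :
    ¬ IsParEqDesc φ := by
  rintro ⟨c, δ, rfl⟩
  cases h with
  | eq h h' => obtain ⟨s, hs⟩ := h'.smp_left; cases hs

/-- `φ` is incompatible with the denial of `φ'` if `φ'` results from `φ`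
by replacements of `a` by `b` and `a = b` is assumed. -/
theorem D.rel {p : Prop} {a b : ℕ} {φ φ' : Form Pr} (hr : RelFm p a b φ φ')
    {S : Multiset (SF Pr)} (hS : p → L₁ (parEq a b) ∈ S ∨ L₁ (parEq b a) ∈ S)
    (h : L₁ φ ∈ S ∧ R₁ φ' ∈ S ∨ L₂ φ ∈ S ∧ R₂ φ' ∈ S ∨ L₁ φ ∈ S ∧ R₂ φ' ∈ S) : D k e S := by
  induction hn : rk φ using Nat.strong_induction_on generalizing a b φ φ' S with
  | _ n ih =>
  subst hn
  have atom : IsAtomic φ → RelFm p a b φ φ' → (p ∨ φ = φ') → D k e S := by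
    intro hA hr hp
    by_cases hp' : p
    · simp only [hp', forall_const] at hS
      simp only [hp'] at hr
      rcases h with ⟨h₁, h₂⟩ | ⟨h₁, h₂⟩ | ⟨h₁, h₂⟩
      · exact D.rel_atom hS (hr.exists_substAtom hA) h₁ (.inl h₂)
      · cases hr with
        | ex hr' =>
          obtain ⟨S, rfl⟩ := Multiset.exists_cons_of_mem h₁
          refine .dec (.exTr₁ _) (by simp) ?_
          simp only [Set.mem_singleton_iff, forall_eq, Multiset.singleton_add]
          refine D.rel_atom (a := a) (b := b) ?_ ((RelFm.ex hr').exists_substAtom hA)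
            (by simp) (.inr (by simpa using h₂))
          simpa using hS
        | @eq _ s t s' t' hs ht =>
          refine D.rel_pred hS (.eq _ _) (.eq _ _) (RelFm.eq hs ht).not_isParEqDesc
            (RelFm.eq hs ht).symm.not_isParEqDesc ((RelFm.eq hs ht).exists_substAtom hA) ?_ h₁ h₂
          simp only [args, Set.mem_insert_iff, Set.mem_singleton_iff, forall_eq_or_imp, forall_eq,
            exists_eq_or_imp, exists_eq_left]
          exact ⟨.inl hs, .inr ht⟩
        | @pred _ _ P ts ts' hr' =>
          refine D.rel_pred hS (.pred _ _) (.pred _ _) (RelFm.pred P hr').not_isParEqDesc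
            (RelFm.pred P hr').symm.not_isParEqDesc ((RelFm.pred P hr').exists_substAtom hA) ?_ h₁ h₂
          rintro _ ⟨i, rfl⟩
          exact ⟨_, ⟨i, rfl⟩, hr' i⟩
        | _ => rcases hA with h | ⟨_, h⟩ <;> cases h
      · exact D.rel_atom hS (hr.exists_substAtom hA) h₁ (.inr h₂)
    · obtain rfl := hp.resolve_left hp'
      rcases h with ⟨h₁, h₂⟩ | ⟨h₁, h₂⟩ | ⟨h₁, h₂⟩
      · exact .axiom_l₁r₁ hA h₁ h₂
      · exact .axiom_l₂r₂ hA h₁ h₂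
      · exact .axiom_l₁r₂ hA h₁ h₂
  have hle : ∀ L L' S' : Multiset (SF Pr), S' ≤ L' + (L + S') := fun L L' S' =>
    (Multiset.le_add_left _ _).trans (Multiset.le_add_left _ _)
  have side : ∀ {X Y : SF Pr} {S' : Multiset (SF Pr)}, (∀ s t, X ≠ L₁ (.eq s t)) → (∀ s t, Y ≠ L₁ (.eq s t)) →
      (∀ Z ∈ S, Z ≠ X → Z ≠ Y → Z ∈ S') →
      (p → L₁ (parEq a b) ∈ S' ∨ L₁ (parEq b a) ∈ S') := by
    intro X Y S' h₁ h₂ h₃ hp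
    exact (hS hp).imp (fun h => h₃ _ h (h₁ _ _).symm (h₂ _ _).symm)
      (fun h => h₃ _ h (h₁ _ _).symm (h₂ _ _).symm)
  -- After both compound formulas are decomposed, every combination of premises contains one of
  -- these clashes between immediate subformulas. This includes all nine combinations of two weak
  -- Kleene rules. Both directions occur because subformulas may change sides.
  have closeφψ : ∀ {φ₁ φ₁' φ₂ φ₂' : Form Pr} {X Y : SF Pr} {W S' : Multiset (SF Pr)},
      RelFm p a b φ₁ φ₁' → RelFm p a b φ₂ φ₂' → rk φ₁ < rk φ → rk φ₂ < rk φ →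
      (∀ s t, X ≠ L₁ (.eq s t)) → (∀ s t, Y ≠ L₁ (.eq s t)) →
      (∀ Z ∈ S, Z ≠ X → Z ≠ Y → Z ∈ S') →
      ((L₁ φ₁ ∈ W ∧ R₁ φ₁' ∈ W ∨ L₂ φ₁ ∈ W ∧ R₂ φ₁' ∈ W ∨ L₁ φ₁ ∈ W ∧ R₂ φ₁' ∈ W) ∨
        (L₁ φ₁' ∈ W ∧ R₁ φ₁ ∈ W ∨ L₂ φ₁' ∈ W ∧ R₂ φ₁ ∈ W ∨ L₁ φ₁' ∈ W ∧ R₂ φ₁ ∈ W) ∨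
        (L₁ φ₂ ∈ W ∧ R₁ φ₂' ∈ W ∨ L₂ φ₂ ∈ W ∧ R₂ φ₂' ∈ W ∨ L₁ φ₂ ∈ W ∧ R₂ φ₂' ∈ W) ∨
        (L₁ φ₂' ∈ W ∧ R₁ φ₂ ∈ W ∨ L₂ φ₂' ∈ W ∧ R₂ φ₂ ∈ W ∨ L₁ φ₂' ∈ W ∧ R₂ φ₂ ∈ W)) →
      S' ≤ W → D k e W := by
    intro φ₁ φ₁' φ₂ φ₂' X Y W S' hr₁ hr₂ hlt₁ hlt₂ hX hY hS' h hle
    have hp' : p → L₁ (parEq a b) ∈ W ∨ L₁ (parEq b a) ∈ W := fun hp =>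
      (side hX hY hS' hp).imp (Multiset.mem_of_le hle) (Multiset.mem_of_le hle)
    rcases h with h | h | h | h
    · exact ih _ hlt₁ hr₁ hp' h rfl
    · exact ih _ (hr₁.rk_eq ▸ hlt₁) hr₁.symm (fun hp => (hp' hp).symm) h rfl
    · exact ih _ hlt₂ hr₂ hp' h rfl
    · exact ih _ (hr₂.rk_eq ▸ hlt₂) hr₂.symm (fun hp => (hp' hp).symm) h rfl
  cases hr with
  | ex hr =>
    exact atom (isAtomic_ex _) (.ex hr) (or_iff_not_imp_left.2 fun h => by rw [hr.eq_of_not h])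
  | eq hs ht =>
    exact atom (.inl (.eq _ _)) (.eq hs ht)
      (or_iff_not_imp_left.2 fun h => by rw [hs.eq_of_not h, ht.eq_of_not h])
  | pred P hr =>
    exact atom (.inl (.pred _ _)) (.pred P hr)
      (or_iff_not_imp_left.2 fun h => by
        congr 1; funext i; exact (hr i).eq_of_not h)
  | @neg _ φ φ' hr =>
    -- Negation exchanges truth and falsity, so the two formulas swap roles and the induction
    -- hypothesis is used with `a` and `b` interchanged.
    have hlt : rk φ' < rk φ.neg := by rw [← hr.rk_eq]; simp [rk, Fm.rank]
    rcases h with ⟨h₁, h₂⟩ | ⟨h₁, h₂⟩ | ⟨h₁, h₂⟩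
    · refine D.dec₂ (.negL₁ _) (.negR₁ _) (by simp) h₁ h₂ ?_
      simp only [Set.mem_singleton_iff, forall_eq]
      intro S' hS'
      refine ih _ hlt hr.symm (fun hp => ?_) (.inr (.inl (by simp))) rfl
      exact (side (by simp) (by simp) hS' hp).symm.imp (Multiset.mem_of_le (hle _ _ _))
        (Multiset.mem_of_le (hle _ _ _))
    · refine D.dec₂ (.negL₂ _) (.negR₂ _) (by simp) h₁ h₂ ?_
      simp only [Set.mem_singleton_iff, forall_eq]
      intro S' hS'
      refine ih _ hlt hr.symm (fun hp => ?_) (.inl (by simp)) rfl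
      exact (side (by simp) (by simp) hS' hp).symm.imp (Multiset.mem_of_le (hle _ _ _))
        (Multiset.mem_of_le (hle _ _ _))
    · refine D.dec₂ (.negL₁ _) (.negR₂ _) (by simp) h₁ h₂ ?_
      simp only [Set.mem_singleton_iff, forall_eq]
      intro S' hS'
      refine ih _ hlt hr.symm (fun hp => ?_) (.inr (.inr (by simp))) rfl
      exact (side (by simp) (by simp) hS' hp).symm.imp (Multiset.mem_of_le (hle _ _ _))
        (Multiset.mem_of_le (hle _ _ _))
  | @and _ φ φ' ψ ψ' hφ hψ =>
    have hlt : rk φ < rk (φ.and ψ) ∧ rk ψ < rk (φ.and ψ) := by simp [rk, Fm.rank]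
    rcases h with ⟨h₁, h₂⟩ | ⟨h₁, h₂⟩ | ⟨h₁, h₂⟩
    · refine D.dec₂ (.andL₁ _ _) (.andR₁ _ _) (by simp) h₁ h₂ ?_
      rintro L hL L' hL' S' hS'
      simp only [Set.mem_singleton_iff, Set.mem_insert_iff] at hL hL'
      subst hL
      rcases hL' with rfl | rfl <;>
          exact closeφψ hφ hψ hlt.1 hlt.2 (by simp) (by simp) hS' (by simp) (hle _ _ _)
    · rcases k with _ | _
      · refine D.dec₂ (.andL₂ rfl _ _) (.andR₂ rfl _ _) (by simp) h₁ h₂ ?_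
        rintro L hL L' hL' S' hS'
        simp only [Set.mem_singleton_iff, Set.mem_insert_iff] at hL hL'
        subst hL
        rcases hL' with rfl | rfl <;>
          exact closeφψ hφ hψ hlt.1 hlt.2 (by simp) (by simp) hS' (by simp) (hle _ _ _)
      · refine D.dec₂ (.andL₂w rfl _ _) (.andR₂w rfl _ _) (by simp) h₁ h₂ ?_
        rintro L hL L' hL' S' hS'
        simp only [Set.mem_singleton_iff, Set.mem_insert_iff] at hL hL'
        rcases hL with rfl | rfl | rfl <;> rcases hL' with rfl | rfl | rfl <;>
          exact closeφψ hφ hψ hlt.1 hlt.2 (by simp) (by simp) hS' (by simp) (hle _ _ _)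
    · rcases k with _ | _
      · refine D.dec₂ (.andL₁ _ _) (.andR₂ rfl _ _) (by simp) h₁ h₂ ?_
        rintro L hL L' hL' S' hS'
        simp only [Set.mem_singleton_iff, Set.mem_insert_iff] at hL hL'
        subst hL
        rcases hL' with rfl | rfl <;>
          exact closeφψ hφ hψ hlt.1 hlt.2 (by simp) (by simp) hS' (by simp) (hle _ _ _)
      · refine D.dec₂ (.andL₁ _ _) (.andR₂w rfl _ _) (by simp) h₁ h₂ ?_
        rintro L hL L' hL' S' hS'
        simp only [Set.mem_singleton_iff, Set.mem_insert_iff] at hL hL'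
        subst hL
        rcases hL' with rfl | rfl | rfl <;>
          exact closeφψ hφ hψ hlt.1 hlt.2 (by simp) (by simp) hS' (by simp) (hle _ _ _)
  | @imp _ φ φ' ψ ψ' hφ hψ =>
    have hlt : rk φ < rk (φ.imp ψ) ∧ rk ψ < rk (φ.imp ψ) := by simp [rk, Fm.rank]
    rcases h with ⟨h₁, h₂⟩ | ⟨h₁, h₂⟩ | ⟨h₁, h₂⟩
    · rcases k with _ | _
      · refine D.dec₂ (.impL₁ rfl _ _) (.impR₁ rfl _ _) (by simp) h₁ h₂ ?_
        rintro L hL L' hL' S' hS'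
        simp only [Set.mem_singleton_iff, Set.mem_insert_iff] at hL hL'
        subst hL'
        rcases hL with rfl | rfl <;>
          exact closeφψ hφ hψ hlt.1 hlt.2 (by simp) (by simp) hS' (by simp) (hle _ _ _)
      · refine D.dec₂ (.impL₁w rfl _ _) (.impR₁w rfl _ _) (by simp) h₁ h₂ ?_
        rintro L hL L' hL' S' hS'
        simp only [Set.mem_singleton_iff, Set.mem_insert_iff] at hL hL'
        rcases hL with rfl | rfl | rfl <;> rcases hL' with rfl | rfl | rfl <;>
          exact closeφψ hφ hψ hlt.1 hlt.2 (by simp) (by simp) hS' (by simp) (hle _ _ _)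
    · refine D.dec₂ (.impL₂ _ _) (.impR₂ _ _) (by simp) h₁ h₂ ?_
      rintro L hL L' hL' S' hS'
      simp only [Set.mem_singleton_iff, Set.mem_insert_iff] at hL hL'
      subst hL'
      rcases hL with rfl | rfl <;>
          exact closeφψ hφ hψ hlt.1 hlt.2 (by simp) (by simp) hS' (by simp) (hle _ _ _)
    · rcases k with _ | _
      · refine D.dec₂ (.impL₁ rfl _ _) (.impR₂ _ _) (by simp) h₁ h₂ ?_
        rintro L hL L' hL' S' hS'
        simp only [Set.mem_singleton_iff, Set.mem_insert_iff] at hL hL'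
        subst hL'
        rcases hL with rfl | rfl <;>
          exact closeφψ hφ hψ hlt.1 hlt.2 (by simp) (by simp) hS' (by simp) (hle _ _ _)
      · refine D.dec₂ (.impL₁w rfl _ _) (.impR₂ _ _) (by simp) h₁ h₂ ?_
        rintro L hL L' hL' S' hS'
        simp only [Set.mem_singleton_iff, Set.mem_insert_iff] at hL hL'
        subst hL'
        rcases hL with rfl | rfl | rfl <;>
          exact closeφψ hφ hψ hlt.1 hlt.2 (by simp) (by simp) hS' (by simp) (hle _ _ _)
  | @all _ φ φ' hr =>
    have hlt : ∀ c, rk (φ.inst c) < rk φ.all := fun c => by rw [rk_inst]; simp [rk, Fm.rank]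
    rcases h with ⟨h₁, h₂⟩ | ⟨h₁, h₂⟩ | ⟨h₁, h₂⟩
    · obtain ⟨S, rfl⟩ := Multiset.exists_cons_of_mem h₂
      refine .dec (.allR₁ _) (by simp) ?_
      rintro _ ⟨c, rfl⟩
      refine .ret (.allL₁ φ c) (by simpa using h₁) ?_
      simp only [Set.mem_singleton_iff, forall_eq]
      refine ih _ (hlt c) (hr.inst c) (fun hp => ?_) (.inl (by simp)) rfl
      exact (hS hp).imp (by simp +contextual) (by simp +contextual)
    · obtain ⟨S, rfl⟩ := Multiset.exists_cons_of_mem h₂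
      refine .dec (.allR₂ _) (by simp) ?_
      rintro _ ⟨c, rfl⟩
      refine .ret (.allL₂ φ c) (by simpa using h₁) ?_
      simp only [Set.mem_singleton_iff, forall_eq]
      refine ih _ (hlt c) (hr.inst c) (fun hp => ?_) (.inr (.inl (by simp))) rfl
      exact (hS hp).imp (by simp +contextual) (by simp +contextual)
    · obtain ⟨S, rfl⟩ := Multiset.exists_cons_of_mem h₂
      refine .dec (.allR₂ _) (by simp) ?_
      rintro _ ⟨c, rfl⟩
      refine .ret (.allL₁ φ c) (by simpa using h₁) ?_
      simp only [Set.mem_singleton_iff, forall_eq]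
      refine ih _ (hlt c) (hr.inst c) (fun hp => ?_) (.inr (.inr (by simp))) rfl
      exact (hS hp).imp (by simp +contextual) (by simp +contextual)

/-- No bisequent can be refuted by a formula both true and not true, or both false and not false,
or both true and false. -/
theorem D.identity (φ : Form Pr) {S : Multiset (SF Pr)}
    (h : L₁ φ ∈ S ∧ R₁ φ ∈ S ∨ L₂ φ ∈ S ∧ R₂ φ ∈ S ∨ L₁ φ ∈ S ∧ R₂ φ ∈ S) : D k e S :=
  D.rel (RelFm.refl not_false 0 0 φ) (fun h => h.elim) h

/-! ### Derived rules for identity and descriptions -/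

theorem D.reflexivity {S : Multiset (SF Pr)} {t : Tm Pr 0} (ht : L₁ (.ex t) ∈ S)
    (h : D k e (L₁ (.eq t t) ::ₘ S)) : D k e S :=
  .ret (.eqRefl t) (by simpa) (by simpa)

theorem D.describe {S : Multiset (SF Pr)} {φ : Fm Pr STm 1} (hφ : L₁ (.ex (.desc φ)) ∈ S)
    (h : ∀ a, D k e (L₁ (descEq a φ) ::ₘ S)) : D k e S :=
  .ret (.exDesc φ) (by simpa) (by simpa)

theorem D.descL₁one {S : Multiset (SF Pr)} {φ : Fm Pr STm 1} {c : ℕ} (hcφ : L₁ (descEq c φ) ∈ S)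
    (hc : L₁ (exPar c) ∈ S) (h : D k e (L₁ (φ.instBody c) ::ₘ S)) : D k e S :=
  .ret (.descL₁one φ c) (by simp [hcφ, hc]) (by simpa)

theorem D.descL₂one {S : Multiset (SF Pr)} {φ : Fm Pr STm 1} {c : ℕ} (hcφ : L₂ (descEq c φ) ∈ S)
    (hc : L₁ (exPar c) ∈ S) (h : D k e (L₂ (φ.instBody c) ::ₘ S)) : D k e S :=
  .ret (.descL₂one φ c) (by simp [hcφ, hc]) (by simpa)

/-- This lifts the restriction to distinct parameters: for `b = c` the second premise adds only `b =
b`, which reflexivity supplies. -/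
theorem D.descL₁two {S : Multiset (SF Pr)} {φ : Fm Pr STm 1} {b c : ℕ}
    (hcφ : L₁ (descEq c φ) ∈ S) (hb : L₁ (exPar b) ∈ S) (hc : L₁ (exPar c) ∈ S)
    (h : D k e (R₂ (φ.instBody b) ::ₘ S)) (h' : D k e (L₁ (parEq b c) ::ₘ S)) : D k e S := by
  by_cases hbc : b = c
  · subst hbc
    exact .reflexivity hb h'
  · exact .ret (.descL₁two φ b c hbc) (by simp [hcφ, hb, hc]) (by simp [h, h'])

theorem D.ex_of_descEq {S : Multiset (SF Pr)} {φ : Fm Pr STm 1} {a : ℕ}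
    (haφ : L₁ (descEq a φ) ∈ S) (hφ : L₁ (.ex (.desc φ)) ∈ S) (h : D k e (L₁ (exPar a) ::ₘ S)) :
    D k e S :=
  .repl (t := .desc φ) (s := .par a) (.inr rfl) (A := .ex (.smp (.var 0))) (.ex .var) (.ex .var)
    haφ hφ h

theorem D.descEq_trans {S : Multiset (SF Pr)} {φ : Fm Pr STm 1} {a c : ℕ}
    (haφ : L₁ (descEq a φ) ∈ S) (ha : L₁ (exPar a) ∈ S) (hac : L₁ (parEq a c) ∈ S)
    (h : D k e (L₁ (descEq c φ) ::ₘ S)) : D k e S := by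
  refine .reflexivity ha ?_
  -- From `a = a`, replacing the left occurrence gives `c = a`, and replacing the right one gives
  -- the identity of `c` with the description.
  refine .repl (t := .par a) (s := .par c) (.inl rfl) (A := .eq (.smp (.var 0)) (.par a))
    (.eq .var (.par a)) (.eq .var (.par a)) (by simp [hac]) (by simp) ?_
  refine .repl (t := .par a) (s := .desc φ) (.inl rfl) (A := .eq (.par c) (.smp (.var 0)))
    (.eq (.par c) .var) (.eq (.par c) .var) (by simp [haφ]) (by simp) ?_
  refine h.weaken_le (Multiset.cons_le_cons _ ?_)
  exact (Multiset.le_cons_self _ _).trans (Multiset.le_cons_self _ _)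

/-- If `c` and `d` exist and `c = d` is not false, then `c = d` is true. -/
theorem D.descEq_l₁_of_l₂ {S : Multiset (SF Pr)} {φ : Fm Pr STm 1} {c : ℕ}
    (hc : L₁ (exPar c) ∈ S) (hφ : L₁ (.ex (.desc φ)) ∈ S) (hcφ : L₂ (descEq c φ) ∈ S)
    (h : D k e (L₁ (descEq c φ) ::ₘ S)) : D k e S := by
  refine .describe hφ fun a => ?_
  by_cases hac : a = c
  · exact hac ▸ h
  refine .ex_of_descEq (a := a) (φ := φ) (by simp) (by simp [hφ]) ?_
  refine .descL₁one (c := a) (φ := φ) (by simp) (by simp) ?_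
  -- The name `a` of the description satisfies `φ`. As `c = ιx φ` is not false, uniqueness leaves
  -- only that `a = c` is not false. Both parameters exist, so `a = c` is true and transitivity
  -- applies.
  refine .ret (.descL₂two φ a c hac) (by simp [hc, hcφ]) ?_
  simp only [Set.mem_insert_iff, Set.mem_singleton_iff, forall_eq_or_imp, forall_eq,
    Multiset.singleton_add]
  refine ⟨D.identity (φ.instBody a) (by simp), ?_⟩
  refine .dec (.exL₂ _ (.eq _ _) (not_isParEqDesc_parEq _ _)) ?_ ?_
  · rintro _ ⟨t, ht, rfl⟩
    simp only [args, Set.mem_insert_iff, Set.mem_singleton_iff] at ht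
    rcases ht with rfl | rfl <;> simp [hc]
  simp only [Set.mem_singleton_iff, forall_eq, Multiset.singleton_add]
  refine .descEq_trans (a := a) (c := c) (φ := φ) (by simp) (by simp) (by simp) ?_
  refine h.weaken_le (Multiset.cons_le_cons _ ?_)
  iterate 3 refine le_trans ?_ (Multiset.le_cons_self _ _)
  exact Multiset.le_cons_self _ _

/-! ### Inversion of the decomposition rules -/

/-- Apart from the axioms, the retaining rules act only on signed formulas without a decomposition.
So a decomposable formula is principal in them only at an axiom, where it has one of the listed
partners. -/
theorem Dec.cases_of_ret {X : SF Pr} {E Ls Q Ls'} (h : Dec k X E Ls) (h' : Ret e Q Ls')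
    (hX : X ∈ Q) : ∃ A, IsAtomic A ∧ (X = R₁ A ∧ L₁ A ∈ Q ∨ X = R₂ A ∧ L₁ A ∈ Q ∨
      X = L₂ A ∧ R₂ A ∈ Q ∨ X = R₂ A ∧ L₂ A ∈ Q ∨
      X = R₁ A ∧ L₂ A ∈ Q ∧ argsEx A ⊆ Q ∧ IsPredication A ∨
      X = L₂ A ∧ R₁ A ∈ Q ∧ argsEx A ⊆ Q ∧ IsPredication A) := by
  cases h' with
  | axLeftLeft A hA =>
    rcases hX with rfl | rfl
    · rcases hA with hA | ⟨t, rfl⟩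
      · cases hA <;> cases h
      · cases h
    · exact ⟨A, hA, by simp⟩
  | axRightRight A hA => rcases hX with rfl | rfl <;> exact ⟨A, hA, by simp⟩
  | axLeftRight A hA =>
    rcases hX with rfl | rfl
    · rcases hA with hA | ⟨t, rfl⟩
      · cases hA <;> cases h
      · cases h
    · exact ⟨A, hA, by simp⟩
  | axExists P hP =>
    rcases hX with (rfl | rfl) | ⟨t, _, rfl⟩
    · exact ⟨P, .inl hP, by simp [hP]⟩
    · exact ⟨P, .inl hP, by simp [hP]⟩
    · cases h
  | allL₁ => rcases hX with rfl | rfl <;> cases h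
  | allL₂ =>
    rcases hX with rfl | rfl <;> cases h
    rename_i hP _
    cases hP
  | exL₁ P hP hd => obtain rfl := hX; cases hP <;> cases h
  | exR₂ P hP hd => obtain rfl := hX; cases hP <;> cases h; exact absurd ⟨_, _, rfl⟩ hd
  | replSecond | replFirst => exact hX.elim
  | eqRefl | exDesc => obtain rfl := hX; cases h
  | descL₁one => rcases hX with rfl | rfl <;> cases h
  | descL₂one =>
    rcases hX with rfl | rfl
    · cases h; rename_i hd; exact absurd ⟨_, _, rfl⟩ hd
    · cases h
  | descL₁two => rcases hX with rfl | rfl | rfl <;> cases h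
  | descL₂two =>
    rcases hX with rfl | rfl | rfl
    · cases h; rename_i hd; exact absurd ⟨_, _, rfl⟩ hd
    · cases h
    · cases h

/-- At an axiom the partner of the inverted formula refutes each premise. For descriptions, the
truth of `c = ιx φ` makes `φ` true of `c`, against the first premise. By uniqueness it also makes
any existing `a` of which `φ` is not false equal to `c`, against the others. -/
theorem Dec.invert_l₁_r₁ {A : Form Pr} {E Ls} (h : Dec k (R₁ A) E Ls) (hA : IsAtomic A)
    {S : Multiset (SF Pr)} (hS : L₁ A ∈ S) (hE : ∀ Y ∈ E, Y ∈ S) : ∀ L ∈ Ls, D k e (S + L) := by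
  cases h with
  | exR₁ | exTr₂ =>
    rintro _ rfl
    exact .axiom_l₁r₂ hA (by simp [hS]) (by simp)
  | descR₁ φ c =>
    have hc : L₁ (exPar c) ∈ S := hE _ rfl
    rintro _ (rfl | ⟨a, rfl⟩)
    · exact .descL₁one (c := c) (φ := φ) (by simp [hS]) (by simp [hc])
        (.identity (φ.instBody c) (by simp))
    · exact .descL₁two (b := a) (c := c) (φ := φ) (by simp [hS]) (by simp) (by simp [hc])
        (.identity (φ.instBody a) (by simp)) (.identity (parEq a c) (by simp))
  | _ => rcases hA with h | ⟨_, h⟩ <;> cases h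

theorem Dec.invert_l₁_r₂ {A : Form Pr} {E Ls} (h : Dec k (R₂ A) E Ls) (hA : IsAtomic A)
    {S : Multiset (SF Pr)} (hS : L₁ A ∈ S) (hE : ∀ Y ∈ E, Y ∈ S) : ∀ L ∈ Ls, D k e (S + L) := by
  cases h with
  | descR₂ φ c =>
    have hc : L₁ (exPar c) ∈ S := hE _ rfl
    rintro _ (rfl | ⟨a, rfl⟩)
    · exact .descL₁one (c := c) (φ := φ) (by simp [hS]) (by simp [hc])
        (.identity (φ.instBody c) (by simp))
    · exact .descL₁two (b := a) (c := c) (φ := φ) (by simp [hS]) (by simp) (by simp [hc])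
        (.identity (φ.instBody a) (by simp)) (.identity (parEq a c) (by simp))
  | _ => rcases hA with h | ⟨_, h⟩ <;> cases h

theorem Dec.invert_l₂_r₂ {A : Form Pr} {E Ls} (h : Dec k (R₂ A) E Ls) (hA : IsAtomic A)
    {S : Multiset (SF Pr)} (hS : L₂ A ∈ S) (hE : ∀ Y ∈ E, Y ∈ S) : ∀ L ∈ Ls, D k e (S + L) := by
  cases h with
  | descR₂ φ c =>
    have hc : L₁ (exPar c) ∈ S := hE _ rfl
    rintro _ (rfl | ⟨a, rfl⟩)
    · exact .descL₂one (c := c) (φ := φ) (by simp [hS]) (by simp [hc])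
        (.identity (φ.instBody c) (by simp))
    -- The retaining rule needs distinct parameters. Otherwise the false identity is `a = a`,
    -- refuted by reflexivity.
    · by_cases hac : a = c
      · subst hac
        exact .reflexivity (t := .par a) (by simp) (.identity (parEq a a) (by simp))
      · refine .ret (.descL₂two φ a c hac) (by simp [hS, hc]) ?_
        simp only [Set.mem_insert_iff, Set.mem_singleton_iff, forall_eq_or_imp, forall_eq,
          Multiset.singleton_add]
        exact ⟨.identity (φ.instBody a) (by simp), .identity (parEq a c) (by simp)⟩
  | _ => rcases hA with h | ⟨_, h⟩ <;> cases h

/-- Every premise of a decomposition rule follows from its conclusion. -/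
theorem D.invert {X : SF Pr} {E Ls} (h : Dec k X E Ls) {S : Multiset (SF Pr)}
    (hE : ∀ Y ∈ E, Y ∈ S) (hS : D k e (X ::ₘ S)) : ∀ L ∈ Ls, D k e (L + S) := by
  intro L hL
  rw [add_comm]
  refine D.elim (M := E) (fun m hm _ E' Ls' h' => ?_) (.inr ?_) ?_ ?_ hS hE
  · cases h <;> first
      | exact hm.elim
      | (obtain ⟨_, _, rfl⟩ := hm; exact Dec.ne_ex h')
  · rintro t rfl; exact Dec.ne_ex h
  · intro T E' Ls' _ h' _ hL'
    obtain ⟨rfl, rfl⟩ := h.unique h'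
    rw [add_comm]; exact hL' L hL
  · intro T Q Ls' hET hR hXQ hQ _
    obtain ⟨A, hA, hc⟩ := h.cases_of_ret hR hXQ
    have hex : ∀ Y ∈ argsEx A, argsEx A ⊆ Q → X ≠ Y → Y ∈ T := fun Y hY hAQ hne =>
      hQ Y (hAQ hY) hne.symm
    rcases hc with ⟨rfl, hc⟩ | ⟨rfl, hc⟩ | ⟨rfl, hc⟩ | ⟨rfl, hc⟩ | ⟨rfl, hc, hAQ, hP⟩ |
      ⟨rfl, hc, hAQ, hP⟩
    · exact h.invert_l₁_r₁ hA (hQ _ hc (by simp)) hET L hL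
    · exact h.invert_l₁_r₂ hA (hQ _ hc (by simp)) hET L hL
    · have hc' := hQ _ hc (by simp)
      cases h with
      | exL₂ | exTr₁ => obtain rfl := hL; exact .axiom_l₁r₂ hA (by simp) (by simp [hc'])
      | _ => rcases hA with h | ⟨_, h⟩ <;> cases h
    · exact h.invert_l₂_r₂ hA (hQ _ hc (by simp)) hET L hL
    · have hc' := hQ _ hc (by simp)
      cases h with
      | exR₁ => obtain rfl := hL; exact .axiom_l₂r₂ hA (by simp [hc']) (by simp)
      | exTr₂ => cases hP
      | descR₁ φ c =>
        have h₁ : L₁ (.ex (.desc φ)) ∈ T := hex _ ⟨.desc φ, by simp [args], rfl⟩ hAQ (by simp)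
        have h₂ : L₁ (exPar c) ∈ T := hex _ ⟨.par c, by simp [args], rfl⟩ hAQ (by simp)
        -- The existence axiom offers only that `c = ιx φ` is not false. Since both terms exist,
        -- this can be raised to truth, which reduces to the case of the ordinary axiom.
        refine .descEq_l₁_of_l₂ (c := c) (φ := φ) (by simp [h₂]) (by simp [h₁])
          (by simp [hc']) ?_
        rw [← Multiset.cons_add]
        exact (Dec.descR₁ φ c).invert_l₁_r₁ hA (by simp)
          (fun Y hY => Multiset.mem_cons_of_mem (hET Y hY)) L hL
      | _ => cases hP
    · have hc' := hQ _ hc (by simp)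
      cases h with
      | exL₂ => obtain rfl := hL; exact .axiom_l₁r₁ hA (by simp) (by simp [hc'])
      | _ => cases hP

/-! ### Contraction -/

/-- The measure for contraction: the places `r₁` and `l₂` count more than `r₂` and `l₁`. -/
def SF.rank : SF Pr → ℕ
  | (.l₁, φ) | (.r₂, φ) => 2 * rk φ
  | (.r₁, φ) | (.l₂, φ) => 2 * rk φ + 1

/-- The extra unit for the places `r₁` and `l₂` is needed for the existence rules, which move a
formula to another place without simplifying it. -/
theorem Dec.rank_lt {X : SF Pr} {E Ls} (h : Dec k X E Ls) : ∀ L ∈ Ls, ∀ Y ∈ L, Y.rank < X.rank := by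
  cases h with
  | allR₁ φ | allR₂ φ =>
    rintro _ ⟨a, rfl⟩
    simp only [Multiset.insert_eq_cons, Multiset.mem_cons, Multiset.mem_singleton,
      forall_eq_or_imp, forall_eq, SF.rank, rk_inst]
    simp [Fm.rank]
    try omega
  | descR₂ φ c | descR₁ φ c =>
    rintro _ (rfl | ⟨a, rfl⟩)
    · have := rk_instBody_lt φ c c
      simp [SF.rank] ; omega
    · have := rk_instBody_lt φ a c
      have := rk_parEq_lt φ a c c
      have : rk (exPar (Pr := Pr) a) = 0 := rfl
      simp only [Multiset.insert_eq_cons, Multiset.mem_cons, Multiset.mem_singleton,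
        forall_eq_or_imp, forall_eq, SF.rank]
      omega
  | _ =>
    simp only [Set.mem_singleton_iff, Set.mem_insert_iff, Multiset.insert_eq_cons,
      Multiset.mem_cons, Multiset.mem_singleton, forall_eq_or_imp, forall_eq, SF.rank, rk, Fm.rank]
    omega

/-- When one copy of `X` is decomposed, inverting the rule on the other copy doubles the components,
which have smaller rank and are contracted by induction. When `X` is principal in a retaining rule,
the second copy can serve as the principal formula. -/
theorem D.contract {X : SF Pr} {S : Multiset (SF Pr)} (h : D k e (X ::ₘ S)) (hX : X ∈ S) :
    D k e S := by
  induction hn : X.rank using Nat.strong_induction_on generalizing X S with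
  | _ n ih =>
  subst hn
  have many : ∀ (L S : Multiset (SF Pr)), (∀ Y ∈ L, Y.rank < X.rank ∧ Y ∈ S) →
      D k e (L + S) → D k e S := by
    intro L
    induction L using Multiset.induction_on with
    | empty => intro S _ h; simpa using h
    | cons Y L ihL =>
      intro S hL h
      refine ihL S (fun Z hZ => hL Z (by simp [hZ])) ?_
      rw [Multiset.cons_add] at h
      exact ih _ (hL Y (by simp)).1 h (by simp [(hL Y (by simp)).2]) rfl
  rw [← add_zero S]
  refine D.elim (M := {X}) (by simp) (by simp) ?_ ?_ h (by simpa)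
  · intro T E Ls hT h hE hL
    obtain ⟨T, rfl⟩ := Multiset.exists_cons_of_mem (hT X rfl)
    have hE' : ∀ Y ∈ E, Y ∈ T := fun Y hY => by
      rcases Multiset.mem_cons.1 (hE Y hY) with rfl | h'
      · exfalso
        cases h <;> first
          | exact hY.elim
          | (obtain ⟨_, _, h⟩ := hY; cases h)
          | cases hY
      · exact h'
    rw [add_zero]
    refine .dec h hE' fun L hLs => ?_
    have h₁ := hL L hLs
    rw [Multiset.add_cons] at h₁
    have h₂ := D.invert h (fun Y hY => Multiset.mem_add.2 (.inr (hE' Y hY))) h₁ L hLs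
    exact many L _ (fun Y hY => ⟨h.rank_lt L hLs Y hY, by simp [hY]⟩) h₂
  · intro T Q Ls hT h hXQ hQ hL
    refine .ret h (fun Y hY => ?_) (fun L hLs => by rw [← add_assoc]; exact hL L hLs)
    rw [add_zero]
    by_cases hY' : Y = X
    · exact hT _ hY'
    · exact hQ Y hY hY'

/-- Derivability only depends on which formulas occur. -/
theorem D.mono {S S' : Multiset (SF Pr)} (h : D k e S) (hS : ∀ Y ∈ S, Y ∈ S') : D k e S' := by
  have key : ∀ S : Multiset (SF Pr), (∀ Y ∈ S, Y ∈ S') → D k e (S + S') → D k e S' := by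
    intro S
    induction S using Multiset.induction_on with
    | empty => intro _ h; simpa using h
    | cons Y S ih =>
      intro hS h
      rw [Multiset.cons_add] at h
      exact ih (fun Z hZ => hS Z (by simp [hZ])) (h.contract (by simp [hS Y (by simp)]))
  exact key S hS (h.weaken S')

/-- A decomposition rule with its principal formula kept in the premises. -/
theorem D.decompose {X : SF Pr} {E Ls} (h : Dec k X E Ls) {S : Multiset (SF Pr)} (hX : X ∈ S)
    (hE : ∀ Y ∈ E, Y ∈ S) (hL : ∀ L ∈ Ls, D k e (L + S)) : D k e S :=
  (D.dec h hE hL).contract hX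

theorem D.descL₂two {S : Multiset (SF Pr)} {φ : Fm Pr STm 1} {b c : ℕ}
    (hcφ : L₂ (descEq c φ) ∈ S) (hb : L₁ (exPar b) ∈ S) (hc : L₁ (exPar c) ∈ S)
    (h : D k e (R₁ (φ.instBody b) ::ₘ S)) (h' : D k e (L₂ (parEq b c) ::ₘ S)) : D k e S := by
  by_cases hbc : b = c
  · subst hbc
    refine .reflexivity hb (D.invert (.exL₂ (parEq b b) (.eq _ _) (not_isParEqDesc_parEq _ _))
      ?_ h' _ rfl)
    rintro _ ⟨t, ht, rfl⟩
    simp only [args, Set.mem_insert_iff, Set.mem_singleton_iff, or_self] at ht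
    exact ht ▸ hb
  · exact .ret (.descL₂two φ b c hbc) (by simp [hcφ, hb, hc]) (by simp [h, h'])

/-! ### Cut on existence formulas, predications and compound formulas -/

theorem Ret.cases_r₂ {φ : Form Pr} {Q Ls} (h : Ret e Q Ls) (hφ : R₂ φ ∈ Q) :
    IsAtomic φ ∧ (L₁ φ ∈ Q ∨ L₂ φ ∈ Q) ∨ IsPredication φ ∧ ∃ t ∈ args φ, Ls = {{L₁ (.ex t)}} := by
  cases h with
  | axRightRight A hA => obtain ⟨⟨⟩⟩ | ⟨⟨⟩⟩ := hφ; exact .inl ⟨hA, by simp⟩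
  | axLeftRight A hA => obtain ⟨⟨⟩⟩ | ⟨⟨⟩⟩ := hφ; exact .inl ⟨hA, by simp⟩
  | exR₂ P hP hd t ht => cases hφ; exact .inr ⟨hP, t, ht, rfl⟩
  | _ => simp [argsEx] at hφ

theorem Ret.cases_r₁ {φ : Form Pr} {Q Ls} (h : Ret e Q Ls) (hφ : R₁ φ ∈ Q) :
    IsAtomic φ ∧ L₁ φ ∈ Q ∨ IsPredication φ ∧ L₂ φ ∈ Q ∧ argsEx φ ⊆ Q := by
  cases h with
  | axLeftLeft A hA => obtain ⟨⟨⟩⟩ | ⟨⟨⟩⟩ := hφ; exact .inl ⟨hA, by simp⟩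
  | axExists P hP =>
    obtain (⟨⟨⟩⟩ | ⟨⟨⟩⟩) | ⟨_, _, ⟨⟩⟩ := hφ
    exact .inr ⟨hP, by simp⟩
  | _ => simp at hφ

theorem Ret.cases_l₂ {φ : Form Pr} {Q Ls} (h : Ret e Q Ls) (hφ : L₂ φ ∈ Q) :
    IsAtomic φ ∧ R₂ φ ∈ Q ∨ IsPredication φ ∧ R₁ φ ∈ Q ∧ argsEx φ ⊆ Q ∨
      (∃ ψ b, φ = .all ψ ∧ L₁ (exPar b) ∈ Q ∧ Ls = {{L₂ (ψ.inst b)}}) ∨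
      (∃ c ψ, φ = descEq c ψ ∧ L₁ (exPar c) ∈ Q ∧ Ls = {{L₂ (ψ.instBody c)}}) ∨
      ∃ b c ψ, φ = descEq c ψ ∧ L₁ (exPar b) ∈ Q ∧ L₁ (exPar c) ∈ Q ∧
        Ls = {{R₁ (ψ.instBody b)}, {L₂ (parEq b c)}} := by
  cases h with
  | axRightRight A hA => obtain ⟨⟨⟩⟩ | ⟨⟨⟩⟩ := hφ; exact .inl ⟨hA, by simp⟩
  | axExists P hP =>
    obtain (⟨⟨⟩⟩ | ⟨⟨⟩⟩) | ⟨_, _, ⟨⟩⟩ := hφ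
    exact .inr (.inl ⟨hP, by simp⟩)
  | allL₂ ψ b => obtain ⟨⟨⟩⟩ | ⟨⟨⟩⟩ := hφ; exact .inr (.inr (.inl ⟨ψ, b, by simp⟩))
  | descL₂one ψ c =>
    obtain ⟨⟨⟩⟩ | ⟨⟨⟩⟩ := hφ; exact .inr (.inr (.inr (.inl ⟨c, ψ, by simp⟩)))
  | descL₂two ψ b c =>
    obtain ⟨⟨⟩⟩ | ⟨⟨⟩⟩ | ⟨⟨⟩⟩ := hφ; exact .inr (.inr (.inr (.inr ⟨b, c, ψ, by simp⟩)))
  | _ => simp at hφ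

/-- The cut rules on `φ` with shared contexts to which all the others reduce. -/
structure Cut (k : Kleene) (e : Side) (φ : Form Pr) : Prop where
  outer {S : Multiset (SF Pr)} : D k e (R₁ φ ::ₘ S) → D k e (L₁ φ ::ₘ S) → D k e S
  inner {S : Multiset (SF Pr)} : D k e (R₂ φ ::ₘ S) → D k e (L₂ φ ::ₘ S) → D k e S

namespace Cut

variable {φ : Form Pr} {S : Multiset (SF Pr)}

/-- Split first into false and not false, then within "not false" into not true and true. -/
theorem three (h : Cut k e φ) (h₁ : D k e (L₁ φ ::ₘ S)) (h₂ : D k e (R₂ φ ::ₘ S))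
    (h₃ : D k e (R₁ φ ::ₘ L₂ φ ::ₘ S)) : D k e S :=
  h.inner h₂ (h.outer h₃ (h₁.mono (by simp +contextual)))

/-- Truth excludes falsity by `D.identity`, so a cut passes from true to not false. The next lemma
is the dual passage from false to not true. -/
theorem l₁_of_l₂ (h : Cut k e φ) (h₁ : D k e (L₂ φ ::ₘ S)) : D k e (L₁ φ ::ₘ S) :=
  h.inner (.identity φ (by simp)) (h₁.mono (by simp +contextual))

theorem r₂_of_r₁ (h : Cut k e φ) (h₁ : D k e (R₁ φ ::ₘ S)) : D k e (R₂ φ ::ₘ S) :=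
  h.outer (h₁.mono (by simp +contextual)) (.identity φ (by simp))

end Cut

/-- Existence formulas are two-valued. A false `Et` is principal only in axioms, and their partners
make `Et` true, directly or by the transfer rule. -/
theorem D.cut_ex {t : Tm Pr 0} {S : Multiset (SF Pr)} (h₁ : D k e (R₂ (.ex t) ::ₘ S))
    (h₂ : D k e (L₁ (.ex t) ::ₘ S)) : D k e S := by
  -- Tracing leaves the context `S` twice; `D.mono` merges the copies, here and in the other cut
  -- reductions.
  refine (D.elim (M := ∅) (S₂ := S) (by simp) (by simp) ?_ ?_ h₁ (by simp)).mono (by simp)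
  · rintro T E Ls _ h; cases h
  · intro T Q Ls _ h hQ hT hL
    rcases h.cases_r₂ hQ with ⟨_, h | h⟩ | ⟨h, _⟩
    · have := hT _ h (by simp)
      exact h₂.mono (by simp +contextual [this])
    · refine .decompose (.exTr₁ t) (by simp [hT _ h (by simp)]) (by simp) ?_
      simp only [Set.mem_singleton_iff, forall_eq, Multiset.singleton_add]
      exact h₂.mono (by simp +contextual)
    · cases h

theorem D.cut_pred {P : Form Pr} (hP : IsPredication P) (hd : ¬ IsParEqDesc P)
    {S : Multiset (SF Pr)} (hS : ∀ Y ∈ argsEx P, Y ∈ S) (h₁ : D k e (R₂ P ::ₘ S))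
    (h₂ : D k e (L₁ P ::ₘ S)) : D k e S := by
  refine (D.elim (M := ∅) (S₂ := S) (by simp) (by simp) ?_ ?_ h₁ (by simp)).mono (by simp)
  · rintro T E Ls _ h
    cases h <;> first
      | exact absurd ⟨_, _, rfl⟩ hd
      | cases hP
  · intro T Q Ls _ h hQ hT hL
    rcases h.cases_r₂ hQ with ⟨_, h | h⟩ | ⟨_, t, ht, rfl⟩
    · have := hT _ h (by simp)
      exact h₂.mono (by simp +contextual [this])
    · refine .decompose (.exL₂ P hP hd) (by simp [hT _ h (by simp)])
        (fun Y hY => by simp [hS Y hY]) ?_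
      simp only [Set.mem_singleton_iff, forall_eq, Multiset.singleton_add]
      exact h₂.mono (by simp +contextual)
    · have := hL _ rfl
      rw [add_assoc, Multiset.singleton_add] at this
      exact this.contract (by simp [hS _ ⟨t, ht, rfl⟩])

theorem Cut.ex (t : Tm Pr 0) : Cut k e (.ex t : Form Pr) := by
  refine ⟨fun {S} h₁ h₂ => ?_, fun {S} h₁ h₂ => ?_⟩
  · exact D.cut_ex (D.invert (.exTr₂ t) (by simp) h₁ _ rfl) h₂
  · exact D.cut_ex h₁ (D.invert (.exTr₁ t) (by simp) h₂ _ rfl)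

/-- The rules between true and not false, and between false and not true, require the arguments to
exist. This is known only where `P` is principal, so `P` is traced up to such a place rather than
inverted at the root. There existence makes `P` two-valued and `D.cut_pred` applies. -/
theorem Cut.pred {P : Form Pr} (hP : IsPredication P) (hd : ¬ IsParEqDesc P) : Cut k e P := by
  refine ⟨fun {S} h₁ h₂ => ?_, fun {S} h₁ h₂ => ?_⟩
  · refine (D.elim (M := ∅) (S₂ := S) (by simp) (.inr ?_) ?_ ?_ h₁ (by simp)).mono (by simp)
    · rintro t ⟨⟩
    · intro T E Ls _ h hE hL
      obtain ⟨rfl, rfl⟩ := h.unique (.exR₁ P hP hd)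
      refine D.cut_pred hP hd (fun Y hY => by simp [hE Y hY]) ((hL _ rfl).mono ?_)
        (h₂.mono ?_) <;> simp +contextual
    · intro T Q Ls _ hR hQ hT _
      rcases hR.cases_r₁ hQ with ⟨_, h⟩ | ⟨_, h, hE⟩
      · have := hT _ h (by simp)
        exact h₂.mono (by simp +contextual [this])
      · refine .decompose (.exL₂ P hP hd) (by simp [hT _ h (by simp)]) (fun Y hY => ?_) ?_
        · have : Y ≠ R₁ P := by rintro rfl; obtain ⟨_, _, ⟨⟩⟩ := hY
          simp [hT Y (hE hY) this]
        · simp only [Set.mem_singleton_iff, forall_eq, Multiset.singleton_add]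
          exact h₂.mono (by simp +contextual)
  · refine (D.elim (M := ∅) (S₂ := S) (by simp) (.inr ?_) ?_ ?_ h₂ (by simp)).mono (by simp)
    · rintro t ⟨⟩
    · intro T E Ls _ h hE hL
      obtain ⟨rfl, rfl⟩ := h.unique (.exL₂ P hP hd)
      refine D.cut_pred hP hd (fun Y hY => by simp [hE Y hY]) (h₁.mono ?_)
        ((hL _ rfl).mono ?_) <;> simp +contextual
    · intro T Q Ls _ hR hQ hT _
      rcases hR.cases_l₂ hQ with ⟨_, h⟩ | ⟨_, h, hE⟩ | ⟨_, _, rfl, _⟩ | ⟨_, _, rfl, _⟩ |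
        ⟨_, _, _, rfl, _⟩
      · have := hT _ h (by simp)
        exact h₁.mono (by simp +contextual [this])
      · refine .decompose (.exR₁ P hP hd) (by simp [hT _ h (by simp)]) (fun Y hY => ?_) ?_
        · have : Y ≠ L₂ P := by rintro rfl; obtain ⟨_, _, ⟨⟩⟩ := hY
          simp [hT Y (hE hY) this]
        · simp only [Set.mem_singleton_iff, forall_eq, Multiset.singleton_add]
          exact h₁.mono (by simp +contextual)
      · cases hP
      · exact absurd ⟨_, _, rfl⟩ hd
      · exact absurd ⟨_, _, rfl⟩ hd

theorem Cut.neg {φ : Form Pr} (h : Cut k e φ) : Cut k e φ.neg := by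
  refine ⟨fun {S} h₁ h₂ => ?_, fun {S} h₁ h₂ => ?_⟩
  · have h₁ := D.invert (.negR₁ φ) (by simp) h₁
    have h₂ := D.invert (.negL₁ φ) (by simp) h₂
    simp only [Set.mem_singleton_iff, forall_eq, Multiset.singleton_add] at h₁ h₂
    exact h.inner h₂ h₁
  · have h₁ := D.invert (.negR₂ φ) (by simp) h₁
    have h₂ := D.invert (.negL₂ φ) (by simp) h₂
    simp only [Set.mem_singleton_iff, forall_eq, Multiset.singleton_add] at h₁ h₂
    exact h.outer h₂ h₁

theorem Cut.and {φ ψ : Form Pr} (hφ : Cut k e φ) (hψ : Cut k e ψ) : Cut k e (φ.and ψ) := by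
  refine ⟨fun {S} h₁ h₂ => ?_, fun {S} h₁ h₂ => ?_⟩
  · have h₁ := D.invert (.andR₁ φ ψ) (by simp) h₁
    have h₂ := D.invert (.andL₁ φ ψ) (by simp) h₂
    simp only [Set.mem_insert_iff, Set.mem_singleton_iff, forall_eq_or_imp, forall_eq,
      Multiset.singleton_add, Multiset.insert_eq_cons, Multiset.cons_add] at h₁ h₂
    exact hψ.outer h₁.2 (hφ.outer (h₁.1.mono (by simp +contextual)) h₂)
  · rcases k with _ | _
    · have h₁ := D.invert (.andR₂ rfl φ ψ) (by simp) h₁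
      have h₂ := D.invert (.andL₂ rfl φ ψ) (by simp) h₂
      simp only [Set.mem_insert_iff, Set.mem_singleton_iff, forall_eq_or_imp, forall_eq,
        Multiset.singleton_add, Multiset.insert_eq_cons, Multiset.cons_add] at h₁ h₂
      exact hψ.inner h₁.2 (hφ.inner (h₁.1.mono (by simp +contextual)) h₂)
    · have h₁ := D.invert (.andR₂w rfl φ ψ) (by simp) h₁
      have h₂ := D.invert (.andL₂w rfl φ ψ) (by simp) h₂
      simp only [Set.mem_insert_iff, Set.mem_singleton_iff, forall_eq_or_imp, forall_eq,
        Multiset.singleton_add, Multiset.insert_eq_cons, Multiset.cons_add] at h₁ h₂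
      obtain ⟨h₁, h₁', h₁''⟩ := h₁
      obtain ⟨h₂, h₂', h₂''⟩ := h₂
      -- A split into the three values of `φ` removes `φ` from the premises and leaves `ψ` false;
      -- the next line is symmetric. Ordinary cuts with the premise where both are not false then
      -- suffice.
      have hψ₂ := hφ.three h₁' h₁ (h₂'.mono (by simp +contextual))
      have hφ₂ := hψ.three h₁'' (h₁.mono (by simp +contextual)) (h₂''.mono (by simp +contextual))
      exact hψ.inner hψ₂ (hφ.inner (hφ₂.mono (by simp +contextual)) h₂)

theorem Cut.imp {φ ψ : Form Pr} (hφ : Cut k e φ) (hψ : Cut k e ψ) : Cut k e (φ.imp ψ) := by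
  refine ⟨fun {S} h₁ h₂ => ?_, fun {S} h₁ h₂ => ?_⟩
  · rcases k with _ | _
    · have h₁ := D.invert (.impR₁ rfl φ ψ) (by simp) h₁
      have h₂ := D.invert (.impL₁ rfl φ ψ) (by simp) h₂
      simp only [Set.mem_insert_iff, Set.mem_singleton_iff, forall_eq_or_imp, forall_eq,
        Multiset.singleton_add, Multiset.insert_eq_cons, Multiset.cons_add] at h₁ h₂
      exact hφ.inner h₂.1 (hψ.outer h₁ (h₂.2.mono (by simp +contextual)))
    · have h₁ := D.invert (.impR₁w rfl φ ψ) (by simp) h₁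
      have h₂ := D.invert (.impL₁w rfl φ ψ) (by simp) h₂
      simp only [Set.mem_insert_iff, Set.mem_singleton_iff, forall_eq_or_imp, forall_eq,
        Multiset.singleton_add, Multiset.insert_eq_cons, Multiset.cons_add] at h₁ h₂
      obtain ⟨h₁, h₁', h₁''⟩ := h₁
      obtain ⟨h₂, h₂', h₂''⟩ := h₂
      -- Splitting on `φ` isolates the truth of `ψ`, and splitting on `ψ` isolates the falsity of
      -- `φ`. These are the premises of the strong Kleene reduction.
      have hψ₁ := hφ.three h₂ (h₂''.mono (by simp +contextual)) (h₁'.mono (by simp +contextual))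
      have hφ₂ := hψ.three h₂'' (h₂'.mono (by simp +contextual)) (h₁''.mono (by simp +contextual))
      exact hφ.inner hφ₂ (hψ.outer h₁ (hψ₁.mono (by simp +contextual)))
  · have h₁ := D.invert (.impR₂ φ ψ) (by simp) h₁
    have h₂ := D.invert (.impL₂ φ ψ) (by simp) h₂
    simp only [Set.mem_insert_iff, Set.mem_singleton_iff, forall_eq_or_imp, forall_eq,
      Multiset.singleton_add, Multiset.insert_eq_cons, Multiset.cons_add] at h₁ h₂
    exact hψ.inner (hφ.outer (h₂.1.mono (by simp +contextual)) h₁) h₂.2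

/-- The succedent side is inverted to all its instances at once. The antecedent side is traced to
each instantiation by some `b`, where `Eb` is in the context and the cut moves to that instance. -/
theorem Cut.all {φ : Fm Pr (Tm Pr) 1} (h : ∀ b, Cut k e (φ.inst b)) : Cut k e φ.all := by
  refine ⟨fun {S} h₁ h₂ => ?_, fun {S} h₁ h₂ => ?_⟩
  · have h₁ := D.invert (.allR₁ φ) (by simp) h₁
    refine (D.elim (M := ∅) (S₂ := S) (by simp) (by simp) ?_ ?_ h₂ (by simp)).mono (by simp)
    · rintro T E Ls _ h; cases h
    · intro T Q Ls _ hR hQ hT hL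
      cases hR with
      | allL₁ ψ b =>
        obtain ⟨⟨⟩⟩ | ⟨⟨⟩⟩ := hQ
        have hb := hT (L₁ (exPar b)) (by simp) (by simp)
        refine (h b).outer ((h₁ _ ⟨b, rfl⟩).mono ?_) ((hL _ rfl).mono (by simp))
        simp +contextual [hb]
      | axLeftLeft A hA | axLeftRight A hA =>
        obtain ⟨⟨⟩⟩ | ⟨⟨⟩⟩ := hQ; rcases hA with h | ⟨_, h⟩ <;> cases h
      | exL₁ P hP => cases hQ; cases hP
      | _ => simp [argsEx] at hQ
  · have h₁ := D.invert (.allR₂ φ) (by simp) h₁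
    refine (D.elim (M := ∅) (S₂ := S) (by simp) (by simp) ?_ ?_ h₂ (by simp)).mono (by simp)
    · rintro T E Ls _ h
      cases h
      rename_i hP _
      cases hP
    · intro T Q Ls _ hR hQ hT hL
      rcases hR.cases_l₂ hQ with ⟨hA, _⟩ | ⟨hA, _⟩ | ⟨ψ, b, ⟨⟩, hb, rfl⟩ | ⟨_, _, ⟨⟩, _⟩ |
        ⟨_, _, _, ⟨⟩, _⟩
      · rcases hA with h | ⟨_, h⟩ <;> cases h
      · cases hA
      · have hb := hT _ hb (by simp)
        refine (h b).inner ((h₁ _ ⟨b, rfl⟩).mono ?_) ((hL _ rfl).mono (by simp))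
        simp +contextual [hb]

/-! ### Cut on identities between a parameter and a description -/

section Description

variable {φ : Fm Pr STm 1} {c : ℕ} {S : Multiset (SF Pr)}

theorem D.invert_descEq_r₂ (hc : L₁ (exPar c) ∈ S) (h : D k e (R₂ (descEq c φ) ::ₘ S)) :
    D k e (R₂ (φ.instBody c) ::ₘ S) ∧
      ∀ a, D k e (L₁ (exPar a) ::ₘ L₁ (φ.instBody a) ::ₘ R₂ (parEq a c) ::ₘ S) := by
  have h := D.invert (.descR₂ φ c) (by simpa using hc) h
  exact ⟨by simpa using h _ (.inl rfl), fun a => by simpa using h _ (.inr ⟨a, rfl⟩)⟩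

theorem D.decompose_descEq_r₂ (hc : L₁ (exPar c) ∈ S) (hS : R₂ (descEq c φ) ∈ S)
    (h₁ : D k e (R₂ (φ.instBody c) ::ₘ S))
    (h₂ : ∀ a, D k e (L₁ (exPar a) ::ₘ L₁ (φ.instBody a) ::ₘ R₂ (parEq a c) ::ₘ S)) :
    D k e S := by
  refine .decompose (.descR₂ φ c) hS (by simpa using hc) ?_
  rintro _ (rfl | ⟨a, rfl⟩)
  · simpa using h₁
  · simpa using h₂ a

theorem D.decompose_descEq_r₁ (hc : L₁ (exPar c) ∈ S) (hS : R₁ (descEq c φ) ∈ S)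
    (h₁ : D k e (R₁ (φ.instBody c) ::ₘ S))
    (h₂ : ∀ a, D k e (L₁ (exPar a) ::ₘ R₁ (parEq a c) ::ₘ L₂ (φ.instBody a) ::ₘ S)) :
    D k e S := by
  refine .decompose (.descR₁ φ c) hS (by simpa using hc) ?_
  rintro _ (rfl | ⟨a, rfl⟩)
  · simpa using h₁
  · simpa using h₂ a

/-- If `c` and `d` exist and `c = d` is not true, then `c = d` is false. -/
theorem D.descEq_r₂_of_r₁ (hφ : ∀ b, Cut k e (φ.instBody b)) (hc : L₁ (exPar c) ∈ S)
    (hd : L₁ (.ex (.desc φ)) ∈ S) (hS : R₁ (descEq c φ) ∈ S)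
    (h : D k e (R₂ (descEq c φ) ::ₘ S)) : D k e S := by
  obtain ⟨h₁, h₂⟩ := D.invert_descEq_r₂ hc h
  refine .decompose_descEq_r₁ hc hS ?_ fun b => ?_
  -- Let `a` name the description, so that `φ` is true of `a`. Uniqueness for `c` leaves two cases:
  -- `φ` false of `c`, which `h₁` refutes, or `c = a`, and then `φ` is also true of `c`.
  · refine .describe (φ := φ) (by simp [hd]) fun a => ?_
    refine .ex_of_descEq (a := a) (φ := φ) (by simp) (by simp [hd]) ?_
    refine .descL₁one (c := a) (φ := φ) (by simp) (by simp) ?_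
    refine .descL₁two (b := c) (c := a) (φ := φ) (by simp) (by simp [hc]) (by simp) ?_ ?_
    · exact h₁.mono (by simp +contextual)
    · exact D.rel (RelFm.instBody a c φ) (by simp) (by simp)
  -- Now `φ` is not false of `b`, so uniqueness gives `b = a`. Hence `φ` is true of `b`, and `b =
  -- c`, being not true of existing objects, is false. This is the case that `h₂ b` refutes; the cut
  -- on the instance at `b` supplies the truth.
  · refine .describe (φ := φ) (by simp [hd]) fun a => ?_
    refine .ex_of_descEq (a := a) (φ := φ) (by simp) (by simp [hd]) ?_
    refine .descL₁one (c := a) (φ := φ) (by simp) (by simp) ?_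
    refine .descL₁two (b := b) (c := a) (φ := φ) (by simp) (by simp) (by simp) ?_ ?_
    · exact D.identity (φ.instBody b) (by simp)
    · refine .decompose (.exR₁ (parEq b c) (.eq _ _) (not_isParEqDesc_parEq _ _)) (by simp) ?_ ?_
      · rintro _ ⟨t, ht, rfl⟩
        simp only [args, Set.mem_insert_iff, Set.mem_singleton_iff] at ht
        rcases ht with rfl | rfl <;> simp [hc]
      simp only [Set.mem_singleton_iff, forall_eq, Multiset.singleton_add]
      refine (hφ b).outer (D.rel (RelFm.instBody a b φ) (by simp) (by simp)) ((h₂ b).mono ?_)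
      simp +contextual

/-- In the outer cut the denial is traced first, because its decomposition requires `c` to exist.
The affirmation is then traced to the description rules, each of which reduces to cuts on an
instance of `φ` or on an identity of parameters. In the inner cut only the second antecedent is
traced: its rules provide the existence of `c` needed to invert the other premise. Where an
existence axiom leaves the identity undefined, existence of both terms rules this out. -/
theorem Cut.desc (hφ : ∀ b, Cut k e (φ.instBody b)) (heq : ∀ b : ℕ, Cut k e (parEq (Pr := Pr) b c)) :
    Cut k e (descEq c φ) := by
  have mem_argsEx : L₁ (exPar c) ∈ argsEx (descEq c φ) ∧
      L₁ (.ex (.desc φ)) ∈ argsEx (descEq c φ) :=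
    ⟨⟨.par c, by simp [args], rfl⟩, ⟨.desc φ, by simp [args], rfl⟩⟩
  refine ⟨fun {S} h₁ h₂ => ?_, fun {S} h₁ h₂ => ?_⟩
  · refine (D.elim (M := ∅) (S₂ := S) (by simp) (by simp) ?_ ?_ h₁ (by simp)).mono (by simp)
    · intro T E Ls _ h hE hL
      obtain ⟨rfl, rfl⟩ := h.unique (.descR₁ φ c)
      have hc : L₁ (exPar c) ∈ T := hE _ rfl
      have g₁ : D k e (R₁ (φ.instBody c) ::ₘ T) := by simpa using hL _ (.inl rfl)
      have g₂ : ∀ a, D k e (L₁ (exPar a) ::ₘ R₁ (parEq a c) ::ₘ L₂ (φ.instBody a) ::ₘ T) :=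
        fun a => by simpa using hL _ (.inr ⟨a, rfl⟩)
      refine (D.elim (M := ∅) (S₂ := T) (by simp) (by simp) ?_ ?_ h₂ (by simp)).mono
        (by simp +contextual [or_comm])
      · rintro T' E' Ls' _ h; cases h
      · intro U Q Ls' _ hR hQ hU hL'
        cases hR with
        | axLeftLeft A hA =>
          obtain ⟨⟨⟩⟩ | ⟨⟨⟩⟩ := hQ
          refine .decompose_descEq_r₁ (c := c) (φ := φ) (by simp [hc])
            (by simp [hU (R₁ (descEq c φ)) (by simp) (by simp)])
            (g₁.mono (by simp +contextual)) fun a => (g₂ a).mono (by simp +contextual)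
        | axLeftRight A hA =>
          obtain ⟨⟨⟩⟩ | ⟨⟨⟩⟩ := hQ
          -- Here the identity is false, but the premises at hand belong to the rule for its not
          -- being true. Cuts of smaller rank convert them: from not true to false, and from not
          -- false to true.
          refine .decompose_descEq_r₂ (c := c) (φ := φ) (by simp [hc])
            (by simp [hU (R₂ (descEq c φ)) (by simp) (by simp)])
            (((hφ c).r₂_of_r₁ g₁).mono (by simp +contextual)) fun a => ?_
          have g := (heq a).r₂_of_r₁ ((g₂ a).mono (S' := R₁ (parEq a c) ::ₘ
            L₂ (φ.instBody a) ::ₘ L₁ (exPar a) ::ₘ T) (by simp +contextual))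
          have g := (hφ a).l₁_of_l₂ (g.mono (S' := L₂ (φ.instBody a) ::ₘ
            R₂ (parEq a c) ::ₘ L₁ (exPar a) ::ₘ T) (by simp +contextual))
          exact g.mono (by simp +contextual)
        | exL₁ P hP hd => cases hQ; exact absurd ⟨_, _, rfl⟩ hd
        | descL₁one φ c =>
          obtain ⟨⟨⟩⟩ | ⟨⟨⟩⟩ := hQ
          exact (hφ c).outer (g₁.mono (by simp +contextual)) ((hL' _ rfl).mono (by simp))
        | descL₁two φ b c hbc =>
          obtain ⟨⟨⟩⟩ | ⟨⟨⟩⟩ | ⟨⟨⟩⟩ := hQ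
          have hb := hU (L₁ (exPar b)) (by simp) (by simp)
          refine (heq b).outer ?_ ((hL' _ (.inr rfl)).mono (by simp))
          refine (hφ b).inner ((hL' _ (.inl rfl)).mono (by simp +contextual))
            ((g₂ b).mono ?_)
          simp +contextual [hb]
        | _ => simp [argsEx] at hQ
    · intro T Q Ls _ hR hQ hT _
      rcases hR.cases_r₁ hQ with ⟨_, h⟩ | ⟨_, h, hE⟩
      · have := hT _ h (by simp)
        exact h₂.mono (by simp +contextual [this])
      · refine .descEq_l₁_of_l₂ (c := c) (φ := φ) (by simp [hT _ (hE mem_argsEx.1) (by simp)])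
          (by simp [hT _ (hE mem_argsEx.2) (by simp)]) (by simp [hT _ h (by simp)])
          (h₂.mono (by simp +contextual))
  · refine (D.elim (M := ∅) (S₂ := S) (by simp) (by simp) ?_ ?_ h₂ (by simp)).mono (by simp)
    · intro T E Ls _ h
      cases h
      rename_i hd
      exact absurd ⟨_, _, rfl⟩ hd
    · intro T Q Ls _ hR hQ hT hL
      have h₁' : D k e (R₂ (descEq c φ) ::ₘ (T + S)) := h₁.mono (by simp +contextual)
      rcases hR.cases_l₂ hQ with ⟨_, h⟩ | ⟨_, h, hE⟩ | ⟨_, _, ⟨⟩, _⟩ | ⟨_, _, ⟨⟩, hc, rfl⟩ |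
        ⟨b, _, _, ⟨⟩, hb, hc, rfl⟩
      · exact h₁'.contract (by simp [hT _ h (by simp)])
      · exact .descEq_r₂_of_r₁ (c := c) hφ (by simp [hT _ (hE mem_argsEx.1) (by simp)])
          (by simp [hT _ (hE mem_argsEx.2) (by simp)]) (by simp [hT _ h (by simp)]) h₁'
      · have hc := hT _ hc (by simp)
        exact (hφ c).inner (D.invert_descEq_r₂ (by simp [hc]) h₁').1
          ((hL _ rfl).mono (by simp))
      · have hc := hT _ hc (by simp)
        have hb := hT _ hb (by simp)
        refine (heq b).inner ?_ ((hL _ (.inr rfl)).mono (by simp))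
        refine (hφ b).outer ((hL _ (.inl rfl)).mono (by simp +contextual)) ?_
        refine ((D.invert_descEq_r₂ (by simp [hc]) h₁').2 b).mono ?_
        simp +contextual [hb]

end Description

theorem cut (φ : Form Pr) : Cut k e φ := by
  induction hn : rk φ using Nat.strong_induction_on generalizing φ with
  | _ n ih =>
  subst hn
  cases φ with
  | ex t => exact .ex t
  | pred P ts => exact .pred (.pred P ts) (by rintro ⟨_, _, ⟨⟩⟩)
  | eq s t =>
    by_cases h : IsParEqDesc (.eq s t)
    · obtain ⟨c, φ, hcφ⟩ := h
      rw [hcφ] at ih ⊢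
      exact .desc (fun b => ih _ (rk_instBody_lt φ b c) _ rfl)
        fun b => ih _ (rk_parEq_lt φ b c c) _ rfl
    · exact .pred (.eq s t) h
  | neg φ => exact .neg (ih _ (by simp [rk, Fm.rank]) φ rfl)
  | and φ ψ =>
    exact .and (ih _ (by simp [rk, Fm.rank]) φ rfl) (ih _ (by simp [rk, Fm.rank]) ψ rfl)
  | imp φ ψ =>
    exact .imp (ih _ (by simp [rk, Fm.rank]) φ rfl) (ih _ (by simp [rk, Fm.rank]) ψ rfl)
  | all φ => exact .all fun b => ih _ (by rw [rk_inst]; simp [rk, Fm.rank]) (φ.inst b) rfl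

/-! ### Renaming of parameters and fresh parameters -/

/-- Apply an operation to all terms of a formula. -/
def Fm.map {T : ℕ → Type v} {T' : ℕ → Type w} (f : ∀ m, T m → T' m) :
    {m : ℕ} → Fm Pr T m → Fm Pr T' m
  | _, .ex t => .ex (f _ t)
  | _, .eq s t => .eq (f _ s) (f _ t)
  | _, .pred P ts => .pred P (fun i => f _ (ts i))
  | _, .neg φ => .neg (φ.map f)
  | _, .and φ ψ => .and (φ.map f) (ψ.map f)
  | _, .imp φ ψ => .imp (φ.map f) (ψ.map f)
  | _, .all φ => .all (φ.map f)

theorem Fm.map_mapTm {T : ℕ → Type v} {T' : ℕ → Type w} {f : ∀ m, T (m + 1) → T' m}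
    {g : ∀ m, T m → T m} {f' : ∀ m, T (m + 1) → T' m} {g' : ∀ m, T' m → T' m}
    (h : ∀ m t, g' m (f m t) = f' m (g (m + 1) t)) :
    ∀ {m : ℕ} (φ : Fm Pr T (m + 1)), (φ.mapTm f).map g' = (φ.map g).mapTm f'
  | _, .ex _ => by simp [Fm.mapTm, Fm.map, h]
  | _, .eq _ _ => by simp [Fm.mapTm, Fm.map, h]
  | _, .pred _ _ => by simp [Fm.mapTm, Fm.map, h]
  | _, .neg φ => by simp [Fm.mapTm, Fm.map, Fm.map_mapTm h φ]
  | _, .and φ ψ => by simp [Fm.mapTm, Fm.map, Fm.map_mapTm h φ, Fm.map_mapTm h ψ]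
  | _, .imp φ ψ => by simp [Fm.mapTm, Fm.map, Fm.map_mapTm h φ, Fm.map_mapTm h ψ]
  | _, .all φ => by simp [Fm.mapTm, Fm.map, Fm.map_mapTm h φ]

theorem Fm.any_map {T : ℕ → Type v} {T' : ℕ → Type w} (f : ∀ m, T m → T' m)
    (p : ∀ m, T' m → Prop) {m : ℕ} (φ : Fm Pr T m) :
    (φ.map f).Any p ↔ φ.Any (fun m t => p m (f m t)) := by
  induction φ <;> simp_all [Fm.map, Fm.Any]

theorem Fm.map_congr {T : ℕ → Type v} {T' : ℕ → Type w} {f g : ∀ m, T m → T' m}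
    {p : ∀ m, T m → Prop} (h : ∀ m t, ¬ p m t → f m t = g m t) {m : ℕ} {φ : Fm Pr T m}
    (hφ : ¬ φ.Any p) : φ.map f = φ.map g := by
  induction φ <;> simp_all [Fm.map, Fm.Any]

theorem Fm.map_id {T : ℕ → Type v} {f : ∀ m, T m → T m} (h : ∀ m t, f m t = t) {m : ℕ}
    (φ : Fm Pr T m) : φ.map f = φ := by
  induction φ <;> simp_all [Fm.map]

theorem Fm.eventually_not_any {T : ℕ → Type v} {p : ℕ → ∀ m, T m → Prop}
    (h : ∀ m t, ∀ᶠ a in Filter.atTop, ¬ p a m t) {m : ℕ} (φ : Fm Pr T m) :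
    ∀ᶠ a in Filter.atTop, ¬ φ.Any (p a) := by
  induction φ with
  | ex t => exact h _ t
  | eq s t => simpa [Fm.Any] using (h _ s).and (h _ t)
  | pred P ts =>
    simp only [Fm.Any, not_exists]
    exact Filter.eventually_all.2 fun i => h _ (ts i)
  | neg _ ih => exact ih
  | and _ _ ih ih' => simpa [Fm.Any] using ih.and ih'
  | imp _ _ ih ih' => simpa [Fm.Any] using ih.and ih'
  | all _ ih => exact ih

theorem STm.eventually_not_hasPar (m : ℕ) (t : STm m) :
    ∀ᶠ a in Filter.atTop, ¬ STm.HasPar a m t := by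
  cases t with
  | par b =>
    filter_upwards [Filter.eventually_gt_atTop b] with a ha
    exact ha.ne
  | var i => exact .of_forall fun _ h => h

theorem Tm.eventually_not_hasPar (m : ℕ) (t : Tm Pr m) :
    ∀ᶠ a in Filter.atTop, ¬ Tm.HasPar a m t := by
  cases t with
  | smp t => exact STm.eventually_not_hasPar m t
  | desc φ => exact Fm.eventually_not_any STm.eventually_not_hasPar φ

theorem exists_fresh (Γ : Multiset (Form Pr)) : ∃ a, Fresh a Γ := by
  have : ∀ᶠ a in Filter.atTop, Fresh a Γ := by
    induction Γ using Multiset.induction_on with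
    | empty => simp [Fresh]
    | cons φ Γ ih =>
      filter_upwards [ih, Fm.eventually_not_any Tm.eventually_not_hasPar φ] with a h₁ h₂
      simpa [Fresh] using ⟨h₂, h₁⟩
  exact this.exists

/-- Rename the parameters of a simple term. -/
def STm.ren (σ : ℕ → ℕ) (m : ℕ) : STm m → STm m
  | .par a => .par (σ a)
  | .var i => .var i

/-- Rename the parameters of a term. -/
def Tm.ren (σ : ℕ → ℕ) (m : ℕ) : Tm Pr m → Tm Pr m
  | .smp t => .smp (t.ren σ)
  | .desc φ => .desc (φ.map (STm.ren σ))

/-- Rename the parameters of a formula. -/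
abbrev Fm.ren (σ : ℕ → ℕ) {m : ℕ} (φ : Fm Pr (Tm Pr) m) : Fm Pr (Tm Pr) m := φ.map (Tm.ren σ)

theorem STm.ren_inst (σ : ℕ → ℕ) (b m : ℕ) (t : STm (m + 1)) :
    (t.inst b m).ren σ = (t.ren σ).inst (σ b) m := by
  cases t with
  | par => rfl
  | var i => by_cases h : i.val < m <;> simp [STm.inst, STm.ren, h]

theorem Fm.map_ren_inst (σ : ℕ → ℕ) (b : ℕ) {m : ℕ} (φ : Fm Pr STm (m + 1)) :
    (φ.mapTm (STm.inst b)).map (STm.ren σ) = (φ.map (STm.ren σ)).mapTm (STm.inst (σ b)) :=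
  Fm.map_mapTm (fun m t => STm.ren_inst σ b m t) φ

theorem Fm.ren_inst (σ : ℕ → ℕ) (φ : Fm Pr (Tm Pr) 1) (b : ℕ) :
    (φ.inst b).ren σ = (φ.ren σ).inst (σ b) := by
  refine Fm.map_mapTm (fun m t => ?_) φ
  cases t with
  | smp t => exact congrArg Tm.smp (STm.ren_inst σ b m t)
  | desc φ => exact congrArg Tm.desc (Fm.map_ren_inst σ b φ)

theorem Fm.map_smp_mapTm (σ : ℕ → ℕ) (b : ℕ) : ∀ {m : ℕ} (φ : Fm Pr STm (m + 1)),
    (φ.mapTm (fun m t => (Tm.smp (t.inst b m) : Tm Pr m))).map (Tm.ren σ) =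
      (φ.map (STm.ren σ)).mapTm (fun m t => Tm.smp (t.inst (σ b) m))
  | _, .ex _ => by simp [Fm.mapTm, Fm.map, Tm.ren, STm.ren_inst]
  | _, .eq _ _ => by simp [Fm.mapTm, Fm.map, Tm.ren, STm.ren_inst]
  | _, .pred _ _ => by simp [Fm.mapTm, Fm.map, Tm.ren, STm.ren_inst]
  | _, .neg φ => by simp [Fm.mapTm, Fm.map, Fm.map_smp_mapTm σ b φ]
  | _, .and φ ψ => by simp [Fm.mapTm, Fm.map, Fm.map_smp_mapTm σ b φ, Fm.map_smp_mapTm σ b ψ]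
  | _, .imp φ ψ => by simp [Fm.mapTm, Fm.map, Fm.map_smp_mapTm σ b φ, Fm.map_smp_mapTm σ b ψ]
  | _, .all φ => by simp [Fm.mapTm, Fm.map, Fm.map_smp_mapTm σ b φ]

theorem Fm.ren_instBody (σ : ℕ → ℕ) (φ : Fm Pr STm 1) (b : ℕ) :
    (φ.instBody b).ren σ = (φ.map (STm.ren σ)).instBody (σ b) := Fm.map_smp_mapTm σ b φ

theorem STm.ren_update {σ : ℕ → ℕ} {a b m : ℕ} {t : STm m} (h : ¬ t.HasPar a) :
    t.ren (Function.update σ a b) = t.ren σ := by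
  cases t with
  | par c => exact congrArg STm.par (Function.update_of_ne h _ _)
  | var => rfl

theorem Tm.ren_update {σ : ℕ → ℕ} {a b m : ℕ} {t : Tm Pr m} (h : ¬ t.HasPar a) :
    t.ren (Function.update σ a b) = t.ren σ := by
  cases t with
  | smp t => exact congrArg Tm.smp (STm.ren_update h)
  | desc φ => exact congrArg Tm.desc (Fm.map_congr (p := STm.HasPar a) (fun _ _ => STm.ren_update) h)

theorem Fm.ren_update {σ : ℕ → ℕ} {a b m : ℕ} {φ : Fm Pr (Tm Pr) m}
    (h : ¬ φ.Any (Tm.HasPar a)) : φ.ren (Function.update σ a b) = φ.ren σ :=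
  Fm.map_congr (p := Tm.HasPar a) (fun _ _ => Tm.ren_update) h

theorem Fm.ren_id {m : ℕ} (φ : Fm Pr (Tm Pr) m) : φ.ren id = φ := by
  have hs : ∀ m (t : STm m), t.ren id = t := fun m t => by cases t <;> rfl
  refine Fm.map_id (fun m t => ?_) φ
  cases t with
  | smp t => exact congrArg Tm.smp (hs m t)
  | desc φ => exact congrArg Tm.desc (Fm.map_id hs φ)

theorem IsPredication.ren {P : Form Pr} (h : IsPredication P) (σ : ℕ → ℕ) :
    IsPredication (P.ren σ) := by
  cases h <;> constructor

theorem IsAtomic.ren {A : Form Pr} (h : IsAtomic A) (σ : ℕ → ℕ) : IsAtomic (A.ren σ) := by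
  rcases h with h | ⟨t, rfl⟩
  · exact .inl (h.ren σ)
  · exact isAtomic_ex _

/-- Renaming preserves the kind of each term, even when it is not injective. So the restriction on
the existence rules survives it. -/
theorem isParEqDesc_of_ren {P : Form Pr} {σ : ℕ → ℕ} (h : IsParEqDesc (P.ren σ)) :
    IsParEqDesc P := by
  obtain ⟨b, δ, h⟩ := h
  cases P with
  | eq s t =>
    simp only [Fm.ren, Fm.map, Fm.eq.injEq] at h
    rcases s with (_ | i) | _ <;> rcases t with _ | _ <;> simp [Tm.ren, STm.ren] at h
    exact ⟨_, _, rfl⟩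
  | _ => cases h

theorem args_ren (P : Form Pr) (σ : ℕ → ℕ) : args (P.ren σ) = Tm.ren σ 0 '' args P := by
  cases P <;> simp [Fm.map, args, Set.image_pair]
  ext; simp

theorem SubstTm.ren {t : Tm Pr 0} {v : Tm Pr 1} {v' : Tm Pr 0} (h : SubstTm t v v') (σ : ℕ → ℕ) :
    SubstTm (t.ren σ) (v.ren σ) (v'.ren σ) := by
  cases h with
  | var => exact .var
  | par a => exact .par _
  | descPar φ b ht =>
    subst ht
    simp only [Tm.ren, Fm.map_ren_inst]
    exact .descPar _ _ rfl
  | descClosed φ hφ b =>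
    simp only [Tm.ren, Fm.map_ren_inst]
    refine .descClosed _ ?_ _
    rw [Fm.any_map]
    convert hφ using 4 with m t
    cases t <;> rfl

theorem SubstAtom.ren {t : Tm Pr 0} {A A'} (h : SubstAtom t A A') (σ : ℕ → ℕ) :
    SubstAtom (t.ren σ) (A.ren σ) (A'.ren σ) := by
  cases h with
  | ex h => exact .ex (h.ren σ)
  | eq h h' => exact .eq (h.ren σ) (h'.ren σ)
  | pred P h => exact .pred P fun i => (h i).ren σ

/-- Rename the parameters of a signed formula. -/
def SF.ren (σ : ℕ → ℕ) (X : SF Pr) : SF Pr := (X.1, X.2.ren σ)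

/-! ### Translation of derivations into `D` -/

/-- The signed formulas of the bisequent `Γ ⇒ Δ ∣ Λ ⇒ Θ`. -/
def signed (Γ Δ Λ Θ : Multiset (Form Pr)) : Multiset (SF Pr) :=
  Γ.map L₁ + Δ.map R₁ + Λ.map L₂ + Θ.map R₂

section

variable (φ : Form Pr) (Γ Δ Λ Θ : Multiset (Form Pr))

theorem signed_cons_l₁ : signed (φ ::ₘ Γ) Δ Λ Θ = L₁ φ ::ₘ signed Γ Δ Λ Θ := by simp [signed]

theorem signed_cons_r₁ : signed Γ (φ ::ₘ Δ) Λ Θ = R₁ φ ::ₘ signed Γ Δ Λ Θ := by simp [signed]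

theorem signed_cons_l₂ : signed Γ Δ (φ ::ₘ Λ) Θ = L₂ φ ::ₘ signed Γ Δ Λ Θ := by simp [signed]

theorem signed_cons_r₂ : signed Γ Δ Λ (φ ::ₘ Θ) = R₂ φ ::ₘ signed Γ Δ Λ Θ := by simp [signed]

theorem signed_add_l₁ (Γ' : Multiset (Form Pr)) :
    signed (Γ' + Γ) Δ Λ Θ = Γ'.map L₁ + signed Γ Δ Λ Θ := by simp [signed, add_assoc]

end

/-- The image of a bisequent under a renaming of parameters. -/
def renamed (σ : ℕ → ℕ) (Γ Δ Λ Θ : Multiset (Form Pr)) : Multiset (SF Pr) :=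
  (signed Γ Δ Λ Θ).map (SF.ren σ)

section

variable (σ : ℕ → ℕ) (φ : Form Pr) (Γ Δ Λ Θ : Multiset (Form Pr))

@[simp] theorem renamed_cons_l₁ : renamed σ (φ ::ₘ Γ) Δ Λ Θ = L₁ (φ.ren σ) ::ₘ renamed σ Γ Δ Λ Θ := by
  simp [renamed, signed_cons_l₁, SF.ren]

@[simp] theorem renamed_cons_r₁ : renamed σ Γ (φ ::ₘ Δ) Λ Θ = R₁ (φ.ren σ) ::ₘ renamed σ Γ Δ Λ Θ := by
  simp [renamed, signed_cons_r₁, SF.ren]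

@[simp] theorem renamed_cons_l₂ : renamed σ Γ Δ (φ ::ₘ Λ) Θ = L₂ (φ.ren σ) ::ₘ renamed σ Γ Δ Λ Θ := by
  simp [renamed, signed_cons_l₂, SF.ren]

@[simp] theorem renamed_cons_r₂ : renamed σ Γ Δ Λ (φ ::ₘ Θ) = R₂ (φ.ren σ) ::ₘ renamed σ Γ Δ Λ Θ := by
  simp [renamed, signed_cons_r₂, SF.ren]

theorem renamed_update {a b : ℕ} (h : Fresh a (Γ + Δ + Λ + Θ)) :
    renamed (Function.update σ a b) Γ Δ Λ Θ = renamed σ Γ Δ Λ Θ := by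
  refine Multiset.map_congr rfl fun X hX => ?_
  have : X.2 ∈ Γ + Δ + Λ + Θ := by
    simp only [signed, Multiset.mem_add, Multiset.mem_map] at hX ⊢
    rcases hX with ((⟨_, h, rfl⟩ | ⟨_, h, rfl⟩) | ⟨_, h, rfl⟩) | ⟨_, h, rfl⟩ <;> simp [h]
  exact congrArg (Prod.mk X.1) (Fm.ren_update (h _ this))

theorem mem_renamed_exs {P : Form Pr} {ts : Multiset (Tm Pr 0)} (hts : ListsArgs ts P) :
    ∀ Y ∈ argsEx (P.ren σ), Y ∈ renamed σ (exs ts + Γ) Δ Λ Θ := by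
  rintro _ ⟨t, ht, rfl⟩
  rw [args_ren] at ht
  obtain ⟨t, ht, rfl⟩ := ht
  refine Multiset.mem_map.2 ⟨L₁ (.ex t), ?_, rfl⟩
  simp [signed, exs, (hts t).2 ht]

end

/-- Quantifying over all renamings `σ` builds the substitution of parameters into the induction.
This is what produces the premises of an eigenparameter rule for every parameter from the single
given one. -/
theorem Der.toD {Γ Δ Λ Θ : Multiset (Form Pr)} (h : Der k e Γ Δ Λ Θ) (σ : ℕ → ℕ) :
    D k e (renamed σ Γ Δ Λ Θ) := by
  induction h generalizing σ with
  | axLeftLeft A hA => exact .ret (.axLeftLeft _ (hA.ren σ)) (by simp) (by simp)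
  | axRightRight A hA => exact .ret (.axRightRight _ (hA.ren σ)) (by simp) (by simp)
  | axLeftRight A hA => exact .ret (.axLeftRight _ (hA.ren σ)) (by simp) (by simp)
  | axExists P hP ts hts =>
    refine .ret (.axExists (P.ren σ) (hP.ren σ)) ?_ (by simp)
    rintro _ ((rfl | rfl) | hY)
    · simp
    · simp
    · exact mem_renamed_exs _ _ _ _ _ hts _ hY
  | negL₁ φ _ ih =>
    have ih := ih σ
    simp only [renamed_cons_l₁, renamed_cons_r₂, Fm.map] at ih ⊢
    exact .dec (.negL₁ _) (by simp) (by simpa)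
  | negR₁ φ _ ih =>
    have ih := ih σ
    simp only [renamed_cons_r₁, renamed_cons_l₂, Fm.map] at ih ⊢
    exact .dec (.negR₁ _) (by simp) (by simpa)
  | negL₂ φ _ ih =>
    have ih := ih σ
    simp only [renamed_cons_r₁, renamed_cons_l₂, Fm.map] at ih ⊢
    exact .dec (.negL₂ _) (by simp) (by simpa)
  | negR₂ φ _ ih =>
    have ih := ih σ
    simp only [renamed_cons_l₁, renamed_cons_r₂, Fm.map] at ih ⊢
    exact .dec (.negR₂ _) (by simp) (by simpa)
  | andL₁ φ ψ _ ih =>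
    have ih := ih σ
    simp only [renamed_cons_l₁, Fm.map] at ih ⊢
    exact .dec (.andL₁ _ _) (by simp) (by simpa)
  | andR₁ φ ψ _ _ ih ih' =>
    have ih := ih σ
    have ih' := ih' σ
    simp only [renamed_cons_r₁, Fm.map] at ih ih' ⊢
    exact .dec (.andR₁ _ _) (by simp) (by simp [ih, ih'])
  | impL₂ φ ψ _ _ ih ih' =>
    have ih := ih σ
    have ih' := ih' σ
    simp only [renamed_cons_r₁, renamed_cons_l₂, Fm.map] at ih ih' ⊢
    exact .dec (.impL₂ _ _) (by simp) (by simp [ih, ih'])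
  | impR₂ φ ψ _ ih =>
    have ih := ih σ
    simp only [renamed_cons_l₁, renamed_cons_r₂, Fm.map] at ih ⊢
    exact .dec (.impR₂ _ _) (by simp) (by simpa using ih.mono (by simp +contextual))
  | andL₂ hk φ ψ _ ih =>
    have ih := ih σ
    simp only [renamed_cons_l₂, Fm.map] at ih ⊢
    exact .dec (.andL₂ hk _ _) (by simp) (by simpa)
  | andR₂ hk φ ψ _ _ ih ih' =>
    have ih := ih σ
    have ih' := ih' σ
    simp only [renamed_cons_r₂, Fm.map] at ih ih' ⊢
    exact .dec (.andR₂ hk _ _) (by simp) (by simp [ih, ih'])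
  | impL₁ hk φ ψ _ _ ih ih' =>
    have ih := ih σ
    have ih' := ih' σ
    simp only [renamed_cons_l₁, renamed_cons_r₂, Fm.map] at ih ih' ⊢
    exact .dec (.impL₁ hk _ _) (by simp) (by simp [ih, ih'])
  | impR₁ hk φ ψ _ ih =>
    have ih := ih σ
    simp only [renamed_cons_r₁, renamed_cons_l₂, Fm.map] at ih ⊢
    refine .dec (.impR₁ hk _ _) (by simp) ?_
    simpa using ih.mono (by simp +contextual)
  | andL₂w hk φ ψ _ _ _ ih ih' ih'' =>
    have ih := ih σ
    have ih' := ih' σ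
    have ih'' := ih'' σ
    simp only [renamed_cons_r₁, renamed_cons_l₂, Fm.map] at ih ih' ih'' ⊢
    refine .dec (.andL₂w hk _ _) (by simp) ?_
    simp only [Set.mem_insert_iff, Set.mem_singleton_iff, forall_eq_or_imp, forall_eq,
      Multiset.singleton_add, Multiset.insert_eq_cons, Multiset.cons_add]
    exact ⟨ih, ih'.mono (by simp +contextual), ih''.mono (by simp +contextual)⟩
  | andR₂w hk φ ψ _ _ _ ih ih' ih'' =>
    have ih := ih σ
    have ih' := ih' σ
    have ih'' := ih'' σ
    simp only [renamed_cons_l₁, renamed_cons_r₂, Fm.map] at ih ih' ih'' ⊢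
    refine .dec (.andR₂w hk _ _) (by simp) ?_
    simp only [Set.mem_insert_iff, Set.mem_singleton_iff, forall_eq_or_imp, forall_eq,
      Multiset.singleton_add, Multiset.insert_eq_cons, Multiset.cons_add]
    exact ⟨ih, ih'.mono (by simp +contextual), ih''.mono (by simp +contextual)⟩
  | impR₁w hk φ ψ _ _ _ ih ih' ih'' =>
    have ih := ih σ
    have ih' := ih' σ
    have ih'' := ih'' σ
    simp only [renamed_cons_r₁, renamed_cons_l₂, Fm.map] at ih ih' ih'' ⊢
    refine .dec (.impR₁w hk _ _) (by simp) ?_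
    simp only [Set.mem_insert_iff, Set.mem_singleton_iff, forall_eq_or_imp, forall_eq,
      Multiset.singleton_add, Multiset.insert_eq_cons, Multiset.cons_add]
    exact ⟨ih.mono (by simp +contextual), ih'.mono (by simp +contextual),
      ih''.mono (by simp +contextual)⟩
  | impL₁w hk φ ψ _ _ _ ih ih' ih'' =>
    have ih := ih σ
    have ih' := ih' σ
    have ih'' := ih'' σ
    simp only [renamed_cons_l₁, renamed_cons_r₂, Fm.map] at ih ih' ih'' ⊢
    refine .dec (.impL₁w hk _ _) (by simp) ?_
    simp only [Set.mem_insert_iff, Set.mem_singleton_iff, forall_eq_or_imp, forall_eq,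
      Multiset.singleton_add, Multiset.insert_eq_cons, Multiset.cons_add]
    exact ⟨ih, ih'.mono (by simp +contextual), ih''.mono (by simp +contextual)⟩
  | allR₁ φ a ha _ ih =>
    simp only [renamed_cons_r₁, Fm.map]
    refine .dec (.allR₁ _) (by simp) ?_
    rintro _ ⟨b, rfl⟩
    -- Sending the eigenparameter `a` to `b` yields the premise for `b`. By freshness of `a` the
    -- rest of the bisequent is renamed as by `σ`.
    have ih := ih (Function.update σ a b)
    have hφ : φ.ren (Function.update σ a b) = φ.ren σ := Fm.ren_update (ha φ.all (by simp))
    rw [renamed_cons_l₁, renamed_cons_r₁,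
      renamed_update _ _ _ _ _ fun ψ hψ => ha ψ (by simp at hψ ⊢; tauto), Fm.ren_inst, hφ] at ih
    simpa [Fm.map, Tm.ren, STm.ren] using ih
  | allR₂ φ a ha _ ih =>
    simp only [renamed_cons_r₂, Fm.map]
    refine .dec (.allR₂ _) (by simp) ?_
    rintro _ ⟨b, rfl⟩
    have ih := ih (Function.update σ a b)
    have hφ : φ.ren (Function.update σ a b) = φ.ren σ := Fm.ren_update (ha φ.all (by simp))
    rw [renamed_cons_l₁, renamed_cons_r₂,
      renamed_update _ _ _ _ _ fun ψ hψ => ha ψ (by simp at hψ ⊢; tauto), Fm.ren_inst, hφ] at ih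
    simpa [Fm.map, Tm.ren, STm.ren] using ih
  | allL₁ φ b _ ih =>
    have ih := ih σ
    simp only [renamed_cons_l₁, Fm.ren_inst, Fm.map, Tm.ren, STm.ren] at ih ⊢
    refine .ret (.allL₁ (φ.ren σ) (σ b)) (by simp) ?_
    simp only [Set.mem_singleton_iff, forall_eq, Multiset.singleton_add]
    exact ih.mono (by simp +contextual)
  | allL₂ φ b _ ih =>
    have ih := ih σ
    simp only [renamed_cons_l₁, renamed_cons_l₂, Fm.ren_inst, Fm.map, Tm.ren, STm.ren] at ih ⊢
    refine .ret (.allL₂ (φ.ren σ) (σ b)) (by simp) ?_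
    simp only [Set.mem_singleton_iff, forall_eq, Multiset.singleton_add]
    exact ih.mono (by simp +contextual)
  | exL₁ P hP hd t ht _ ih =>
    have ih := ih σ
    simp only [renamed_cons_l₁] at ih ⊢
    exact .exL₁ (hP.ren σ) (fun h => hd (isParEqDesc_of_ren h))
      (args_ren P σ ▸ Set.mem_image_of_mem _ ht) (by simp) ih
  | exR₂ P hP hd t ht _ ih =>
    have ih := ih σ
    simp only [renamed_cons_l₁, renamed_cons_r₂] at ih ⊢
    exact .exR₂ (hP.ren σ) (fun h => hd (isParEqDesc_of_ren h))
      (args_ren P σ ▸ Set.mem_image_of_mem _ ht) (by simp) (ih.mono (by simp +contextual [Fm.map]))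
  | exL₂ P hP hd ts hts _ ih =>
    have ih := ih σ
    rw [Multiset.add_cons, renamed_cons_l₁] at ih
    rw [renamed_cons_l₂]
    exact .dec (.exL₂ _ (hP.ren σ) fun h => hd (isParEqDesc_of_ren h))
      (mem_renamed_exs _ _ _ _ _ hts) (by simpa)
  | exR₁ P hP hd ts hts _ ih =>
    have ih := ih σ
    rw [renamed_cons_r₂] at ih
    rw [renamed_cons_r₁]
    exact .dec (.exR₁ _ (hP.ren σ) fun h => hd (isParEqDesc_of_ren h))
      (mem_renamed_exs _ _ _ _ _ hts) (by simpa)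
  | exTr₁ t _ ih =>
    have ih := ih σ
    simp only [renamed_cons_l₁, renamed_cons_l₂, Fm.map] at ih ⊢
    exact .dec (.exTr₁ _) (by simp) (by simpa)
  | exTr₂ t _ ih =>
    have ih := ih σ
    simp only [renamed_cons_r₁, renamed_cons_r₂, Fm.map] at ih ⊢
    exact .dec (.exTr₂ _) (by simp) (by simpa)
  | replSecond he t s I hI A At As ht hs _ _ _ ih ih' ih'' =>
    have ih := ih σ
    have ih' := ih' σ
    have ih'' := ih'' σ
    simp only [renamed_cons_l₁, renamed_cons_r₂] at ih ih' ih''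
    refine .ret (.replSecond he (t.ren σ) (s.ren σ) (I.ren σ) ?_ _ _ _ (ht.ren σ) (hs.ren σ))
      (by simp) (by simp [ih, ih', ih''])
    rcases hI with rfl | rfl <;> simp [Fm.map]
  | replFirst he t s I hI A At As ht hs _ _ _ ih ih' ih'' =>
    have ih := ih σ
    have ih' := ih' σ
    have ih'' := ih'' σ
    simp only [renamed_cons_l₁, renamed_cons_r₁] at ih ih' ih''
    refine .ret (.replFirst he (t.ren σ) (s.ren σ) (I.ren σ) ?_ _ _ _ (ht.ren σ) (hs.ren σ))
      (by simp) (by simp [ih, ih', ih''])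
    rcases hI with rfl | rfl <;> simp [Fm.map]
  | eqRefl t _ ih =>
    have ih := ih σ
    simp only [renamed_cons_l₁, Fm.map] at ih ⊢
    exact .reflexivity (by simp) ih
  | exDesc φ a ha _ ih =>
    simp only [renamed_cons_l₁, Fm.map, Tm.ren]
    refine .describe (φ := φ.map (STm.ren σ)) (by simp) fun b => ?_
    have ih := ih (Function.update σ a b)
    have hφ : φ.map (STm.ren (Function.update σ a b)) = φ.map (STm.ren σ) :=
      Fm.map_congr (p := STm.HasPar a) (fun _ _ => STm.ren_update)
        (ha (.ex (.desc φ)) (by simp))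
    rw [renamed_cons_l₁, renamed_cons_l₁,
      renamed_update _ _ _ _ _ fun ψ hψ => ha ψ (by simp at hψ ⊢; tauto)] at ih
    simpa [Fm.map, Tm.ren, STm.ren, hφ] using ih
  | descL₁one φ c _ ih =>
    have ih := ih σ
    simp only [renamed_cons_l₁, Fm.ren_instBody, Fm.map, Tm.ren, STm.ren] at ih ⊢
    exact .descL₁one (c := σ c) (φ := φ.map (STm.ren σ)) (by simp) (by simp) ih
  | descL₂one φ c _ ih =>
    have ih := ih σ
    simp only [renamed_cons_l₁, renamed_cons_l₂, Fm.ren_instBody, Fm.map, Tm.ren, STm.ren] at ih ⊢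
    exact .descL₂one (c := σ c) (φ := φ.map (STm.ren σ)) (by simp) (by simp)
      (ih.mono (by simp +contextual))
  | descL₁two φ b c _ _ ih ih' =>
    have ih := ih σ
    have ih' := ih' σ
    simp only [renamed_cons_l₁, renamed_cons_r₂, Fm.ren_instBody, Fm.map, Tm.ren, STm.ren]
      at ih ih' ⊢
    exact .descL₁two (b := σ b) (c := σ c) (φ := φ.map (STm.ren σ)) (by simp) (by simp) (by simp)
      (ih.mono (by simp +contextual)) (ih'.mono (by simp +contextual))
  | descL₂two φ b c _ _ ih ih' =>
    have ih := ih σ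
    have ih' := ih' σ
    simp only [renamed_cons_l₁, renamed_cons_l₂, renamed_cons_r₁, Fm.ren_instBody, Fm.map, Tm.ren,
      STm.ren] at ih ih' ⊢
    exact .descL₂two (b := σ b) (c := σ c) (φ := φ.map (STm.ren σ)) (by simp) (by simp) (by simp)
      (ih.mono (by simp +contextual)) (ih'.mono (by simp +contextual))
  | descR₂ φ c a ha _ _ ih ih' =>
    have ih := ih σ
    simp only [renamed_cons_l₁, renamed_cons_r₂, Fm.ren_instBody, Fm.map, Tm.ren, STm.ren] at ih ⊢
    refine .decompose_descEq_r₂ (c := σ c) (φ := φ.map (STm.ren σ)) (by simp) (by simp)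
      (ih.mono (by simp +contextual)) fun b => ?_
    have ih' := ih' (Function.update σ a b)
    have hφ : φ.map (STm.ren (Function.update σ a b)) = φ.map (STm.ren σ) :=
      Fm.map_congr (p := STm.HasPar a) (fun _ _ => STm.ren_update)
        fun h => ha (descEq c φ) (by simp) (.inr h)
    have hc : Function.update σ a b c = σ c :=
      Function.update_of_ne (fun h => ha (exPar c) (by simp) h) _ _
    rw [renamed_cons_l₁, renamed_cons_l₁, renamed_cons_l₁, renamed_cons_r₂,
      renamed_update _ _ _ _ _ fun ψ hψ => ha ψ (by simp at hψ ⊢; tauto)] at ih'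
    simp only [Fm.ren_instBody, Fm.map, Tm.ren, STm.ren, hφ, hc, Function.update_self] at ih'
    exact ih'.mono (by simp +contextual)
  | descR₁ φ c a ha _ _ ih ih' =>
    have ih := ih σ
    simp only [renamed_cons_l₁, renamed_cons_r₁, Fm.ren_instBody, Fm.map, Tm.ren, STm.ren] at ih ⊢
    refine .decompose_descEq_r₁ (c := σ c) (φ := φ.map (STm.ren σ)) (by simp) (by simp)
      (ih.mono (by simp +contextual)) fun b => ?_
    have ih' := ih' (Function.update σ a b)
    have hφ : φ.map (STm.ren (Function.update σ a b)) = φ.map (STm.ren σ) :=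
      Fm.map_congr (p := STm.HasPar a) (fun _ _ => STm.ren_update)
        fun h => ha (descEq c φ) (by simp) (.inr h)
    have hc : Function.update σ a b c = σ c :=
      Function.update_of_ne (fun h => ha (exPar c) (by simp) h) _ _
    rw [renamed_cons_l₁, renamed_cons_l₁, renamed_cons_r₁, renamed_cons_l₂,
      renamed_update _ _ _ _ _ fun ψ hψ => ha ψ (by simp at hψ ⊢; tauto)] at ih'
    simp only [Fm.ren_instBody, Fm.map, Tm.ren, STm.ren, hφ, hc, Function.update_self] at ih'
    exact ih'.mono (by simp +contextual)

/-! ### Translation of `D` back into the original calculus -/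

/-- The formulas of a bisequent at a given place. -/
def part (p : Pos) (S : Multiset (SF Pr)) : Multiset (Form Pr) :=
  S.filterMap fun X => if X.1 = p then some X.2 else none

@[simp] theorem part_cons (p q : Pos) (φ : Form Pr) (S : Multiset (SF Pr)) :
    part p ((q, φ) ::ₘ S) = if q = p then φ ::ₘ part p S else part p S := by
  by_cases h : q = p <;> simp [part, h]

theorem mem_part {p : Pos} {φ : Form Pr} {S : Multiset (SF Pr)} :
    φ ∈ part p S ↔ (p, φ) ∈ S := by
  simp [part, and_comm]

@[simp] theorem part_signed (Γ Δ Λ Θ : Multiset (Form Pr)) :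
    part .l₁ (signed Γ Δ Λ Θ) = Γ ∧ part .r₁ (signed Γ Δ Λ Θ) = Δ ∧
      part .l₂ (signed Γ Δ Λ Θ) = Λ ∧ part .r₂ (signed Γ Δ Λ Θ) = Θ := by
  have hn : ∀ s : Multiset (Form Pr), s.filterMap (fun _ => (none : Option (Form Pr))) = 0 :=
    fun s => by induction s using Multiset.induction_on <;> simp_all
  refine ⟨?_, ?_, ?_, ?_⟩ <;>
    simp [hn, part, signed, Multiset.filterMap_add, Multiset.filterMap_map, Function.comp_def]

/-- Derivability of the bisequent formed by signed formulas. -/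
@[simp] abbrev DerOf (k : Kleene) (e : Side) (S : Multiset (SF Pr)) : Prop :=
  Der k e (part .l₁ S) (part .r₁ S) (part .l₂ S) (part .r₂ S)

theorem exists_eq_cons {p : Pos} {φ : Form Pr} {S : Multiset (SF Pr)} (h : (p, φ) ∈ S) :
    ∃ Γ, part p S = φ ::ₘ Γ :=
  Multiset.exists_cons_of_mem (mem_part.2 h)

theorem exists_eq_cons_cons {p : Pos} {φ ψ : Form Pr} {S : Multiset (SF Pr)} (hne : φ ≠ ψ)
    (h : (p, φ) ∈ S) (h' : (p, ψ) ∈ S) : ∃ Γ, part p S = φ ::ₘ ψ ::ₘ Γ := by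
  obtain ⟨Γ, hΓ⟩ := exists_eq_cons h
  have := mem_part.2 h'
  rw [hΓ, Multiset.mem_cons] at this
  obtain ⟨Γ', rfl⟩ := Multiset.exists_cons_of_mem (this.resolve_left hne.symm)
  exact ⟨Γ', hΓ⟩

theorem exists_eq_exs_add {P : Form Pr} (hP : IsPredication P) {S : Multiset (SF Pr)}
    (h : ∀ Y ∈ argsEx P, Y ∈ S) : ∃ ts Γ, ListsArgs ts P ∧ part .l₁ S = exs ts + Γ := by
  classical
  obtain ⟨ts, hts⟩ := exists_listsArgs hP
  -- Membership guarantees only one copy of each existence formula, so repetitions in the list of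
  -- arguments are dropped.
  have hle : exs ts.dedup ≤ part .l₁ S := by
    refine (Multiset.le_iff_subset ?_).2 ?_
    · exact (Multiset.nodup_dedup ts).map fun _ _ h => by cases h; rfl
    · intro φ hφ
      obtain ⟨t, ht, rfl⟩ := Multiset.mem_map.1 hφ
      exact mem_part.2 (h _ ⟨t, (hts t).1 (Multiset.mem_dedup.1 ht), rfl⟩)
  obtain ⟨Γ, hΓ⟩ := Multiset.le_iff_exists_add.1 hle
  exact ⟨ts.dedup, Γ, fun t => by rw [Multiset.mem_dedup, hts t], hΓ⟩

/-- Of the premises for all parameters only the one for a parameter fresh for the conclusion is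
used. -/
theorem Der.dec {X : SF Pr} {E Ls} (h : Dec k X E Ls) {S : Multiset (SF Pr)}
    (hE : ∀ Y ∈ E, Y ∈ S) (hL : ∀ L ∈ Ls, DerOf k e (L + S)) : DerOf k e (X ::ₘ S) := by
  cases h with
  | negL₁ φ => simpa using Der.negL₁ φ (by simpa using hL _ rfl)
  | negR₁ φ => simpa using Der.negR₁ φ (by simpa using hL _ rfl)
  | negL₂ φ => simpa using Der.negL₂ φ (by simpa using hL _ rfl)
  | negR₂ φ => simpa using Der.negR₂ φ (by simpa using hL _ rfl)
  | andL₁ φ ψ => simpa using Der.andL₁ φ ψ (by simpa using hL _ rfl)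
  | andR₁ φ ψ =>
    simpa using Der.andR₁ φ ψ (by simpa using hL _ (.inl rfl)) (by simpa using hL _ (.inr rfl))
  | impL₂ φ ψ =>
    simpa using Der.impL₂ φ ψ (by simpa using hL _ (.inl rfl)) (by simpa using hL _ (.inr rfl))
  | impR₂ φ ψ => simpa using Der.impR₂ φ ψ (by simpa using hL _ rfl)
  | andL₂ hk φ ψ => simpa using Der.andL₂ hk φ ψ (by simpa using hL _ rfl)
  | andR₂ hk φ ψ =>
    simpa using Der.andR₂ hk φ ψ (by simpa using hL _ (.inl rfl)) (by simpa using hL _ (.inr rfl))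
  | impL₁ hk φ ψ =>
    simpa using Der.impL₁ hk φ ψ (by simpa using hL _ (.inl rfl)) (by simpa using hL _ (.inr rfl))
  | impR₁ hk φ ψ => simpa using Der.impR₁ hk φ ψ (by simpa using hL _ rfl)
  | andL₂w hk φ ψ =>
    simpa using Der.andL₂w hk φ ψ (by simpa using hL _ (.inl rfl))
      (by simpa using hL _ (.inr (.inl rfl))) (by simpa using hL _ (.inr (.inr rfl)))
  | andR₂w hk φ ψ =>
    simpa using Der.andR₂w hk φ ψ (by simpa using hL _ (.inl rfl))
      (by simpa using hL _ (.inr (.inl rfl))) (by simpa using hL _ (.inr (.inr rfl)))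
  | impR₁w hk φ ψ =>
    simpa using Der.impR₁w hk φ ψ (by simpa using hL _ (.inl rfl))
      (by simpa using hL _ (.inr (.inl rfl))) (by simpa using hL _ (.inr (.inr rfl)))
  | impL₁w hk φ ψ =>
    simpa using Der.impL₁w hk φ ψ (by simpa using hL _ (.inl rfl))
      (by simpa using hL _ (.inr (.inl rfl))) (by simpa using hL _ (.inr (.inr rfl)))
  | allR₁ φ =>
    obtain ⟨a, ha⟩ := exists_fresh (part .l₁ S + (φ.all ::ₘ part .r₁ S) + part .l₂ S + part .r₂ S)
    simpa using Der.allR₁ φ a ha (by simpa using hL _ ⟨a, rfl⟩)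
  | allR₂ φ =>
    obtain ⟨a, ha⟩ := exists_fresh (part .l₁ S + part .r₁ S + part .l₂ S + (φ.all ::ₘ part .r₂ S))
    simpa using Der.allR₂ φ a ha (by simpa using hL _ ⟨a, rfl⟩)
  | exL₂ P hP hd =>
    obtain ⟨ts, Γ, hts, hΓ⟩ := exists_eq_exs_add hP hE
    have := hL _ rfl
    simp [hΓ] at this ⊢
    exact .exL₂ P hP hd ts hts (by simpa using this)
  | exR₁ P hP hd =>
    obtain ⟨ts, Γ, hts, hΓ⟩ := exists_eq_exs_add hP hE
    have := hL _ rfl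
    simp [hΓ] at this ⊢
    exact .exR₁ P hP hd ts hts this
  | exTr₁ t => simpa using Der.exTr₁ t (by simpa using hL _ rfl)
  | exTr₂ t => simpa using Der.exTr₂ t (by simpa using hL _ rfl)
  | descR₂ φ c =>
    obtain ⟨Γ, hΓ⟩ := exists_eq_cons (hE _ rfl)
    obtain ⟨a, ha⟩ := exists_fresh ((exPar c ::ₘ Γ) + part .r₁ S + part .l₂ S +
      (descEq c φ ::ₘ part .r₂ S))
    have h₁ := hL _ (.inl rfl)
    have h₂ := hL _ (.inr ⟨a, rfl⟩)
    simp [hΓ] at h₁ h₂ ⊢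
    exact .descR₂ φ c a ha h₁ (by rwa [Multiset.cons_swap (exPar c)])
  | descR₁ φ c =>
    obtain ⟨Γ, hΓ⟩ := exists_eq_cons (hE _ rfl)
    obtain ⟨a, ha⟩ := exists_fresh ((exPar c ::ₘ Γ) + (descEq c φ ::ₘ part .r₁ S) + part .l₂ S +
      part .r₂ S)
    have h₁ := hL _ (.inl rfl)
    have h₂ := hL _ (.inr ⟨a, rfl⟩)
    simp [hΓ] at h₁ h₂ ⊢
    exact .descR₁ φ c a ha h₁ h₂

theorem Der.ret {Q : Set (SF Pr)} {Ls} (h : Ret e Q Ls) {S : Multiset (SF Pr)}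
    (hQ : ∀ Y ∈ Q, Y ∈ S) (hL : ∀ L ∈ Ls, DerOf k e (L + S)) : DerOf k e S := by
  cases h with
  | axLeftLeft A hA =>
    obtain ⟨Γ, hΓ⟩ := exists_eq_cons (hQ (L₁ A) (by simp))
    obtain ⟨Δ, hΔ⟩ := exists_eq_cons (hQ (R₁ A) (by simp))
    rw [DerOf, hΓ, hΔ]
    exact .axLeftLeft A hA
  | axRightRight A hA =>
    obtain ⟨Γ, hΓ⟩ := exists_eq_cons (hQ (L₂ A) (by simp))
    obtain ⟨Δ, hΔ⟩ := exists_eq_cons (hQ (R₂ A) (by simp))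
    rw [DerOf, hΓ, hΔ]
    exact .axRightRight A hA
  | axLeftRight A hA =>
    obtain ⟨Γ, hΓ⟩ := exists_eq_cons (hQ (L₁ A) (by simp))
    obtain ⟨Δ, hΔ⟩ := exists_eq_cons (hQ (R₂ A) (by simp))
    rw [DerOf, hΓ, hΔ]
    exact .axLeftRight A hA
  | axExists P hP =>
    obtain ⟨ts, Γ, hts, hΓ⟩ := exists_eq_exs_add hP fun Y hY => hQ Y (.inr hY)
    obtain ⟨Δ, hΔ⟩ := exists_eq_cons (hQ (R₁ P) (by simp))
    obtain ⟨Λ, hΛ⟩ := exists_eq_cons (hQ (L₂ P) (by simp))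
    rw [DerOf, hΓ, hΔ, hΛ]
    exact .axExists P hP ts hts
  | allL₁ φ b =>
    obtain ⟨Γ, hΓ⟩ := exists_eq_cons_cons (by simp) (hQ (L₁ (exPar b)) (by simp))
      (hQ (L₁ φ.all) (by simp))
    have := hL _ rfl
    simp [hΓ] at this ⊢
    refine .allL₁ φ b ?_
    rwa [Multiset.cons_swap φ.all, Multiset.cons_swap (exPar b)]
  | allL₂ φ b =>
    obtain ⟨Γ, hΓ⟩ := exists_eq_cons (hQ (L₁ (exPar b)) (by simp))
    obtain ⟨Λ, hΛ⟩ := exists_eq_cons (hQ (L₂ φ.all) (by simp))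
    have := hL _ rfl
    simp [hΓ, hΛ] at this ⊢
    refine .allL₂ φ b ?_
    rwa [Multiset.cons_swap φ.all]
  | exL₁ P hP hd t ht =>
    obtain ⟨Γ, hΓ⟩ := exists_eq_cons (hQ (L₁ P) (by simp))
    have := hL _ rfl
    simp [hΓ] at this ⊢
    exact .exL₁ P hP hd t ht this
  | exR₂ P hP hd t ht =>
    obtain ⟨Θ, hΘ⟩ := exists_eq_cons (hQ (R₂ P) (by simp))
    have := hL _ rfl
    simp [hΘ] at this ⊢
    exact .exR₂ P hP hd t ht this
  | replSecond he t s I hI A At As ht hs =>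
    exact .replSecond he t s I hI A At As ht hs (by simpa using hL _ (.inl rfl))
      (by simpa using hL _ (.inr (.inl rfl))) (by simpa using hL _ (.inr (.inr rfl)))
  | replFirst he t s I hI A At As ht hs =>
    exact .replFirst he t s I hI A At As ht hs (by simpa using hL _ (.inl rfl))
      (by simpa using hL _ (.inr (.inl rfl))) (by simpa using hL _ (.inr (.inr rfl)))
  | eqRefl t =>
    obtain ⟨Γ, hΓ⟩ := exists_eq_cons (hQ (L₁ (.ex t)) (by simp))
    have := hL _ rfl
    simp [hΓ] at this ⊢
    exact .eqRefl t this
  | exDesc φ =>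
    obtain ⟨Γ, hΓ⟩ := exists_eq_cons (hQ (L₁ (.ex (.desc φ))) (by simp))
    obtain ⟨a, ha⟩ := exists_fresh ((.ex (.desc φ) ::ₘ Γ) + part .r₁ S + part .l₂ S + part .r₂ S)
    have := hL _ ⟨a, rfl⟩
    simp [hΓ] at this ⊢
    exact .exDesc φ a ha this
  | descL₁one φ c =>
    obtain ⟨Γ, hΓ⟩ := exists_eq_cons_cons (by simp) (hQ (L₁ (descEq c φ)) (by simp))
      (hQ (L₁ (exPar c)) (by simp))
    have := hL _ rfl
    simp [hΓ] at this ⊢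
    exact .descL₁one φ c this
  | descL₂one φ c =>
    obtain ⟨Γ, hΓ⟩ := exists_eq_cons (hQ (L₁ (exPar c)) (by simp))
    obtain ⟨Λ, hΛ⟩ := exists_eq_cons (hQ (L₂ (descEq c φ)) (by simp))
    have := hL _ rfl
    simp [hΓ, hΛ] at this ⊢
    exact .descL₂one φ c this
  | descL₁two φ b c hbc =>
    -- Distinctness ensures that the two existence formulas are separate members of the multiset.
    have hne : exPar (Pr := Pr) b ≠ exPar c := by simpa using hbc
    obtain ⟨Γ, hΓ⟩ := exists_eq_cons_cons hne (hQ (L₁ (exPar b)) (by simp))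
      (hQ (L₁ (exPar c)) (by simp))
    have hmem := mem_part.2 (hQ (L₁ (descEq c φ)) (by simp))
    rw [hΓ] at hmem
    obtain ⟨Γ, rfl⟩ := Multiset.exists_cons_of_mem (show descEq c φ ∈ Γ by simpa using hmem)
    rw [Multiset.cons_swap (exPar c), Multiset.cons_swap (exPar b)] at hΓ
    have h₁ := hL _ (.inl rfl)
    have h₂ := hL _ (.inr rfl)
    simp [hΓ] at h₁ h₂ ⊢
    exact .descL₁two φ b c h₁ h₂
  | descL₂two φ b c hbc =>
    have hne : exPar (Pr := Pr) b ≠ exPar c := by simpa using hbc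
    obtain ⟨Γ, hΓ⟩ := exists_eq_cons_cons hne (hQ (L₁ (exPar b)) (by simp))
      (hQ (L₁ (exPar c)) (by simp))
    obtain ⟨Λ, hΛ⟩ := exists_eq_cons (hQ (L₂ (descEq c φ)) (by simp))
    have h₁ := hL _ (.inl rfl)
    have h₂ := hL _ (.inr rfl)
    simp [hΓ, hΛ] at h₁ h₂ ⊢
    exact .descL₂two φ b c h₁ h₂

theorem D.toDer {S : Multiset (SF Pr)} (h : D k e S) : DerOf k e S := by
  induction h with
  | dec h hE _ ih => exact .dec h hE ih
  | ret h hQ _ ih => exact .ret h hQ ih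

theorem der_iff {Γ Δ Λ Θ : Multiset (Form Pr)} : Der k e Γ Δ Λ Θ ↔ D k e (signed Γ Δ Λ Θ) := by
  constructor
  · intro h
    have := h.toD id
    rwa [renamed, Multiset.map_congr rfl fun X _ => show SF.ren id X = id X from
      congrArg (Prod.mk X.1) (Fm.ren_id X.2), Multiset.map_id] at this
  · intro h
    simpa using h.toDer

theorem signed_add (Γ Δ Λ Θ Γ' Δ' Λ' Θ' : Multiset (Form Pr)) :
    signed (Γ + Γ') (Δ + Δ') (Λ + Λ') (Θ + Θ') = signed Γ Δ Λ Θ + signed Γ' Δ' Λ' Θ' := by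
  simp only [signed, Multiset.map_add]
  abel

end NFL

/-! ### The six cut rules -/

theorem mainTheorem1 {Pr : ℕ → Type*} (k : NFL.Kleene) (e : NFL.Side) :
    -- (E-Cut)
    (∀ (t : NFL.Tm Pr 0) (Γ Δ Λ Θ Γ' Δ' Λ' Θ' : Multiset (NFL.Form Pr)),
      NFL.Der k e Γ Δ Λ (.ex t ::ₘ Θ) →
      NFL.Der k e (.ex t ::ₘ Γ') Δ' Λ' Θ' →
      NFL.Der k e (Γ + Γ') (Δ + Δ') (Λ + Λ') (Θ + Θ')) ∧
    -- (L-Cut)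
    (∀ (P : NFL.Form Pr) (ts : Multiset (NFL.Tm Pr 0))
        (Γ Δ Λ Θ Γ' Δ' Λ' Θ' : Multiset (NFL.Form Pr)),
      NFL.IsPredication P → NFL.ListsArgs ts P →
      NFL.Der k e (NFL.exs ts + Γ) Δ Λ (P ::ₘ Θ) →
      NFL.Der k e (NFL.exs ts + (P ::ₘ Γ')) Δ' Λ' Θ' →
      NFL.Der k e (NFL.exs ts + Γ + Γ') (Δ + Δ') (Λ + Λ') (Θ + Θ')) ∧
    -- (O-Cut)
    (∀ (φ : NFL.Form Pr) (Γ Δ Λ Θ Γ' Δ' Λ' Θ' : Multiset (NFL.Form Pr)),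
      NFL.Der k e Γ (φ ::ₘ Δ) Λ Θ →
      NFL.Der k e (φ ::ₘ Γ') Δ' Λ' Θ' →
      NFL.Der k e (Γ + Γ') (Δ + Δ') (Λ + Λ') (Θ + Θ')) ∧
    -- (I-Cut)
    (∀ (φ : NFL.Form Pr) (Γ Δ Λ Θ Γ' Δ' Λ' Θ' : Multiset (NFL.Form Pr)),
      NFL.Der k e Γ Δ Λ (φ ::ₘ Θ) →
      NFL.Der k e Γ' Δ' (φ ::ₘ Λ') Θ' →
      NFL.Der k e (Γ + Γ') (Δ + Δ') (Λ + Λ') (Θ + Θ')) ∧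
    -- (R-Cut)
    (∀ (φ : NFL.Form Pr) (Γ Δ Λ Θ Γ' Δ' Λ' Θ' : Multiset (NFL.Form Pr)),
      NFL.Der k e Γ Δ (φ ::ₘ Λ) Θ →
      NFL.Der k e Γ' (φ ::ₘ Δ') Λ' Θ' →
      NFL.Der k e (Γ + Γ') (Δ + Δ') (Λ + Λ') (Θ + Θ')) ∧
    -- (3-Cut)
    (∀ (φ : NFL.Form Pr)
        (Γ₁ Δ₁ Λ₁ Θ₁ Γ₂ Δ₂ Λ₂ Θ₂ Γ₃ Δ₃ Λ₃ Θ₃ : Multiset (NFL.Form Pr)),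
      NFL.Der k e (φ ::ₘ Γ₁) Δ₁ Λ₁ Θ₁ →
      NFL.Der k e Γ₂ Δ₂ Λ₂ (φ ::ₘ Θ₂) →
      NFL.Der k e Γ₃ (φ ::ₘ Δ₃) (φ ::ₘ Λ₃) Θ₃ →
      NFL.Der k e (Γ₁ + Γ₂ + Γ₃) (Δ₁ + Δ₂ + Δ₃) (Λ₁ + Λ₂ + Λ₃) (Θ₁ + Θ₂ + Θ₃)) := by
  simp only [NFL.der_iff, NFL.signed_add]
  simp only [NFL.signed_add_l₁, NFL.signed_cons_l₁, NFL.signed_cons_r₁, NFL.signed_cons_l₂,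
    NFL.signed_cons_r₂]
  refine ⟨?_, ?_, ?_, ?_, ?_, ?_⟩
  · intro t _ _ _ _ _ _ _ _ h₁ h₂
    exact NFL.D.cut_ex (t := t) (h₁.mono (by simp +contextual)) (h₂.mono (by simp +contextual))
  · intro P ts Γ Δ Λ Θ _ _ _ _ hP hts h₁ h₂
    -- L-Cut is a 3-Cut whose undefined case is the existence axiom.
    refine (NFL.cut P).three (h₂.mono ?_) (h₁.mono ?_) (.ret (.axExists P hP) ?_ (by simp))
    · simp +contextual only [Multiset.mem_add, Multiset.mem_cons]
      tauto
    · simp +contextual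
    · rintro Y (hY | ⟨t, ht, rfl⟩)
      · rcases hY with rfl | rfl <;> simp
      · simp [NFL.exs, (hts t).2 ht]
  · intro φ _ _ _ _ _ _ _ _ h₁ h₂
    exact (NFL.cut φ).outer (h₁.mono (by simp +contextual)) (h₂.mono (by simp +contextual))
  · intro φ _ _ _ _ _ _ _ _ h₁ h₂
    exact (NFL.cut φ).inner (h₁.mono (by simp +contextual)) (h₂.mono (by simp +contextual))
  · intro φ _ _ _ _ _ _ _ _ h₁ h₂
    -- R-Cut: a refutation of "not false" also refutes "true", so an O-Cut suffices.
    exact (NFL.cut φ).outer (h₂.mono (by simp +contextual))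
      ((NFL.cut φ).l₁_of_l₂ (h₁.mono (by simp +contextual)))
  · intro φ _ _ _ _ _ _ _ _ _ _ _ _ h₁ h₂ h₃
    exact (NFL.cut φ).three (h₁.mono (by simp +contextual)) (h₂.mono (by simp +contextual))
      (h₃.mono (by simp +contextual))
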